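/- All groups are finite. For a group $G$ and a subset $S\subseteq G$, let $\mathrm{Cay}(G,S)$ be the digraph with vertex set $G$ in which $(x,y)$ is an arc if and only if $yx^{-1}\in S$; $G$ acts on it by automorphisms via right multiplication. We say that $G$ admits an oriented regular representation (ORR) if there is a subset $S\subseteq G$ with $S\cap S^{-1}=\emptyset$ such that $\mathrm{Aut}(\mathrm{Cay}(G,S))=G$, that is, every automorphism of $\mathrm{Cay}(G,S)$ is a right multiplication $x\mapsto xg$ with $g\in G$. We say that $G$ is generalized dihedral if $G$ contains an abelian subgroup $A$ with $|G:A|=2$ and an element $\tau\in G\setminus A$ such that $\tau^2=1$ and $\tau^{-1}a\tau=a^{-1}$ for every $a\in A$. Let $d(G)$ denote the minimum cardinality of a generating set of $G$, let $C_n$ be the cyclic group of order $n$, and write $x^z=z^{-1}xz$. Theorem. Let $G$ be a finite group with $d(G)=3$. Then one of the following holds: (i) $G$ is generalized dihedral; (ii) $G$ admits an ORR; (iii) $G$ is isomorphic to one of the following four groups: - $C_4\times C_2^2$, - $C_3\times C_2^3$, - $\langle x,y,z\mid x^4=y^4=z^4=(xy)^2=(xy^{-1})^2=(xz)^2=(xz^{-1})^2=(yz)^2=(yz^{-1})^2=x^2y^2z^2=1\rangle$,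 which has order $32$, - $\langle x,y,z\mid x^4=y^4=z^4=(yx)^2=(yx^{-1})^2=(yz)^2=(yz^{-1})^2=1,\ x^2=z^2,\ x^z=x^{-1},\ x^2=y^2\rangle$, which has order $16$. Furthermore, the generalized dihedral groups $G$ with $d(G)=3$ and the four groups listed in (iii) admit no ORR. -/

import Mathlib

namespace ORR

open scoped Pointwise

/-- The Cayley digraph `Cay(G, S)`: vertex set `G`, with an arc `(x, y)` iff `y x⁻¹ ∈ S`. -/
def cayley {G : Type*} [Group G] (S : Set G) : Digraph G where
  Adj x y := y * x⁻¹ ∈ S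

/-- The automorphism group of a digraph, as a group of permutations of its vertices. -/
def digraphAut {V : Type*} (Γ : Digraph V) : Subgroup (Equiv.Perm V) where
  carrier := {φ | ∀ x y, Γ.Adj (φ x) (φ y) ↔ Γ.Adj x y}
  mul_mem' := fun {φ ψ} hφ hψ x y => (hφ (ψ x) (ψ y)).trans (hψ x y)
  one_mem' := fun _ _ => Iff.rfl
  inv_mem' := fun {φ} hφ x y => by
    have h := hφ (φ⁻¹ x) (φ⁻¹ y)
    simpa using h.symm

/-- The image of the right regular representation of `G` in `Sym(G)`: the group of all
right translations `x ↦ x g`. -/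
def rightRegular (G : Type*) [Group G] : Subgroup (Equiv.Perm G) :=
  (MulAction.toPermHom Gᵐᵒᵖ G).range

/-- `G` admits an oriented regular representation: for some `S ⊆ G` with `S ∩ S⁻¹ = ∅`, the full
automorphism group of `Cay(G, S)` is `G` in its right regular representation. -/
def AdmitsORR (G : Type*) [Group G] : Prop :=
  ∃ S : Set G, S ∩ S⁻¹ = ∅ ∧ digraphAut (cayley S) = rightRegular G

/-- `G` is generalized dihedral: it has an abelian subgroup `A` of index `2` and an element
`τ ∉ A` with `τ² = 1` that inverts every element of `A` by conjugation. -/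
def IsGeneralizedDihedral (G : Type*) [Group G] : Prop :=
  ∃ A : Subgroup G, (∀ a ∈ A, ∀ b ∈ A, a * b = b * a) ∧ A.index = 2 ∧
    ∃ τ : G, τ ∉ A ∧ τ ^ 2 = 1 ∧ ∀ a ∈ A, τ⁻¹ * a * τ = a⁻¹

/-- The cyclic group of order `n` (for `n ≥ 1`), written multiplicatively. -/
abbrev C (n : ℕ) : Type := Multiplicative (ZMod n)

/-- The relators of `Group32`, as words in `x`, `y`, `z`. -/
def relators32 {F : Type*} [Group F] (x y z : F) : Set F :=
  {x ^ 4, y ^ 4, z ^ 4, (x * y) ^ 2, (x * y⁻¹) ^ 2, (x * z) ^ 2, (x * z⁻¹) ^ 2,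
    (y * z) ^ 2, (y * z⁻¹) ^ 2, x ^ 2 * y ^ 2 * z ^ 2}

/-- The relators of `Group16`, as words in `x`, `y`, `z`. The last three express
`x² = z²`, `z⁻¹ x z = x⁻¹` and `x² = y²`. -/
def relators16 {F : Type*} [Group F] (x y z : F) : Set F :=
  {x ^ 4, y ^ 4, z ^ 4, (y * x) ^ 2, (y * x⁻¹) ^ 2, (y * z) ^ 2, (y * z⁻¹) ^ 2,
    x ^ 2 * (z ^ 2)⁻¹, z⁻¹ * x * z * (x⁻¹)⁻¹, x ^ 2 * (y ^ 2)⁻¹}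

/-- `⟨x, y, z ∣ x⁴ = y⁴ = z⁴ = (xy)² = (xy⁻¹)² = (xz)² = (xz⁻¹)² = (yz)² = (yz⁻¹)² = x²y²z² = 1⟩` -/
abbrev Group32 : Type :=
  PresentedGroup
    (relators32 (FreeGroup.of (0 : Fin 3)) (FreeGroup.of (1 : Fin 3)) (FreeGroup.of (2 : Fin 3)))

/-- `⟨x, y, z ∣ x⁴ = y⁴ = z⁴ = (yx)² = (yx⁻¹)² = (yz)² = (yz⁻¹)² = 1, x² = z², xᶻ = x⁻¹, x² = y²⟩` -/
abbrev Group16 : Type :=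
  PresentedGroup
    (relators16 (FreeGroup.of (0 : Fin 3)) (FreeGroup.of (1 : Fin 3)) (FreeGroup.of (2 : Fin 3)))

/-- `G` is isomorphic to one of the four exceptional groups. -/
def IsExceptional (G : Type*) [Group G] : Prop :=
  Nonempty (G ≃* C 4 × (Fin 2 → C 2)) ∨ Nonempty (G ≃* C 3 × (Fin 3 → C 2)) ∨
    Nonempty (G ≃* Group32) ∨ Nonempty (G ≃* Group16)

end ORR

namespace ORR

/-! ### Rigidity criteria for oriented regular representations -/

section Criteria

variable {G : Type*} [Group G]

/-! An automorphism of `Cay(G, S)` that fixes `1` permutes `S` and preserves the digraph induced on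
`S`. If this forces it to fix a generating set, then translations show that it is trivial. Because
`d(G) = 3`, a set `T` inside `⟨x, y⟩` can be completed by a third generator `z`, which is isolated
in the digraph induced on `T ∪ {z}`; only the rigidity of `T` matters (`admitsORR_of_rigid`). Unless
`G` is generalized dihedral, `z` can be chosen with `z² ≠ 1` (`exists_completion`). The sets `{x, y,
yx⁻¹}`, `{x, y, xy, x²y}` and `{x, x², y, x²y}` are rigid outside a few relations, so in a group
that is neither generalized dihedral nor has an ORR every pair in a generating triple satisfies one
of these relations (`pair_cases`, `commute_cases`).

If a member `x` of some generating triple has `x⁴ ≠ 1`, the relations make `G` abelian and leave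
`C₃³`, which has an explicit ORR, and `C₃ × C₂³`. Otherwise the squares of all members of generating
triples are central of order at most `2`, and squaring behaves like a quadratic map on the seven
points `x, y, z, xy, xz, yz, xyz` of the Fano plane. On each line some square is trivial or all
three coincide (`CentralSquares.line`). Changes of basis then reduce to a short list: a generalized
dihedral group, groups of orders `16`, `32`, `64` with explicit ORRs, and the exceptional groups.
They are identified with concrete models `Quad d`, where minimality of the generating triple
replaces a count of the order.

Conversely, a generalized dihedral group has only involutions outside `A`, so `S` lies in `A` and
the two cosets of `A` can be translated independently. For an exceptional group, every admissible
`S` is preserved by a nontrivial group automorphism. -/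

theorem mem_digraphAut_cayley {S : Set G} {φ : Equiv.Perm G} :
    φ ∈ digraphAut (cayley S) ↔ ∀ x y, φ y * (φ x)⁻¹ ∈ S ↔ y * x⁻¹ ∈ S := Iff.rfl

theorem mem_rightRegular {φ : Equiv.Perm G} : φ ∈ rightRegular G ↔ ∃ g, ∀ x, φ x = x * g := by
  constructor
  · rintro ⟨g, rfl⟩
    exact ⟨g.unop, fun x => rfl⟩
  · rintro ⟨g, hg⟩
    exact ⟨MulOpposite.op g, Equiv.ext fun x => (hg x).symm⟩

theorem mulRight_mem_digraphAut (S : Set G) (g : G) :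
    Equiv.mulRight g ∈ digraphAut (cayley S) := by
  intro x y
  simp [cayley, mul_assoc]

/-- The elements fixed by all automorphisms of `Cay(G, S)` that fix `1` form a subgroup. -/
theorem fixes_closure [Finite G] {S X : Set G}
    (h : ∀ φ ∈ digraphAut (cayley S), φ 1 = 1 → ∀ x ∈ X, φ x = x) {g : G}
    (hg : g ∈ Subgroup.closure X) : ∀ φ ∈ digraphAut (cayley S), φ 1 = 1 → φ g = g := by
  -- In a finite group the submonoid closure suffices, so inverses need no treatment.
  rw [← Subgroup.mem_toSubmonoid, Subgroup.closure_toSubmonoid_of_finite] at hg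
  induction hg using Submonoid.closure_induction with
  | mem x hx => exact fun φ hφ h1 => h φ hφ h1 x hx
  | one => exact fun φ _ h1 => h1
  | mul a b _ _ iha ihb =>
    intro φ hφ h1
    have hb := ihb φ hφ h1
    -- The automorphism `g ↦ φ(gb)b⁻¹` fixes `1` because `φ` fixes `b`; that it fixes `a` means that
    -- `φ` fixes `ab`.
    have h2 := iha (Equiv.mulRight b⁻¹ * φ * Equiv.mulRight b)
      (mul_mem (mul_mem (mulRight_mem_digraphAut S _) hφ) (mulRight_mem_digraphAut S _))
      (by simp [hb])
    simpa [mul_inv_eq_iff_eq_mul] using h2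

/-- If the automorphisms of `Cay(G, S)` fixing `1` fix a generating set pointwise, they are
trivial. -/
theorem digraphAut_eq_rightRegular [Finite G] {S X : Set G} (hX : Subgroup.closure X = ⊤)
    (h : ∀ φ ∈ digraphAut (cayley S), φ 1 = 1 → ∀ x ∈ X, φ x = x) :
    digraphAut (cayley S) = rightRegular G := by
  ext φ
  rw [mem_rightRegular]
  constructor
  · intro hφ
    refine ⟨φ 1, fun x => ?_⟩
    have := fixes_closure h (hX ▸ Subgroup.mem_top x) (Equiv.mulRight (φ 1)⁻¹ * φ)
      (mul_mem (mulRight_mem_digraphAut S _) hφ) (by simp)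
    simpa [mul_inv_eq_iff_eq_mul] using this
  · rintro ⟨g, hg⟩
    have : φ = Equiv.mulRight g := Equiv.ext hg
    exact this ▸ mulRight_mem_digraphAut S g

theorem apply_mem_iff {S : Set G} {φ : Equiv.Perm G} (hφ : φ ∈ digraphAut (cayley S))
    (h1 : φ 1 = 1) (x : G) : φ x ∈ S ↔ x ∈ S := by
  simpa [h1] using (mem_digraphAut_cayley.1 hφ) 1 x

theorem inter_inv_eq_empty {S : Set G} (h : ∀ a ∈ S, ∀ b ∈ S, a * b ≠ 1) : S ∩ S⁻¹ = ∅ := by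
  ext a
  simp only [Set.mem_inter_iff, Set.mem_inv, Set.mem_empty_iff_false, iff_false, not_and]
  intro ha hb
  exact h a ha _ hb (mul_inv_cancel a)

/-- The relation on `Option ι` that extends `R` by an isolated point. -/
def isolated {ι : Type*} (R : ι → ι → Bool) : Option ι → Option ι → Bool
  | some i, some j => R i j
  | _, _ => false

/-- A set `T` whose induced digraph determines enough of its vertices gives an oriented regular
representation together with one further generator. -/
theorem admitsORR_of_rigid [Finite G] {ι : Type*} [Finite ι] (e : ι → G) (z : G) (I : Set ι)
    (R : ι → ι → Bool) (he : Function.Injective e)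
    (hz : z ∉ Subgroup.closure (Set.range e))
    (hgen : Subgroup.closure (insert z (Set.range e)) = ⊤)
    (hI : ∀ i, e i ∈ Subgroup.closure (e '' I))
    (hS : ∀ i j, e i * e j ≠ 1) (hz2 : z * z ≠ 1) (hzz : ∀ i, z * z ≠ e i)
    (hR : ∀ i j, (∃ k, e k * e i = e j) ↔ R i j = true)
    (hrigid : ∀ σ : Equiv.Perm (Option ι),
      (∀ a b, isolated R (σ a) (σ b) = isolated R a b) → ∀ i ∈ I, σ (some i) = some i) :
    AdmitsORR G := by
  classical
  set S : Set G := insert z (Set.range e) with hSdef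
  have hmem : ∀ i, e i ∈ Subgroup.closure (Set.range e) := fun i =>
    Subgroup.subset_closure ⟨i, rfl⟩
  have hne : ∀ i, e i ≠ 1 := fun i h => hS i i (by rw [h, one_mul])
  refine ⟨S, inter_inv_eq_empty ?_, digraphAut_eq_rightRegular hgen ?_⟩
  · rintro a (rfl | ⟨i, rfl⟩) b (rfl | ⟨j, rfl⟩)
    · exact hz2
    · exact fun h => hz (by rw [mul_eq_one_iff_eq_inv.1 h]; exact inv_mem (hmem j))
    · exact fun h => hz (by rw [← inv_eq_iff_mul_eq_one.2 h]; exact inv_mem (hmem i))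
    · exact hS i j
  let f : Option ι → G := fun o => o.elim z e
  have hf : Function.Injective f := by
    rintro (_ | i) (_ | j) hij
    · rfl
    · have hij : z = e j := hij
      exact absurd (hij ▸ hmem j) hz
    · have hij : e i = z := hij
      exact absurd (hij ▸ hmem i) hz
    · exact congrArg some (he hij)
  have hfS : Set.range f = S := by
    ext g
    constructor
    · rintro ⟨_ | i, rfl⟩
      · exact Or.inl rfl
      · exact Or.inr ⟨i, rfl⟩
    · rintro (rfl | ⟨i, rfl⟩)
      · exact ⟨none, rfl⟩
      · exact ⟨some i, rfl⟩
  -- An arc at `z` would put `z` into the subgroup generated by the `e i`, or would need `e i = 1`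
  -- or `z * z = e j`, and all of these are excluded.
  have hadj : ∀ a b, f b * (f a)⁻¹ ∈ S ↔ isolated R a b = true := by
    have hzm : ∀ {k : ι} {t : G}, t ∈ Subgroup.closure (Set.range e) → e k ≠ z * t ∧
        e k ≠ t * z := by
      intro k t ht
      refine ⟨fun h => hz ?_, fun h => hz ?_⟩
      · rw [← mul_inv_eq_iff_eq_mul.2 h]
        exact mul_mem (hmem k) (inv_mem ht)
      · rw [← inv_mul_eq_iff_eq_mul.2 h]
        exact mul_mem (inv_mem ht) (hmem k)
    rintro (_ | i) (_ | j)
    · simp only [f, Option.elim, mul_inv_cancel, isolated, Bool.false_eq_true, iff_false]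
      rintro (h | ⟨i, h⟩)
      · exact hz (h ▸ one_mem _)
      · exact hne i h
    · simp only [f, Option.elim, isolated, Bool.false_eq_true, iff_false]
      rintro (h | ⟨i, h⟩)
      · exact hzz j (mul_inv_eq_iff_eq_mul.1 h).symm
      · exact (hzm (hmem i)).2 (eq_mul_inv_iff_mul_eq.1 h).symm
    · simp only [f, Option.elim, isolated, Bool.false_eq_true, iff_false]
      rintro (h | ⟨k, h⟩)
      · exact hne i (by simpa using h)
      · exact (hzm (inv_mem (hmem i))).1 h
    · simp only [f, Option.elim, isolated, ← hR]
      constructor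
      · rintro (h | ⟨k, h⟩)
        · exact absurd (h ▸ mul_mem (hmem j) (inv_mem (hmem i))) hz
        · exact ⟨k, by rw [h]; simp⟩
      · rintro ⟨k, h⟩
        exact Or.inr ⟨k, by rw [← h]; simp⟩
  have hI' : ∀ φ ∈ digraphAut (cayley S), φ 1 = 1 → ∀ g ∈ e '' I, φ g = g := by
    intro φ hφ h1
    have hφf : ∀ o, ∃ o', f o' = φ (f o) := by
      intro o
      have : φ (f o) ∈ S := (apply_mem_iff hφ h1 _).2 (hfS ▸ ⟨o, rfl⟩)
      rwa [← hfS] at this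
    choose σ hσ using hφf
    have hσi : Function.Injective σ := by
      intro a b hab
      exact hf (φ.injective (by rw [← hσ, ← hσ, hab]))
    let σ' : Equiv.Perm (Option ι) := Equiv.ofBijective σ (Finite.injective_iff_bijective.1 hσi)
    have hfixI := hrigid σ' (by
      intro a b
      rw [Bool.eq_iff_iff, ← hadj, ← hadj]
      change f (σ b) * (f (σ a))⁻¹ ∈ S ↔ _
      rw [hσ, hσ]
      exact mem_digraphAut_cayley.1 hφ _ _)
    rintro g ⟨i, hi, rfl⟩
    have := hσ (some i)
    rw [show σ (some i) = some i from hfixI i hi] at this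
    exact this.symm
  have hall : ∀ φ ∈ digraphAut (cayley S), φ 1 = 1 → ∀ i, φ (e i) = e i :=
    fun φ hφ h1 i => fixes_closure hI' (hI i) φ hφ h1
  rintro φ hφ h1 g (rfl | ⟨i, rfl⟩)
  -- The other elements of `S` are already fixed, so `z` is the only possible image of `z`.
  · rcases (apply_mem_iff hφ h1 g).2 (Or.inl rfl) with h | ⟨i, hi⟩
    · exact h
    · rw [← hall φ hφ h1 i] at hi
      exact absurd (φ.injective hi ▸ hmem i) hz
  · exact hall φ hφ h1 i

end Criteria

/-! ### Generating triples and generalized dihedral groups -/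

section Dihedral

variable {G : Type*} [Group G]

/-- `closure {x, y, z} = ⊤`. -/
def Generates (x y z : G) : Prop := Subgroup.closure {x, y, z} = ⊤

theorem Generates.trans {x y z x' y' z' : G} (h : Generates x y z)
    (hx : x ∈ Subgroup.closure {x', y', z'}) (hy : y ∈ Subgroup.closure {x', y', z'})
    (hz : z ∈ Subgroup.closure {x', y', z'}) : Generates x' y' z' := by
  refine top_le_iff.1 (h ▸ (Subgroup.closure_le _).2 ?_)
  rintro g (rfl | rfl | rfl) <;> assumption

theorem mem₁ (x y z : G) : x ∈ Subgroup.closure {x, y, z} := Subgroup.subset_closure (by simp)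
theorem mem₂ (x y z : G) : y ∈ Subgroup.closure {x, y, z} := Subgroup.subset_closure (by simp)
theorem mem₃ (x y z : G) : z ∈ Subgroup.closure {x, y, z} := Subgroup.subset_closure (by simp)

theorem left_mem (x y : G) : x ∈ Subgroup.closure {x, y} := Subgroup.subset_closure (by simp)
theorem right_mem (x y : G) : y ∈ Subgroup.closure {x, y} := Subgroup.subset_closure (by simp)

theorem Generates.swap₁₂ {x y z : G} (h : Generates x y z) : Generates y x z :=
  h.trans (mem₂ _ _ _) (mem₁ _ _ _) (mem₃ _ _ _)

theorem Generates.swap₂₃ {x y z : G} (h : Generates x y z) : Generates x z y :=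
  h.trans (mem₁ _ _ _) (mem₃ _ _ _) (mem₂ _ _ _)

/-- Replacing the last generator by a product `a * z * b` with `a`, `b` generated by the
others. -/
theorem Generates.mul₃ {x y z a b : G} (h : Generates x y z)
    (ha : a ∈ Subgroup.closure {x, y}) (hb : b ∈ Subgroup.closure {x, y}) :
    Generates x y (a * z * b) := by
  have hle : Subgroup.closure {x, y} ≤ Subgroup.closure {x, y, a * z * b} :=
    Subgroup.closure_mono (by intro g; simp; tauto)
  refine h.trans (mem₁ _ _ _) (mem₂ _ _ _) ?_
  have := mul_mem (mul_mem (inv_mem (hle ha)) (mem₃ x y (a * z * b))) (inv_mem (hle hb))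
  simpa [mul_assoc] using this

theorem Generates.mul₃_left {x y z a : G} (h : Generates x y z)
    (ha : a ∈ Subgroup.closure {x, y}) : Generates x y (a * z) := by
  simpa using h.mul₃ ha (one_mem _)

theorem Generates.mul₃_right {x y z b : G} (h : Generates x y z)
    (hb : b ∈ Subgroup.closure {x, y}) : Generates x y (z * b) := by
  simpa using h.mul₃ (one_mem _) hb

theorem Generates.inv₁ {x y z : G} (h : Generates x y z) : Generates x⁻¹ y z :=
  h.trans ((inv_mem_iff).1 (mem₁ _ _ _)) (mem₂ _ _ _) (mem₃ _ _ _)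

/-- Two commuting elements, both inverted by an involution outside the subgroup they generate. -/
theorem isGeneralizedDihedral_of_inverts {H : Subgroup G} {t : G} (ht : t ∉ H) (ht2 : t ^ 2 = 1)
    (hinv : ∀ a ∈ H, t⁻¹ * a * t = a⁻¹) (hgen : H ⊔ Subgroup.closure {t} = ⊤) :
    IsGeneralizedDihedral G := by
  have htt : t⁻¹ = t := inv_eq_of_mul_eq_one_left (by rw [← pow_two, ht2])
  refine ⟨H, ?_, ?_, t, ht, ht2, hinv⟩
  · intro a ha b hb
    have h1 := hinv _ (mul_mem ha hb)
    have h2 : t⁻¹ * (a * b) * t = (t⁻¹ * a * t) * (t⁻¹ * b * t) := by group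
    rw [h1, hinv a ha, hinv b hb] at h2
    have := congrArg Inv.inv h2
    simpa using this
  · rw [Subgroup.index_eq_two_iff]
    refine ⟨t, fun b => ?_⟩
    have hcov : ∀ b : G, b ∈ H ∨ b * t ∈ H := by
      intro b
      have hb : b ∈ Subgroup.closure ((H : Set G) ∪ {t}) := by
        rw [Subgroup.closure_union, Subgroup.closure_eq, hgen]; trivial
      have step : ∀ x y : G, y ∈ (H : Set G) ∪ {t} → (x ∈ H ∨ x * t ∈ H) →
          (x * y ∈ H ∨ x * y * t ∈ H) := by
        rintro x y (hy | rfl) (hx | hx)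
        · exact Or.inl (mul_mem hx hy)
        · refine Or.inr ?_
          have : x * y * t = x * t * (t⁻¹ * y * t) := by group
          rw [this, hinv y hy]
          exact mul_mem hx (inv_mem hy)
        · refine Or.inr ?_
          rwa [mul_assoc, ← pow_two, ht2, mul_one]
        · exact Or.inl hx
      induction hb using Subgroup.closure_induction_right with
      | one => exact Or.inl (one_mem _)
      | mul_right x hx y hy ih => exact step x y hy ih
      | mul_inv_cancel x hx y hy ih =>
        refine step x y⁻¹ ?_ ih
        rcases hy with hy | rfl
        · exact Or.inl (inv_mem hy)
        · exact Or.inr htt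
    rcases hcov b with h | h
    · refine Or.inr ⟨h, fun h' => ht ?_⟩
      simpa using mul_mem (inv_mem h) h'
    · refine Or.inl ⟨h, fun h' => ht ?_⟩
      simpa using mul_mem (inv_mem h') h

theorem closure_insert_sup {x y z : G} (h : Generates x y z) :
    Subgroup.closure {x, y} ⊔ Subgroup.closure {z} = ⊤ := by
  rw [← Subgroup.closure_union]
  refine Eq.trans (congrArg _ ?_) h
  ext g; simp; tauto

theorem not_mem_closure {x y z : G} (h2 : ∀ a b : G, Subgroup.closure {a, b} ≠ ⊤)
    (h : Generates x y z) : z ∉ Subgroup.closure {x, y} := by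
  intro hz
  refine h2 x y (top_le_iff.1 (h ▸ (Subgroup.closure_le _).2 ?_))
  rintro g (rfl | rfl | rfl)
  · exact left_mem _ _
  · exact right_mem _ _
  · exact hz

/-- A pair of generators can be completed by an element that is not an involution. -/
theorem exists_completion (hG : ¬ IsGeneralizedDihedral G)
    (h2 : ∀ a b : G, Subgroup.closure {a, b} ≠ ⊤) {x y z : G} (h : Generates x y z) :
    ∃ w, Generates x y w ∧ w ^ 2 ≠ 1 := by
  by_contra! hw
  have hz2 : z ^ 2 = 1 := hw z h
  refine hG (isGeneralizedDihedral_of_inverts (not_mem_closure h2 h) hz2 ?_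
    (closure_insert_sup h))
  intro a ha
  -- The element `a z` also completes the pair, so `(a z)² = 1`; together with `z² = 1` this says
  -- that `z` inverts `a`.
  have h1 := hw _ (h.mul₃_left ha)
  have htt : z⁻¹ = z := inv_eq_of_mul_eq_one_left (by rw [← pow_two, hz2])
  refine eq_inv_of_mul_eq_one_right ?_
  rw [htt, ← mul_assoc, ← mul_assoc, ← h1, pow_two, ← mul_assoc]

theorem isGeneralizedDihedral_of_pair (h2 : ∀ a b : G, Subgroup.closure {a, b} ≠ ⊤) {x y t : G}
    (h : Generates x y t) (hxy : x * y = y * x) (ht : t ^ 2 = 1) (hx : t⁻¹ * x * t = x⁻¹)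
    (hy : t⁻¹ * y * t = y⁻¹) : IsGeneralizedDihedral G := by
  refine isGeneralizedDihedral_of_inverts (not_mem_closure h2 h) ht ?_ (closure_insert_sup h)
  have hcomm : ∀ a ∈ Subgroup.closure {x, y}, ∀ b ∈ Subgroup.closure {x, y}, a * b = b * a := by
    have := Subgroup.isMulCommutative_closure (k := {x, y}) (by
      rintro a (rfl | rfl) b (rfl | rfl) <;> simp [hxy])
    exact fun a ha b hb => setLike_mul_comm ha hb
  intro a ha
  induction ha using Subgroup.closure_induction with
  | mem g hg => rcases hg with rfl | rfl <;> assumption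
  | one => simp
  | mul a b ha hb iha ihb =>
    have : t⁻¹ * (a * b) * t = (t⁻¹ * a * t) * (t⁻¹ * b * t) := by group
    rw [this, iha, ihb, hcomm a ha b hb, mul_inv_rev]
  | inv a _ ih =>
    have : t⁻¹ * a⁻¹ * t = (t⁻¹ * a * t)⁻¹ := by group
    rw [this, ih]

/-- Elements outside `A` are involutions, so `S` lies in `A` and no arc joins `A` to its complement.
Translating only the complement by some `c ≠ 1` in `A` is then an automorphism that is not a right
translation. -/
theorem not_admitsORR_of_isGeneralizedDihedral [Finite G] (hG : IsGeneralizedDihedral G)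
    (h2 : ∀ a b : G, Subgroup.closure {a, b} ≠ ⊤) : ¬ AdmitsORR G := by
  classical
  obtain ⟨A, -, hA, τ, hτ, hτ2, hinv⟩ := hG
  rintro ⟨S, hS, haut⟩
  have hmul : ∀ a b, a * b ∈ A ↔ (a ∈ A ↔ b ∈ A) := fun a b =>
    Subgroup.mul_mem_iff_of_index_two hA
  have hSA : S ⊆ A := by
    intro s hs
    by_contra hsA
    have h1 := hinv (s * τ) ((hmul _ _).2 (iff_of_false hsA hτ))
    have h3 : s = s⁻¹ := by
      have : τ⁻¹ * (s * τ) * τ = τ⁻¹ * (s * τ ^ 2) := by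
        simp only [pow_two, mul_assoc]
      rw [this, hτ2, mul_one, mul_inv_rev] at h1
      exact mul_left_cancel h1
    exact (Set.eq_empty_iff_forall_notMem.1 hS s) ⟨hs, by rwa [Set.mem_inv, ← h3]⟩
  -- If `A` were trivial, `τ` alone would generate `G`.
  obtain ⟨c, hcA, hc⟩ : ∃ c ∈ A, c ≠ 1 := by
    by_contra! hA1
    refine h2 τ τ (top_le_iff.1 fun g _ => ?_)
    by_cases hg : g ∈ A
    · rw [hA1 g hg]; exact one_mem _
    · have := hA1 (g * τ) ((hmul _ _).2 (iff_of_false hg hτ))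
      rw [eq_inv_of_mul_eq_one_left this]
      exact inv_mem (left_mem _ _)
  have hmc : ∀ x c, c ∈ A → (x * c ∈ A ↔ x ∈ A) := fun x c hc => by
    rw [hmul]; simp [hc]
  let φ : Equiv.Perm G :=
    { toFun := fun x => if x ∈ A then x else x * c
      invFun := fun x => if x ∈ A then x else x * c⁻¹
      left_inv := fun x => by
        by_cases hx : x ∈ A
        · simp [hx]
        · simp [hx, hmc x c hcA]
      right_inv := fun x => by
        by_cases hx : x ∈ A
        · simp [hx]
        · simp [hx, hmc x c⁻¹ (inv_mem hcA)] }
  have hφ1 : ∀ x, φ x = if x ∈ A then x else x * c := fun x => rfl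
  have hφ : φ ∈ digraphAut (cayley S) := by
    rw [mem_digraphAut_cayley]
    intro x y
    rw [hφ1, hφ1]
    have hne : ∀ a b : G, a ∈ A → b ∉ A → a * b⁻¹ ∉ S ∧ b * a⁻¹ ∉ S := by
      intro a b ha hb
      refine ⟨fun h => ?_, fun h => ?_⟩
      · have := (hmul _ _).1 (hSA h)
        simp [ha, hb] at this
      · have := (hmul _ _).1 (hSA h)
        simp [ha, hb] at this
    by_cases hx : x ∈ A <;> by_cases hy : y ∈ A
    · simp [hx, hy]
    · rw [if_pos hx, if_neg hy]
      exact iff_of_false (hne x (y * c) hx (by rwa [hmc y c hcA])).2 (hne x y hx hy).2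
    · rw [if_neg hx, if_pos hy]
      exact iff_of_false (hne y (x * c) hy (by rwa [hmc x c hcA])).1 (hne y x hy hx).1
    · rw [if_neg hx, if_neg hy]
      simp
  rw [haut, mem_rightRegular] at hφ
  obtain ⟨g, hg⟩ := hφ
  have hg1 : g = 1 := by
    have := hg 1
    rw [hφ1, if_pos (one_mem A)] at this
    simpa using this.symm
  have := hg τ
  rw [hφ1, if_neg hτ, hg1, mul_right_inj] at this
  exact hc this

end Dihedral

/-! ### Noncommuting pairs: the connection set `{x, y, yx⁻¹, z}` -/

section Pairs

variable {G : Type*} [Group G]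

/-- Otherwise `g` and `z` would generate `G`. -/
theorem ne_zpow {x y z g : G} (h2 : ∀ a b : G, Subgroup.closure {a, b} ≠ ⊤)
    (h : Generates x y z) {m n : ℤ} (hx : g ^ m = x) (hy : g ^ n = y) : False := by
  refine h2 g z (top_le_iff.1 (h ▸ (Subgroup.closure_le _).2 ?_))
  rintro a (rfl | rfl | rfl)
  · exact hx ▸ zpow_mem (left_mem _ _) m
  · exact hy ▸ zpow_mem (left_mem _ _) n
  · exact right_mem _ _

theorem closure_range_two {ι : Type*} {e : ι → G} {x y : G}
    (he : ∀ i, e i ∈ Subgroup.closure {x, y}) (hx : x ∈ Set.range e) (hy : y ∈ Set.range e) :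
    Subgroup.closure (Set.range e) = Subgroup.closure {x, y} := by
  refine le_antisymm ((Subgroup.closure_le _).2 ?_) (Subgroup.closure_mono ?_)
  · rintro _ ⟨i, rfl⟩
    exact he i
  · rintro _ (rfl | rfl) <;> assumption

/-- The special case of `admitsORR_of_rigid` in which `z` completes a generating triple. -/
theorem admitsORR_of_rigid_pair [Finite G] (h2 : ∀ a b : G, Subgroup.closure {a, b} ≠ ⊤)
    {ι : Type*} [Finite ι] {x y z : G} (h : Generates x y z) (hz2 : z ^ 2 ≠ 1)
    (e : ι → G) (i j : ι) (hi : e i = x) (hj : e j = y) (I : Set ι)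
    (hIi : e i ∈ Subgroup.closure (e '' I))
    (hIj : e j ∈ Subgroup.closure (e '' I))
    (R : ι → ι → Bool) (he : Function.Injective e) (hmem : ∀ i, e i ∈ Subgroup.closure {x, y})
    (hS : ∀ i j, e i * e j ≠ 1) (hzz : ∀ i, z * z ≠ e i)
    (hR : ∀ i j, (∃ k, e k * e i = e j) ↔ R i j = true)
    (hrigid : ∀ σ : Equiv.Perm (Option ι),
      (∀ a b, isolated R (σ a) (σ b) = isolated R a b) → ∀ i ∈ I, σ (some i) = some i) :
    AdmitsORR G := by
  have hcl := closure_range_two hmem ⟨i, hi⟩ ⟨j, hj⟩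
  refine admitsORR_of_rigid e z I R he ?_ ?_ ?_ hS ?_ hzz hR hrigid
  · rw [hcl]
    exact not_mem_closure h2 h
  · rw [← top_le_iff, ← h, Subgroup.closure_le]
    rintro a (rfl | rfl | rfl)
    · exact Subgroup.subset_closure (Or.inr ⟨i, hi⟩)
    · exact Subgroup.subset_closure (Or.inr ⟨j, hj⟩)
    · exact Subgroup.subset_closure (Or.inl rfl)
  · intro k
    have := hmem k
    refine (Subgroup.closure_le _).2 ?_ this
    rintro a (rfl | rfl)
    · exact hi ▸ hIi
    · exact hj ▸ hIj
  · rwa [← pow_two]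

/-- If `t = z²`, then `⟨y, z⟩` or `⟨x, z⟩` contains all three generators. This keeps `z²` out of the
connection set. -/
theorem sq_ne_of_generates {x y z t : G} (h2 : ∀ a b : G, Subgroup.closure {a, b} ≠ ⊤)
    (h : Generates x y z) (hx : x ∈ Subgroup.closure {y, t} ∨ y ∈ Subgroup.closure {x, t}) :
    z * z ≠ t := by
  rintro rfl
  have key : ∀ u : G, Subgroup.closure {u, z * z} ≤ Subgroup.closure {u, z} := fun u => by
    rw [Subgroup.closure_le]
    rintro a (rfl | rfl)
    · exact left_mem _ _
    · exact mul_mem (right_mem _ _) (right_mem _ _)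
  rcases hx with hx | hx
  · exact not_mem_closure h2 h.swap₁₂.swap₂₃ (key y hx)
  · exact not_mem_closure h2 h.swap₂₃ (key x hx)

/-- The arcs among three elements `x`, `y`, `y * x⁻¹`. -/
def pairRel (A B : Bool) : Fin 3 → Fin 3 → Bool :=
  ![![false, true, false], ![false, false, A], ![B, false, false]]

/-- Only both optional arcs together close a directed triangle, which could rotate. Otherwise the
arcs form a directed path of length one or two, and all remaining vertices are isolated. -/
theorem pairRel_rigid : ∀ A B : Bool, (A && B) = false → ∀ σ : Equiv.Perm (Option (Fin 3)),
    (∀ a b, isolated (pairRel A B) (σ a) (σ b) = isolated (pairRel A B) a b) →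
    σ (some 0) = some 0 ∧ σ (some 1) = some 1 := by
  decide +kernel

/-- A generating triple whose first two elements neither commute nor generate a quaternion
group. -/
theorem admitsORR_of_pair [Finite G] (h2 : ∀ a b : G, Subgroup.closure {a, b} ≠ ⊤) {x y z : G}
    (h : Generates x y z) (hx : x ^ 2 ≠ 1) (hy : y ^ 2 ≠ 1) (hp : (y * x⁻¹) ^ 2 ≠ 1)
    (hz : z ^ 2 ≠ 1) (hxy : x * y ≠ y * x) (hq : ¬ (x * y = y * x⁻¹ ∧ x ^ 2 = y ^ 2)) :
    AdmitsORR G := by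
  classical
  rw [pow_two] at hx hy hp
  rw [pow_two, pow_two] at hq
  have hcyc := fun (g : G) (m n : ℤ) (h1 : g ^ m = x) (h3 : g ^ n = y) => ne_zpow h2 h h1 h3
  have x1 : x ≠ 1 := fun h => hx (by rw [h, one_mul])
  have y1 : y ≠ 1 := fun h => hy (by rw [h, one_mul])
  have p1 : y * x⁻¹ ≠ 1 := fun h => hp (by rw [h, one_mul])
  have hyx : y ≠ x := fun h => p1 (by rw [h, mul_inv_cancel])
  have xyx : y ≠ x * x := fun h => hcyc x 1 2 (by simp) (by rw [h, zpow_two])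
  have yxx : y * y ≠ x := fun h => hcyc y 2 1 (by rw [zpow_two, h]) (by simp)
  have yinv : y ≠ x⁻¹ := fun h => hcyc x 1 (-1) (by simp) (by rw [h, zpow_neg_one])
  have px : x * x ≠ y * x⁻¹ := fun h => hcyc x 1 3 (by simp) (by
    rw [← eq_mul_inv_iff_mul_eq.1 h, ← pow_two, ← pow_succ, ← zpow_natCast]; rfl)
  have pp : y * x⁻¹ * (y * x⁻¹) ≠ x := fun h => hcyc (y * x⁻¹) 2 3 (by rw [zpow_two, h]) (by
    rw [show (3 : ℤ) = 1 + 2 from rfl, zpow_add, zpow_two, h, zpow_one, inv_mul_cancel_right])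
  have ppy : y * x⁻¹ * (y * x⁻¹) ≠ y := fun h => xyx (by
    rw [mul_assoc, mul_eq_left, ← mul_assoc, mul_inv_eq_one] at h
    rwa [inv_mul_eq_iff_eq_mul] at h)
  have xp : y * x⁻¹ ≠ x := fun h => xyx (mul_inv_eq_iff_eq_mul.1 h)
  have xxi : x ≠ x⁻¹ := fun h => hx (by nth_rw 2 [h]; exact mul_inv_cancel x)
  have xy1 : x * y ≠ 1 := fun h => yinv (eq_inv_of_mul_eq_one_right h)
  have yx1 : y * x ≠ 1 := fun h => yinv (eq_inv_of_mul_eq_one_left h)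
  have xxy1 : x * (y * x⁻¹) ≠ 1 := fun h => y1 (by
    rw [← mul_assoc, mul_inv_eq_one] at h; exact mul_eq_left.1 h)
  have yyx1 : y * (y * x⁻¹) ≠ 1 := fun h => yxx (by rwa [← mul_assoc, mul_inv_eq_one] at h)
  have yxy1 : y * x⁻¹ * y ≠ 1 := fun h => yxx (by
    rw [mul_assoc, mul_eq_one_iff_eq_inv', inv_mul_eq_iff_eq_mul, eq_mul_inv_iff_mul_eq] at h
    exact h)
  have yxyx : y * x⁻¹ * y ≠ x := fun h => hp (by rw [← mul_assoc, h, mul_inv_cancel])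
  have xyxy : x * (y * x⁻¹) ≠ y := fun h => hxy (by rwa [← mul_assoc, mul_inv_eq_iff_eq_mul] at h)
  have yyxx : y * (y * x⁻¹) = x ↔ x * x = y * y := by
    rw [← mul_assoc, mul_inv_eq_iff_eq_mul, eq_comm]
  -- The arc `x → y` is always present, `y → yx⁻¹` occurs iff `xy = yx⁻¹`, and `yx⁻¹ → x` iff `x² =
  -- y²`; both at once is the excluded quaternion case.
  refine admitsORR_of_rigid_pair h2 h hz ![x, y, y * x⁻¹] 0 1 rfl rfl {0, 1}
    (Subgroup.subset_closure ⟨0, by simp, rfl⟩) (Subgroup.subset_closure ⟨1, by simp, rfl⟩)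
    (pairRel (decide (x * y = y * x⁻¹)) (decide (x * x = y * y))) ?_ ?_ ?_ ?_ ?_ ?_
  · intro i j
    revert i j
    simp only [Fin.forall_fin_succ]
    simp [x1, hyx, hyx.symm, xp, xp.symm]
  · intro i
    fin_cases i
    · exact left_mem _ _
    · exact right_mem _ _
    · exact mul_mem (right_mem _ _) (inv_mem (left_mem _ _))
  · simp only [Fin.forall_fin_succ]
    simp [hx, hy, hp, xy1, yx1, xxy1, yyx1, yxy1, y1]
  · intro i
    fin_cases i
    · exact sq_ne_of_generates h2 h (Or.inl (right_mem _ _))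
    · exact sq_ne_of_generates h2 h (Or.inr (right_mem _ _))
    · refine sq_ne_of_generates h2 h (Or.inr ?_)
      have := mul_mem (right_mem x (y * x⁻¹)) (left_mem x (y * x⁻¹))
      simpa using this
  · simp only [Fin.forall_fin_succ, Fin.exists_fin_succ]
    simp [pairRel, x1, y1, p1, hyx, px, xxi, yxx, yxyx, yinv, pp, ppy, xyxy, yyxx]
  · intro σ hσ i hi
    have := pairRel_rigid _ _ (by
      rw [Bool.and_eq_false_iff, decide_eq_false_iff_not, decide_eq_false_iff_not]; tauto) σ hσ
    rcases hi with rfl | rfl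
    · exact this.1
    · exact this.2

end Pairs

/-! ### Commuting pairs: the connection set `{x, y, xy, x²y, z}` -/

section Abelian

variable {G : Type*} [Group G]

/-- If `ua + vb = 1`, the relation `x^a y^b = 1` would make both `x` and `y` powers of `x^v y^(-u)`.
-/
theorem zpow_mul_zpow_ne_one {x y z : G} (h2 : ∀ a b : G, Subgroup.closure {a, b} ≠ ⊤)
    (h : Generates x y z) (hxy : Commute x y) {a b : ℤ} (hab : IsCoprime a b) :
    x ^ a * y ^ b ≠ 1 := by
  intro h1
  obtain ⟨u, v, huv⟩ := hab
  have hc : ∀ m n : ℤ, Commute (x ^ m) (y ^ n) := fun m n => (hxy.zpow_right n).zpow_left m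
  have hpow : ∀ k m n : ℤ, (x ^ m * y ^ n) ^ k = x ^ (m * k) * y ^ (n * k) := fun k m n => by
    rw [(hc m n).mul_zpow, zpow_mul, zpow_mul]
  refine ne_zpow h2 h (g := x ^ v * y ^ (-u)) (m := b) (n := -a) ?_ ?_
  · have e := hpow (-u) a b
    rw [h1, one_zpow] at e
    have e2 : x ^ (v * b) * y ^ (-u * b) = x * (x ^ (a * -u) * y ^ (b * -u)) := by
      rw [← mul_assoc, ← zpow_one_add, ← huv]
      congr 2 <;> ring
    rw [hpow, e2, ← e, mul_one]
  · have e := hpow (-v) a b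
    rw [h1, one_zpow] at e
    have e2 : x ^ (v * -a) * y ^ (-u * -a) = (x ^ (a * -v) * y ^ (b * -v)) * y := by
      rw [mul_assoc, ← zpow_add_one, ← huv]
      congr 2 <;> ring
    rw [hpow, e2, ← e, one_mul]

/-- Exponents of the elements `x`, `y`, `x * y`, `x ^ 2 * y`. -/
def abelianExp : Fin 4 → ℤ × ℤ := ![(1, 0), (0, 1), (1, 1), (2, 1)]

/-- The arcs among the elements `x`, `y`, `x * y`, `x ^ 2 * y`. -/
def abelianRel : Fin 4 → Fin 4 → Bool :=
  ![![false, false, true, true], ![false, false, true, false], ![false, false, false, true],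
    ![false, false, false, false]]

/-- The vertex `x` is the only one of out-degree two, and `y` is the only one of out-degree one
without an incoming arc. -/
theorem abelianRel_rigid : ∀ σ : Equiv.Perm (Option (Fin 4)),
    (∀ a b, isolated abelianRel (σ a) (σ b) = isolated abelianRel a b) →
    σ (some 0) = some 0 ∧ σ (some 1) = some 1 := by
  decide +kernel

/-- Exponent vectors `(a, b)` for which `x ^ a * y ^ b = 1` is excluded in
`admitsORR_of_commute`. -/
def Excluded (w : ℤ × ℤ) : Prop :=
  Int.gcd w.1 w.2 = 1 ∨ w ∈ [(2, 0), (0, 2), (2, 2), (4, 2), (3, 0)] ∨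
    -w ∈ [((2 : ℤ), (0 : ℤ)), (0, 2), (2, 2), (4, 2), (3, 0)]

instance : DecidablePred Excluded := fun w => by unfold Excluded; infer_instance

/-- These checks show that every coincidence spoiling the connection set (an inverse pair, a
repeated element, an unwanted arc) would be a relation with an excluded exponent vector. -/
theorem abelianExp_sum : ∀ i j, Excluded (abelianExp i + abelianExp j) := by decide
theorem abelianExp_sub : ∀ i j, i ≠ j → Excluded (abelianExp i - abelianExp j) := by decide
theorem abelianExp_rel : ∀ i j k, Excluded (abelianExp k + abelianExp i - abelianExp j) ∨
    abelianExp k + abelianExp i = abelianExp j ∧ abelianRel i j = true := by decide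
theorem abelianRel_exists : ∀ i j, abelianRel i j = true →
    ∃ k, abelianExp k + abelianExp i = abelianExp j := by decide

theorem admitsORR_of_commute [Finite G] (h2 : ∀ a b : G, Subgroup.closure {a, b} ≠ ⊤)
    {x y z : G} (h : Generates x y z) (hz : z ^ 2 ≠ 1) (hxy : Commute x y) (hx : x ^ 2 ≠ 1)
    (hx3 : x ^ 3 ≠ 1) (hy : y ^ 2 ≠ 1) (hxy2 : (x * y) ^ 2 ≠ 1) (hxxy : (x ^ 2 * y) ^ 2 ≠ 1) :
    AdmitsORR G := by
  let f : ℤ × ℤ → G := fun w => x ^ w.1 * y ^ w.2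
  have hfadd : ∀ v w, f (v + w) = f v * f w := fun v w => by
    have := (hxy.zpow_right v.2).zpow_left w.1
    simp only [f, Prod.fst_add, Prod.snd_add, zpow_add]
    rw [mul_assoc, ← mul_assoc (x ^ w.1), this.eq]
    simp only [mul_assoc]
  have hf0 : f 0 = 1 := by simp [f]
  have hfneg : ∀ w, f (-w) = (f w)⁻¹ := fun w => by
    rw [eq_inv_iff_mul_eq_one, ← hfadd, neg_add_cancel, hf0]
  have hfsub : ∀ v w, f (v - w) = f v * (f w)⁻¹ := fun v w => by
    rw [sub_eq_add_neg, hfadd, hfneg]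
  have hlist : ∀ w ∈ [((2 : ℤ), (0 : ℤ)), (0, 2), (2, 2), (4, 2), (3, 0)], f w ≠ 1 := by
    have e1 : x ^ (2 : ℤ) * y ^ (2 : ℤ) = (x * y) ^ 2 := by
      rw [hxy.mul_pow]; norm_cast
    have e2 : x ^ (4 : ℤ) * y ^ (2 : ℤ) = (x ^ 2 * y) ^ 2 := by
      rw [(hxy.pow_left 2).mul_pow, ← pow_mul]; norm_cast
    simp only [List.forall_mem_cons, f]
    refine ⟨?_, ?_, ?_, ?_, ?_, by simp⟩
    · simpa using (by exact_mod_cast hx : x ^ (2 : ℤ) ≠ 1)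
    · simpa using (by exact_mod_cast hy : y ^ (2 : ℤ) ≠ 1)
    · rwa [e1]
    · rwa [e2]
    · simpa using (by exact_mod_cast hx3 : x ^ (3 : ℤ) ≠ 1)
  have hexc : ∀ w, Excluded w → f w ≠ 1 := by
    rintro w (hw | hw | hw)
    · exact zpow_mul_zpow_ne_one h2 h hxy (Int.isCoprime_iff_gcd_eq_one.2 hw)
    · exact hlist w hw
    · have := hlist _ hw
      rwa [hfneg, inv_ne_one] at this
  have hmem : ∀ i, f (abelianExp i) ∈ Subgroup.closure {x, y} := fun i =>
    mul_mem (zpow_mem (left_mem _ _) _) (zpow_mem (right_mem _ _) _)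
  have f0 : f (abelianExp 0) = x := by simp [f, abelianExp]
  have f1 : f (abelianExp 1) = y := by simp [f, abelianExp]
  refine admitsORR_of_rigid_pair h2 h hz (fun i => f (abelianExp i)) 0 1 f0 f1 {0, 1}
    (Subgroup.subset_closure ⟨0, by simp, rfl⟩) (Subgroup.subset_closure ⟨1, by simp, rfl⟩)
    abelianRel ?_ hmem ?_ ?_ ?_ ?_
  · intro i j hij
    by_contra hne
    refine hexc _ (abelianExp_sub i j hne) ?_
    rw [hfsub, mul_inv_eq_one]
    exact hij
  · intro i j
    rw [← hfadd]
    exact hexc _ (abelianExp_sum i j)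
  · intro i
    fin_cases i
    · exact f0 ▸ sq_ne_of_generates h2 h (Or.inl (f0.symm ▸ right_mem _ _))
    · exact sq_ne_of_generates h2 h (Or.inr (f1.symm ▸ right_mem _ _))
    · refine sq_ne_of_generates h2 h (Or.inr ?_)
      have := mul_mem (inv_mem (left_mem x (x * y))) (right_mem x (x * y))
      simpa [f, abelianExp] using this
    · refine sq_ne_of_generates h2 h (Or.inr ?_)
      have := mul_mem (inv_mem (pow_mem (left_mem x (x ^ 2 * y)) 2)) (right_mem x (x ^ 2 * y))
      simpa [f, abelianExp, ← mul_assoc] using this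
  · intro i j
    constructor
    · rintro ⟨k, hk⟩
      rcases abelianExp_rel i j k with h | h
      · refine absurd ?_ (hexc _ h)
        rw [hfsub, hfadd, mul_inv_eq_one]
        exact hk
      · exact h.2
    · intro hij
      obtain ⟨k, hk⟩ := abelianRel_exists i j hij
      exact ⟨k, by rw [← hfadd, hk]⟩
  · intro σ hσ i hi
    rcases hi with rfl | rfl
    · exact (abelianRel_rigid σ hσ).1
    · exact (abelianRel_rigid σ hσ).2

/-- The possible orders of commuting elements that are part of a generating triple. -/
theorem commute_cases [Finite G] (h2 : ∀ a b : G, Subgroup.closure {a, b} ≠ ⊤)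
    (hD : ¬ IsGeneralizedDihedral G) (hO : ¬ AdmitsORR G) {x y z : G} (h : Generates x y z)
    (hxy : Commute x y) (hx : x ^ 2 ≠ 1) :
    (x ^ 3 = 1 ∧ y ^ 3 = 1) ∨ (x ^ 4 = 1 ∧ y ^ 4 = 1) ∨
      (x ^ 6 = 1 ∧ x ^ 3 ≠ 1 ∧ ∃ j : ℕ, (y * x ^ j) ^ 2 = 1) := by
  obtain ⟨w, hw, hw2⟩ := exists_completion hD h2 h
  have key : ∀ x y : G, Generates x y w → Commute x y → x ^ 2 = 1 ∨ x ^ 3 = 1 ∨ y ^ 2 = 1 ∨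
      (x * y) ^ 2 = 1 ∨ (x ^ 2 * y) ^ 2 = 1 := by
    intro x y h hxy
    by_contra! hc
    exact hO (admitsORR_of_commute h2 h hw2 hxy hc.1 hc.2.1 hc.2.2.1 hc.2.2.2.1 hc.2.2.2.2)
  have hne : ∀ a b : ℤ, IsCoprime a b → x ^ a * y ^ b ≠ 1 := fun a b hab =>
    zpow_mul_zpow_ne_one h2 h hxy hab
  by_cases hx3 : x ^ 3 = 1
  · left
    refine ⟨hx3, ?_⟩
    -- Each alternative to be refuted, other than `x² = 1`, is a relation between powers of `x` and
    -- `y`; raising the exponent of `x` by `3` makes the two exponents coprime.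
    have hx' : x ^ (3 : ℤ) = 1 := by exact_mod_cast hx3
    rcases key y x hw.swap₁₂ hxy.symm with h | h | h | h | h
    · exfalso
      refine hne 3 2 (by norm_num) ?_
      rw [hx', one_mul]; exact_mod_cast h
    · exact h
    · exact absurd h hx
    · exfalso
      refine hne 5 2 (by norm_num) ?_
      rw [hxy.symm.mul_pow] at h
      rw [show (5 : ℤ) = 3 + 2 from rfl, zpow_add, hx', one_mul, ← (hxy.symm.zpow_zpow _ _).eq]
      exact_mod_cast h
    · exfalso
      refine hne 5 4 (by norm_num) ?_
      rw [(hxy.symm.pow_left 2).mul_pow, ← pow_mul] at h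
      rw [show (5 : ℤ) = 3 + 2 from rfl, zpow_add, hx', one_mul, ← (hxy.symm.zpow_zpow _ _).eq]
      exact_mod_cast h
  · right
    have hj : ∃ j : ℕ, (y * x ^ j) ^ 2 = 1 := by
      rcases key x y hw hxy with h | h | h | h | h
      · exact absurd h hx
      · exact absurd h hx3
      · exact ⟨0, by simpa using h⟩
      · exact ⟨1, by rw [pow_one, ← hxy.eq]; exact h⟩
      · exact ⟨2, by rw [← (hxy.pow_left 2).eq]; exact h⟩
    obtain ⟨j, hj⟩ := hj
    have hcj : Commute x (y * x ^ j) := hxy.mul_right (Commute.pow_right rfl j)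
    have hgj : Generates x (y * x ^ (j + 1)) w := by
      have := hw.swap₂₃.mul₃_right (pow_mem (left_mem x w) (j + 1))
      exact this.swap₂₃
    have hcj' : Commute x (y * x ^ (j + 1)) := hxy.mul_right (Commute.pow_right rfl _)
    set t := y * x ^ j with ht
    have ht1 : y * x ^ (j + 1) = x * t := by
      rw [pow_succ, ← mul_assoc, ← ht, hcj.eq]
    rw [ht1] at hgj hcj'
    have e : ∀ k : ℕ, (x ^ k * t) ^ 2 = x ^ (2 * k) := fun k => by
      rw [(hcj.pow_left k).mul_pow, hj, mul_one, ← pow_mul, mul_comm]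
    -- Since `t² = 1` and `t` commutes with `x`, the squares of `xt`, `x · xt` and `x² · xt` are
    -- `x²`, `x⁴` and `x⁶`.
    have h46 : x ^ 4 = 1 ∨ x ^ 6 = 1 := by
      rcases key x (x * t) hgj hcj' with h | h | h | h | h
      · exact absurd h hx
      · exact absurd h hx3
      · exact absurd (by simpa using (e 1).symm.trans (by simpa using h)) hx
      · left
        rw [← mul_assoc, ← pow_two, e] at h
        exact h
      · right
        rw [← mul_assoc, ← pow_succ, e] at h
        exact h
    rcases h46 with h4 | h6
    · left
      refine ⟨h4, ?_⟩
      have : y = t * (x ^ j)⁻¹ := by rw [ht, mul_inv_cancel_right]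
      rw [this, (hcj.symm.pow_right j).inv_right.mul_pow, show 4 = 2 * 2 from rfl, pow_mul, hj,
        one_pow, one_mul, inv_pow, ← pow_mul, mul_comm, pow_mul, h4, one_pow, inv_one]
    · exact Or.inr ⟨h6, hx3, j, hj⟩

end Abelian

/-! ### Pairs with `(yx)² = (yx⁻¹)² = 1`, and the alternatives for a pair -/

section Twisted

variable {G : Type*} [Group G]

/-- The arcs among the elements `x`, `x ^ 2`, `y`, `x ^ 2 * y`. -/
def twistedRel (B : Bool) : Fin 4 → Fin 4 → Bool :=
  ![![false, true, false, false], ![false, false, true, false], ![false, false, false, true],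
    ![false, B, false, false]]

/-- The vertex `x` is the only one with an outgoing but no incoming arc, and the path `x → x² → y →
x²y` can be followed from it. -/
theorem twistedRel_rigid : ∀ B : Bool, ∀ σ : Equiv.Perm (Option (Fin 4)),
    (∀ a b, isolated (twistedRel B) (σ a) (σ b) = isolated (twistedRel B) a b) →
    σ (some 0) = some 0 ∧ σ (some 2) = some 2 := by
  decide +kernel

/-- The relations give `yxy = x⁻¹` and `yx⁻¹y = x`, so conjugation by `y` inverts `x²`. The
connection set is `{x, x², y, x²y, z}`, with arcs `x → x² → y → x²y` given by `x`, `x²y`, `x²`; the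
further arc `x²y → x²` occurs iff `y² = x⁴`. The condition `z² ≠ x²` is there because `x²` belongs
to the set. -/
theorem admitsORR_of_twisted [Finite G] (h2 : ∀ a b : G, Subgroup.closure {a, b} ≠ ⊤)
    {x y z : G} (h : Generates x y z) (hz : z ^ 2 ≠ 1) (hzx : z ^ 2 ≠ x ^ 2) (hx : x ^ 4 ≠ 1)
    (hy : y ^ 2 ≠ 1) (h3 : (y * x) ^ 2 = 1) (h4 : (y * x⁻¹) ^ 2 = 1) : AdmitsORR G := by
  classical
  have hcyc := fun (g : G) (m n : ℤ) (h1 : g ^ m = x) (h3 : g ^ n = y) => ne_zpow h2 h h1 h3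
  obtain ⟨a, ha⟩ : ∃ a, a = x * x := ⟨_, rfl⟩
  let K := Subgroup.zpowers x
  have xK : x ∈ K := Subgroup.mem_zpowers x
  have aK : a ∈ K := ha ▸ mul_mem xK xK
  have hyK : y ∉ K := fun ⟨n, hn⟩ => hcyc x 1 n (zpow_one x) hn
  have m1 : ∀ u ∈ K, ∀ w ∈ K, u * y ≠ w := fun u hu w hw h =>
    hyK ((K.mul_mem_cancel_left hu).1 (h ▸ hw))
  have m2 : ∀ u ∈ K, ∀ w ∈ K, y * u ≠ w := fun u hu w hw h =>
    hyK ((K.mul_mem_cancel_right hu).1 (h ▸ hw))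
  have m0 : ∀ w ∈ K, y ≠ w := fun w hw h => hyK (h ▸ hw)
  have aa1 : a * a ≠ 1 := fun h => hx (by
    rw [show 4 = 2 * 2 from rfl, pow_mul, pow_two x, ← ha, pow_two, h])
  have a1 : a ≠ 1 := fun h => aa1 (by rw [h, one_mul])
  have x1 : x ≠ 1 := fun h => a1 (by rw [ha, h, one_mul])
  have y1 : y ≠ 1 := m0 1 (one_mem _)
  have yy1 : y * y ≠ 1 := fun h => hy (by rw [pow_two, h])
  have hxa : x * a = a * x := by rw [ha, mul_assoc]
  rw [pow_two] at h3 h4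
  have hyxy : y * x * y = x⁻¹ := eq_inv_of_mul_eq_one_left (by rwa [← mul_assoc] at h3)
  have hyxy' : y * x⁻¹ * y = x := by
    rw [← mul_assoc] at h4
    exact mul_inv_eq_one.1 h4
  have hya : y * a = a⁻¹ * y := by
    have : y * a = (y * x * y) * (y * x⁻¹ * y)⁻¹ * y := by rw [ha]; group
    rw [this, hyxy, hyxy', ha, mul_inv_rev]
  have hay : a * y = y * a⁻¹ := by
    rw [eq_mul_inv_iff_mul_eq, mul_assoc, hya, mul_inv_cancel_left]
  have hyyx : y * y * x = x * (y * y)⁻¹ := by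
    have : y * y * x = y * (y * x * y) * y⁻¹ := by group
    rw [this, hyxy]
    have : x * (y * y)⁻¹ = (y * x⁻¹ * y) * (y * y)⁻¹ := by rw [hyxy']
    rw [this]
    group
  have ninv : y * x ≠ x⁻¹ * y := fun h => yy1 (by
    rw [← mul_assoc, h, mul_assoc, mul_assoc, inv_mul_eq_one, ← mul_assoc] at h3
    exact mul_eq_right.1 h3.symm)
  have x3 : x * a ≠ 1 := fun h => ninv (by
    have : a = x⁻¹ := eq_inv_of_mul_eq_one_right h
    rw [this, inv_inv] at hay
    rw [← hay])
  have x3' : a * x ≠ 1 := hxa ▸ x3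
  -- By `hyyx`, `y²x = xy⁻²`; if `y²` is a power of `x` it commutes with `x`, so it equals its own
  -- inverse.
  have commyy : ∀ w ∈ K, y * y = w → w * w = 1 := by
    rintro w ⟨n, hn⟩ h
    have hc : w * x = x * w := by
      rw [← hn]
      exact ((Commute.refl x).zpow_left n).eq
    rw [h, hc] at hyyx
    have := mul_left_cancel hyyx
    nth_rw 1 [this]
    exact inv_mul_cancel w
  have yya : y * y ≠ a := fun h => aa1 (commyy a aK h)
  have yyx : y * y ≠ x := fun h => a1 (ha ▸ commyy x xK h)
  have yyx' : y * y ≠ x⁻¹ := fun h => a1 (by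
    have := commyy _ (inv_mem xK) h
    rwa [← mul_inv_rev, inv_eq_one, ← ha] at this)
  have yya' : y * y ≠ a⁻¹ := fun h => aa1 (by
    have := commyy _ (inv_mem aK) h
    rwa [← mul_inv_rev, inv_eq_one] at this)
  have yyxa : y * y ≠ x * a := fun h => ninv (by
    have h6 := commyy _ (mul_mem xK aK) h
    have e1 : x = x * a * a⁻¹ := by rw [mul_inv_cancel_right]
    have e2 : y * x = x * a * a * y := by
      nth_rw 1 [e1]
      rw [← h, mul_assoc (y * y) a y, hay]
      group
    have e3 : x⁻¹ = x * a * a := inv_eq_of_mul_eq_one_right (by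
      rw [← h6, ha]; group)
    rw [e2, e3])
  have ayay : a * y * (a * y) = y * y := by
    rw [mul_assoc, ← mul_assoc y, hya]; group
  have yay : y * (a * y) = a⁻¹ * (y * y) := by
    rw [← mul_assoc, hya, mul_assoc]
  have aya : a * y * a = y := by rw [hay, inv_mul_cancel_right]
  have ayy : ∀ w, a * y * y = w ↔ y * y = a⁻¹ * w := fun w => by
    rw [mul_assoc, eq_inv_mul_iff_mul_eq]
  have aix : a⁻¹ * x = x⁻¹ := by rw [ha]; group
  have xna : x ≠ a := fun h => x1 (by rw [ha] at h; exact (mul_eq_left.1 h.symm))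
  have ayx : a * y * x ≠ y := fun h => xna (by
    rw [hay, mul_assoc, mul_eq_left, inv_mul_eq_one] at h
    exact h.symm)
  have yxay : y * x ≠ a * y := fun h => x3 (by
    rw [hay] at h
    rw [mul_left_cancel h, inv_mul_cancel])
  have aax : a * a ≠ x := fun h => x3 (by
    rw [ha, ← mul_assoc, mul_eq_right, ← ha, ← hxa] at h
    exact h)
  have m3 : ∀ w, a * y * x = w → w ∉ K := fun w h hw =>
    hyK ((K.mul_mem_cancel_left aK).1 ((K.mul_mem_cancel_right xK).1 (h ▸ hw)))
  refine admitsORR_of_rigid_pair h2 h hz ![x, a, y, a * y] 0 2 rfl rfl {0, 2}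
    (Subgroup.subset_closure ⟨0, by simp, rfl⟩) (Subgroup.subset_closure ⟨2, by simp, rfl⟩)
    (twistedRel (decide (y * y = a * a))) ?_ ?_ ?_ ?_ ?_ ?_
  · intro i j
    revert i j
    simp only [Fin.forall_fin_succ]
    simp [m0 x xK, (m0 x xK).symm, m0 a aK, (m0 a aK).symm, m1 a aK x xK,
      (m1 a aK x xK).symm, a1, y1, xna, xna.symm]
  · intro i
    have : a ∈ Subgroup.closure {x, y} := ha ▸ mul_mem (left_mem _ _) (left_mem _ _)
    fin_cases i
    · exact left_mem _ _
    · exact this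
    · exact right_mem _ _
    · exact mul_mem this (right_mem _ _)
  · simp only [Fin.forall_fin_succ]
    have e1 : x * x ≠ 1 := ha ▸ a1
    have e2 : x * (a * y) ≠ 1 := mul_assoc x a y ▸ m1 _ (mul_mem xK aK) _ (one_mem _)
    have e3 : a * (a * y) ≠ 1 := mul_assoc a a y ▸ m1 _ (mul_mem aK aK) _ (one_mem _)
    have e4 : a * y * x ≠ 1 := fun h => m3 _ h (one_mem _)
    have e5 : a⁻¹ * (y * y) ≠ 1 := fun h => yya (inv_mul_eq_one.1 h).symm
    simp [e1, e2, e3, e4, e5, x3, x3', aa1, yy1, y1, yay, aya, ayay, ayy, yya',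
      m1 x xK 1 (one_mem _), m1 a aK 1 (one_mem _), m2 x xK 1 (one_mem _), m2 a aK 1 (one_mem _)]
  · intro i
    fin_cases i
    · exact sq_ne_of_generates h2 h (Or.inl (right_mem _ _))
    · change z * z ≠ a
      rwa [ha, ← pow_two, ← pow_two]
    · exact sq_ne_of_generates h2 h (Or.inr (right_mem _ _))
    · refine sq_ne_of_generates h2 h (Or.inr ?_)
      have := mul_mem (inv_mem (mul_mem (left_mem x (a * y)) (left_mem x (a * y))))
        (right_mem x (a * y))
      rwa [← ha, inv_mul_cancel_left] at this
  · simp only [Fin.forall_fin_succ, Fin.exists_fin_succ]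
    have e0 : x * a ≠ a * y := fun h => m1 _ aK _ (mul_mem xK aK) h.symm
    have e2 : x * (a * y) ≠ a := mul_assoc x a y ▸ m1 _ (mul_mem xK aK) _ aK
    have e3 : a * (a * y) ≠ x := mul_assoc a a y ▸ m1 _ (mul_mem aK aK) _ xK
    have e6 : a⁻¹ * (y * y) ≠ x := fun h => yyxa (by rw [hxa]; exact inv_mul_eq_iff_eq_mul.1 h)
    have e7 : a⁻¹ * (y * y) = a ↔ y * y = a * a := inv_mul_eq_iff_eq_mul
    have e8 : x * (a * y) ≠ y := fun h => x3 (by rwa [← mul_assoc, mul_eq_right] at h)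
    have e9 : a * (a * y) ≠ y := fun h => aa1 (by rwa [← mul_assoc, mul_eq_right] at h)
    have e10 : y * a ≠ a * y := fun h => aa1 (by
      rw [hay] at h
      nth_rw 1 [mul_left_cancel h]
      exact inv_mul_cancel a)
    have e11 : a⁻¹ * (y * y) ≠ y := fun h => m1 a aK 1 (one_mem _) (mul_eq_left.1 (yay.trans h))
    have e12 : a⁻¹ * (y * y) ≠ a * y := fun h => y1 (mul_eq_right.1 (yay.trans h))
    simp [twistedRel, e11, e12, xna.symm, m0 _ (inv_mem aK), e0, e2, e3, e6, e7, e8, e9, e10,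
      ← ha, x1, a1, y1, yay, aya, ayay, ayy,
      aix, yya, yyx, yyx', yy1, ayx, yxay, aax, xna, m0 x xK, (m0 x xK).symm,
      m0 a aK, (m0 a aK).symm, (m0 _ (mul_mem aK xK)).symm, m1 x xK a aK, m1 a aK x xK,
      m1 a aK 1 (one_mem _), m2 a aK x xK]
  · intro σ hσ i hi
    have := twistedRel_rigid _ σ hσ
    rcases hi with rfl | rfl
    · exact this.1
    · exact this.2

/-- The possible relations between two elements that are part of a generating triple. -/
theorem pair_cases [Finite G] (h2 : ∀ a b : G, Subgroup.closure {a, b} ≠ ⊤)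
    (hD : ¬ IsGeneralizedDihedral G) (hO : ¬ AdmitsORR G) {x y z : G} (h : Generates x y z)
    (hx : x ^ 2 ≠ 1) :
    Commute x y ∨ (y ^ 2 = 1 ∧ x * y = y * x⁻¹) ∨ (x * y = y * x⁻¹ ∧ x ^ 2 = y ^ 2) ∨
      (x ^ 4 = 1 ∧ y ^ 4 = 1 ∧ Commute (x ^ 2) y) := by
  obtain ⟨w, hw, hw2⟩ := exists_completion hD h2 h
  by_cases hc : Commute x y
  · exact Or.inl hc
  by_cases hq : x * y = y * x⁻¹ ∧ x ^ 2 = y ^ 2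
  · exact Or.inr (Or.inr (Or.inl hq))
  have hgen : ∀ n : ℕ, Generates x (y * x ^ n) w := fun n =>
    (hw.swap₂₃.mul₃_right (pow_mem (left_mem x w) n)).swap₂₃
  -- Of two consecutive terms of the sequence `y x^n`, one has trivial square; otherwise
  -- `admitsORR_of_pair` applies.
  have key : ∀ n : ℕ, (y * x ^ n) ^ 2 = 1 ∨ (y * x ^ n * x⁻¹) ^ 2 = 1 := by
    intro n
    by_contra! hn
    refine hO (admitsORR_of_pair h2 (hgen n) hx hn.1 hn.2 hw2 ?_ ?_)
    · intro he
      refine hc ?_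
      have : Commute x (y * x ^ n * (x ^ n)⁻¹) :=
        Commute.mul_right he ((Commute.refl x).pow_right n).inv_right
      rwa [mul_inv_cancel_right] at this
    · rintro ⟨e1, e2⟩
      have e3 : x * y = y * x⁻¹ := by
        refine mul_right_cancel (b := x ^ n) ?_
        rw [mul_assoc, e1, mul_assoc, mul_assoc, ((Commute.refl x).inv_left.pow_right n).eq]
      refine hq ⟨e3, ?_⟩
      have e4 : ∀ n : ℕ, x ^ n * y = y * (x ^ n)⁻¹ := by
        intro n
        induction n with
        | zero => simp
        | succ n ih => rw [pow_succ, mul_assoc, e3, ← mul_assoc, ih, mul_inv_rev, mul_assoc,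
            ((Commute.refl x).inv_left.pow_right n).inv_right.eq]
      rw [e2, pow_two, pow_two, mul_assoc, ← mul_assoc (x ^ n), e4, inv_mul_cancel_right]
  have twist : ∀ x y : G, Generates x y w → y ^ 2 ≠ 1 → (y * x) ^ 2 = 1 → (y * x⁻¹) ^ 2 = 1 →
      x ^ 4 = 1 := by
    intro x y h hy h3 h4
    by_contra hx4
    by_cases hwx : w ^ 2 = x ^ 2
    · refine hO (admitsORR_of_twisted h2 h.inv₁ hw2 ?_ (by simpa using hx4) hy h4
        (by simpa using h3))
      rw [hwx, inv_pow]
      intro h5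
      refine hx4 ?_
      rw [show 4 = 2 + 2 from rfl, pow_add]
      nth_rw 1 [h5]
      exact inv_mul_cancel _
    · exact hO (admitsORR_of_twisted h2 h hw2 hwx hx4 hy h3 h4)
  have comm_sq : ∀ x y : G, x ^ 4 = 1 → (y * x) ^ 2 = 1 → (y * x⁻¹) ^ 2 = 1 →
      Commute (x ^ 2) y := by
    intro x y hx4 h3 h4
    rw [pow_two, ← mul_assoc] at h3 h4
    have e1 : y * x * y = x⁻¹ := eq_inv_of_mul_eq_one_left h3
    have e2 : y * x⁻¹ * y = x := mul_inv_eq_one.1 h4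
    have e3 : y * x ^ 2 = (y * x * y) * (y * x⁻¹ * y)⁻¹ * y := by rw [pow_two]; group
    have e4 : x⁻¹ * x⁻¹ = x ^ 2 := by
      rw [← mul_inv_rev, ← pow_two]
      exact inv_eq_of_mul_eq_one_left (by rw [← pow_add, hx4])
    rw [Commute, SemiconjBy, e3, e1, e2, e4]
  refine Or.inr ?_
  have k1 := key 1
  have k2 := key 2
  rw [pow_one, mul_inv_cancel_right] at k1
  rw [pow_two x, ← mul_assoc, mul_inv_cancel_right] at k2
  by_cases hy : y ^ 2 = 1
  · by_cases hyx : (y * x) ^ 2 = 1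
    · left
      refine ⟨hy, ?_⟩
      have hyi : y⁻¹ = y := inv_eq_of_mul_eq_one_left (by rw [← pow_two, hy])
      rw [pow_two, mul_assoc] at hyx
      have := eq_inv_of_mul_eq_one_right hyx
      rw [hyi, ← mul_assoc] at this
      exact eq_mul_inv_iff_mul_eq.2 this
    · right; right
      -- Now `yx` takes the role of `y`: its neighbours `y` and `yx²` in the sequence have trivial
      -- squares.
      have hyxx := k2.resolve_right hyx
      have g1 := hgen 1
      rw [pow_one] at g1
      have hyi : (y * x * x⁻¹) ^ 2 = 1 := by rwa [mul_inv_cancel_right]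
      have hx4 := twist x (y * x) g1 hyx hyxx hyi
      refine ⟨hx4, by rw [show 4 = 2 * 2 from rfl, pow_mul, hy, one_pow], ?_⟩
      have := comm_sq x (y * x) hx4 hyxx hyi
      have h5 := this.mul_right ((Commute.refl x).pow_left 2).inv_right
      rwa [mul_inv_cancel_right] at h5
  · right; right
    have k0 := key 0
    rw [pow_zero, mul_one] at k0
    have h3 := k1.resolve_right hy
    have h4 := k0.resolve_left hy
    have hx4 := twist x y hw hy h3 h4
    refine ⟨hx4, ?_, comm_sq x y hx4 h3 h4⟩
    refine twist y x hw.swap₁₂ hx ?_ ?_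
    · have : (x * y) ^ 2 = x * (y * x) ^ 2 * x⁻¹ := by rw [pow_two, pow_two]; group
      rw [this, h3]; simp
    · have : (x * y⁻¹) ^ 2 = ((y * x⁻¹) ^ 2)⁻¹ := by rw [pow_two, pow_two]; group
      rw [this, h4]; simp

end Twisted

/-! ### A numerical rigidity test for explicit connection sets -/

section Weights

variable {G : Type*} [Group G]

/-- An invariant of the pair of vertices `s`, `t` in `Cay(G, S)`, `S` the range of `e`: it records
the number of directed paths of length one and two from `s` to `t`. -/
def pathWeight [DecidableEq G] {n : ℕ} (e : Fin n → G) (s t : G) : ℕ :=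
  (if ∃ k, e k * s = t then 100 else 0) +
    (Finset.univ.filter fun k => ∃ m, e m * (e k * s) = t).card

/-- An automorphism maps the out-neighbours of `s` bijectively onto those of `φ s`, and with them
the middle vertices of paths of length two. -/
theorem pathWeight_apply [DecidableEq G] {n : ℕ} {e : Fin n → G} (he : Function.Injective e)
    {φ : Equiv.Perm G} (hφ : φ ∈ digraphAut (cayley (Set.range e))) (s t : G) :
    pathWeight e (φ s) (φ t) = pathWeight e s t := by
  have hadj : ∀ a b, (∃ k, e k * φ a = φ b) ↔ ∃ k, e k * a = b := by
    intro a b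
    have := (mem_digraphAut_cayley.1 hφ) a b
    simpa only [Set.mem_range, eq_mul_inv_iff_mul_eq] using this
  have hstep : ∀ k, ∃ k', e k' * φ s = φ (e k * s) := fun k => (hadj s _).2 ⟨k, rfl⟩
  choose g hg using hstep
  have hginj : Function.Injective g := by
    intro a b hab
    have : φ (e a * s) = φ (e b * s) := by rw [← hg, ← hg, hab]
    exact he (mul_right_cancel (φ.injective this))
  have hgsurj : Function.Surjective g := Finite.surjective_of_injective hginj
  unfold pathWeight
  congr 1
  · simp only [hadj]
  · symm
    refine Finset.card_bij (fun k _ => g k) ?_ (fun a _ b _ h => hginj h) ?_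
    · intro k hk
      simp only [Finset.mem_filter, Finset.mem_univ, true_and] at hk ⊢
      rw [hg]
      exact (hadj _ _).2 hk
    · intro b hb
      obtain ⟨k, rfl⟩ := hgsurj b
      refine ⟨k, ?_, rfl⟩
      simp only [Finset.mem_filter, Finset.mem_univ, true_and] at hb ⊢
      rw [hg] at hb
      exact (hadj _ _).1 hb

/-- The sum in `hinj` is unchanged by any relabelling that preserves the weights. If it separates
the indices, the stabilizer of `1` fixes the connection set pointwise. Paths of length two may leave
the set, so this works even when no arc lies inside it. -/
theorem admitsORR_of_pathWeight [Finite G] [DecidableEq G] {n : ℕ} (e : Fin n → G)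
    (he : Function.Injective e) (hS : ∀ i j, e i * e j ≠ 1)
    (hgen : Subgroup.closure (Set.range e) = ⊤) (W : Fin n → Fin n → ℕ)
    (hW : ∀ i j, pathWeight e (e i) (e j) = W i j)
    (hinj : Function.Injective fun i => ∑ j, W i j * ∑ k, W j k ^ 2) : AdmitsORR G := by
  refine ⟨Set.range e, inter_inv_eq_empty ?_, digraphAut_eq_rightRegular hgen ?_⟩
  · rintro _ ⟨i, rfl⟩ _ ⟨j, rfl⟩
    exact hS i j
  intro φ hφ h1
  have hφe : ∀ i, ∃ j, e j = φ (e i) := fun i => (apply_mem_iff hφ h1 _).2 ⟨i, rfl⟩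
  choose σ hσ using hφe
  have hσi : Function.Injective σ := by
    intro a b hab
    exact he (φ.injective (by rw [← hσ, ← hσ, hab]))
  have hσW : ∀ i j, W (σ i) (σ j) = W i j := fun i j => by
    rw [← hW, ← hW, hσ, hσ, pathWeight_apply he hφ]
  have hσb := Finite.injective_iff_bijective.1 hσi
  rintro _ ⟨i, rfl⟩
  rw [← hσ]
  refine congrArg e (hinj ?_)
  refine (hσb.sum_comp fun j => W (σ i) j * ∑ k, W j k ^ 2).symm.trans ?_
  refine Finset.sum_congr rfl fun j _ => ?_
  rw [hσW, ← hσb.sum_comp fun k => W (σ j) k ^ 2]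
  simp only [hσW]

/-- Oriented regular representations are transported by isomorphisms. -/
theorem AdmitsORR.of_mulEquiv {H : Type*} [Group H] (f : G ≃* H) (hG : AdmitsORR G) :
    AdmitsORR H := by
  obtain ⟨S, hS, haut⟩ := hG
  refine ⟨f '' S, ?_, ?_⟩
  · rw [← Set.image_inv f S, ← Set.image_inter f.injective, hS, Set.image_empty]
  · ext φ
    have hconj : f.toEquiv.permCongr.symm φ ∈ digraphAut (cayley S) ↔
        φ ∈ digraphAut (cayley (f '' S)) := by
      rw [mem_digraphAut_cayley, mem_digraphAut_cayley]
      have key : ∀ a b : H, b * a⁻¹ ∈ f '' S ↔ f.symm b * (f.symm a)⁻¹ ∈ S := by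
        intro a b
        rw [← map_inv, ← map_mul]
        constructor
        · rintro ⟨s, hs, h⟩
          rw [← h]; simpa using hs
        · exact fun h => ⟨_, h, by simp⟩
      constructor
      · intro h a b
        have := h (f.symm a) (f.symm b)
        simp only [Equiv.permCongr_symm_apply] at this
        rw [key, key]
        simpa using this
      · intro h a b
        have := h (f a) (f b)
        rw [key, key] at this
        simpa using this
    rw [← hconj, haut, mem_rightRegular, mem_rightRegular]
    constructor
    · rintro ⟨g, hg⟩
      refine ⟨f g, fun a => ?_⟩
      have := hg (f.symm a)
      simpa [MulEquiv.symm_apply_eq, Equiv.symm_apply_eq] using congrArg f this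
    · rintro ⟨g, hg⟩
      exact ⟨f.symm g, fun a => by simp [hg]⟩

end Weights

/-! ### Central extensions of `C₂³` with prescribed squares and commutators -/

section Quadratic

/-- Squares of the generators `x`, `y`, `z` and the commutators defined by
`y * x = x * y * cyx` etc. -/
structure QuadData (Φ : Type*) where
  sx : Φ
  sy : Φ
  sz : Φ
  cyx : Φ
  czx : Φ
  czy : Φ

/-- The central extension of an elementary abelian group of order `8` by `Φ` with prescribed
squares and commutators of the three generators. -/
@[ext] structure Quad {Φ : Type*} (d : QuadData Φ) where
  i : ZMod 2
  j : ZMod 2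
  k : ZMod 2
  φ : Φ

instance {Φ : Type*} [Zero Φ] {d : QuadData Φ} : One (Quad d) := ⟨⟨0, 0, 0, 0⟩⟩

theorem Quad.one_def {Φ : Type*} [Zero Φ] {d : QuadData Φ} : (1 : Quad d) = ⟨0, 0, 0, 0⟩ := rfl

variable {Φ : Type*} [AddCommGroup Φ] [Module (ZMod 2) Φ]

/-- The bilinear cocycle that defines the multiplication of `Quad d`. -/
def QuadData.cocycle (d : QuadData Φ) (a b : Quad d) : Φ :=
  (a.i * b.i) • d.sx + (a.j * b.j) • d.sy + (a.k * b.k) • d.sz + (a.j * b.i) • d.cyx +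
    (a.k * b.i) • d.czx + (a.k * b.j) • d.czy

namespace Quad

variable {d : QuadData Φ}

instance : Mul (Quad d) :=
  ⟨fun a b => ⟨a.i + b.i, a.j + b.j, a.k + b.k, a.φ + b.φ + d.cocycle a b⟩⟩
instance : Inv (Quad d) := ⟨fun a => ⟨-a.i, -a.j, -a.k, -a.φ + d.cocycle a a⟩⟩

theorem mul_def (a b : Quad d) :
    a * b = ⟨a.i + b.i, a.j + b.j, a.k + b.k, a.φ + b.φ + d.cocycle a b⟩ := rfl
theorem inv_def (a : Quad d) : a⁻¹ = ⟨-a.i, -a.j, -a.k, -a.φ + d.cocycle a a⟩ := rfl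

instance : Group (Quad d) := Group.ofLeftAxioms
  (fun a b c => by
    ext
    · simp only [mul_def, add_assoc]
    · simp only [mul_def, add_assoc]
    · simp only [mul_def, add_assoc]
    · simp only [mul_def, QuadData.cocycle, add_mul, mul_add, add_smul]
      abel)
  (fun a => by ext <;> simp [mul_def, one_def, QuadData.cocycle])
  (fun a => by
    ext
    · simp only [mul_def, one_def, inv_def, neg_add_cancel]
    · simp only [mul_def, one_def, inv_def, neg_add_cancel]
    · simp only [mul_def, one_def, inv_def, neg_add_cancel]
    · simp only [mul_def, one_def, inv_def, QuadData.cocycle, neg_mul, neg_smul]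
      abel)

instance [DecidableEq Φ] : DecidableEq (Quad d) := fun a b =>
  decidable_of_iff (a.i = b.i ∧ a.j = b.j ∧ a.k = b.k ∧ a.φ = b.φ) Quad.ext_iff.symm

/-- `Quad d` as a product. -/
def equivProd (d : QuadData Φ) : Quad d ≃ ZMod 2 × ZMod 2 × ZMod 2 × Φ where
  toFun a := (a.i, a.j, a.k, a.φ)
  invFun a := ⟨a.1, a.2.1, a.2.2.1, a.2.2.2⟩
  left_inv _ := rfl
  right_inv _ := rfl

instance [Fintype Φ] : Fintype (Quad d) := Fintype.ofEquiv _ (equivProd d).symm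

variable {G : Type*} [Group G]

/-- Powers with exponents modulo `n`. -/
theorem pow_val_add {g : G} {n : ℕ} [NeZero n] (h : g ^ n = 1) (a b : ZMod n) :
    g ^ (a + b).val = g ^ a.val * g ^ b.val := by
  rw [← pow_add, ZMod.val_add, ← pow_mod_orderOf,
    Nat.mod_mod_of_dvd _ (orderOf_dvd_of_pow_eq_one h),
    pow_mod_orderOf]

/-- The homomorphism from `Quad d` given by three elements with the prescribed squares and
commutators. -/
def lift (x y z : G) (ι : Multiplicative Φ →* G) (hι : ∀ φ g, Commute (ι φ) g)
    (hx : x * x = ι (.ofAdd d.sx)) (hy : y * y = ι (.ofAdd d.sy)) (hz : z * z = ι (.ofAdd d.sz))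
    (hyx : y * x = x * (y * ι (.ofAdd d.cyx))) (hzx : z * x = x * (z * ι (.ofAdd d.czx)))
    (hzy : z * y = y * (z * ι (.ofAdd d.czy))) : Quad d →* G :=
  MonoidHom.mk' (fun a => x ^ a.i.val * (y ^ a.j.val * (z ^ a.k.val * ι (.ofAdd a.φ)))) (by
    have h01 : ∀ i : ZMod 2, i = 0 ∨ i = 1 := by decide
    -- Collection to the normal form `x^i y^j z^k ι(φ)`: `sq` and `cm` are the rewriting rules, and
    -- the central terms they produce add up to the cocycle.
    have sq : ∀ {g : G} {s : Φ} (_ : g * g = ι (.ofAdd s)) (i j : ZMod 2),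
        g ^ i.val * g ^ j.val = g ^ (i + j).val * ι (.ofAdd ((i * j) • s)) := by
      intro g s hg i j
      rcases h01 i with rfl | rfl <;> rcases h01 j with rfl | rfl <;>
        simp [ZMod.val_one, hg, show (1 + 1 : ZMod 2) = 0 from rfl]
    have cm : ∀ {g h : G} {s : Φ} (_ : h * g = g * (h * ι (.ofAdd s))) (i j : ZMod 2),
        h ^ j.val * g ^ i.val = g ^ i.val * (h ^ j.val * ι (.ofAdd ((j * i) • s))) := by
      intro g h s hg i j
      rcases h01 i with rfl | rfl <;> rcases h01 j with rfl | rfl <;>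
        simp [ZMod.val_one, hg]
    have sq' : ∀ {g : G} {s : Φ} (_ : g * g = ι (.ofAdd s)) (i j : ZMod 2) (w : G),
        g ^ i.val * (g ^ j.val * w) = g ^ (i + j).val * (ι (.ofAdd ((i * j) • s)) * w) :=
      fun hg i j w => by rw [← mul_assoc, sq hg, mul_assoc]
    have cm' : ∀ {g h : G} {s : Φ} (_ : h * g = g * (h * ι (.ofAdd s))) (i j : ZMod 2) (w : G),
        h ^ j.val * (g ^ i.val * w) =
          g ^ i.val * (h ^ j.val * (ι (.ofAdd ((j * i) • s)) * w)) :=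
      fun hg i j w => by rw [← mul_assoc, cm hg]; simp only [mul_assoc]
    have ci' : ∀ (g : G) (i : ZMod 2) φ w, ι φ * (g ^ i.val * w) = g ^ i.val * (ι φ * w) :=
      fun g i φ w => by rw [← mul_assoc, (hι φ _).eq, mul_assoc]
    intro a b
    simp only [mul_def, mul_assoc, ci', cm' hyx, cm' hzx, cm' hzy, sq' hx, sq' hy, sq' hz,
      ← map_mul, ← ofAdd_add]
    refine congrArg (fun t => _ * (_ * (_ * ι (Multiplicative.ofAdd t)))) ?_
    simp only [QuadData.cocycle]
    abel)

section Bijective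

variable (x y z : G) (ι : Multiplicative Φ →* G) (hι : ∀ φ g, Commute (ι φ) g)
    (hx : x * x = ι (.ofAdd d.sx)) (hy : y * y = ι (.ofAdd d.sy)) (hz : z * z = ι (.ofAdd d.sz))
    (hyx : y * x = x * (y * ι (.ofAdd d.cyx))) (hzx : z * x = x * (z * ι (.ofAdd d.czx)))
    (hzy : z * y = y * (z * ι (.ofAdd d.czy)))

theorem lift_apply (a : Quad d) : lift x y z ι hι hx hy hz hyx hzx hzy a =
    x ^ a.i.val * (y ^ a.j.val * (z ^ a.k.val * ι (.ofAdd a.φ))) := rfl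

theorem lift_surjective (h : Generates x y z) :
    Function.Surjective (lift x y z ι hι hx hy hz hyx hzx hzy) := by
  rw [← MonoidHom.range_eq_top, ← top_le_iff, ← h, Subgroup.closure_le]
  rintro _ (rfl | rfl | rfl)
  · exact ⟨⟨1, 0, 0, 0⟩, by simp [lift_apply, ZMod.val_one]⟩
  · exact ⟨⟨0, 1, 0, 0⟩, by simp [lift_apply, ZMod.val_one]⟩
  · exact ⟨⟨0, 0, 1, 0⟩, by simp [lift_apply, ZMod.val_one]⟩

end Bijective

/-- A central involution that is part of a minimal generating set is not a product of squares. -/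
theorem notMem_closure_squares (h2 : ∀ a b : G, Subgroup.closure {a, b} ≠ ⊤) {g y z : G}
    (h : Generates g y z) (hg : ∀ u, Commute g u) (hg2 : g * g = 1) :
    g ∉ Subgroup.closure (Set.range fun u : G => u * u) := by
  have hnot := not_mem_closure h2 h.swap₁₂.swap₂₃
  -- Since `u` and `gu` have the same square, this puts every square into `⟨y, z⟩`, which does not
  -- contain `g`.
  have hcov : ∀ u : G, u ∈ Subgroup.closure {y, z} ∨ g * u ∈ Subgroup.closure {y, z} := by
    intro u
    have hu : u ∈ Subgroup.closure {g, y, z} := by rw [h]; trivial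
    induction hu using Subgroup.closure_induction with
    | mem u hu =>
      rcases hu with rfl | rfl | rfl
      · exact Or.inr (hg2 ▸ one_mem _)
      · exact Or.inl (left_mem _ _)
      · exact Or.inl (right_mem _ _)
    | one => exact Or.inl (one_mem _)
    | mul a b _ _ iha ihb =>
      rcases iha with ha | ha <;> rcases ihb with hb | hb
      · exact Or.inl (mul_mem ha hb)
      · refine Or.inr ?_
        rw [← mul_assoc, (hg a).eq, mul_assoc]
        exact mul_mem ha hb
      · refine Or.inr ?_
        rw [← mul_assoc]
        exact mul_mem ha hb
      · refine Or.inl ?_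
        have : a * b = g * a * (g * b) := by
          rw [(hg a).eq, mul_assoc, ← mul_assoc g, hg2, one_mul]
        rw [this]
        exact mul_mem ha hb
    | inv a _ ih =>
      rcases ih with ha | ha
      · exact Or.inl (inv_mem ha)
      · refine Or.inr ?_
        have : g * a⁻¹ = (g * a)⁻¹ := by
          rw [mul_inv_rev, ← eq_inv_of_mul_eq_one_left hg2, (hg a).inv_right.eq]
        rw [this]
        exact inv_mem ha
  intro hmem
  refine hnot ((Subgroup.closure_le _).2 ?_ hmem)
  rintro _ ⟨u, rfl⟩
  rcases hcov u with hu | hu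
  · exact mul_mem hu hu
  · have : g * u * (g * u) = u * u := by
      rw [mul_assoc, ← mul_assoc u g u, ← (hg u).eq, mul_assoc g u u, ← mul_assoc, hg2, one_mul]
    have h3 := mul_mem hu hu
    rwa [this] at h3

/-- A group with the prescribed squares and commutators is isomorphic to `Quad d`. -/
theorem nonempty_mulEquiv (h2 : ∀ a b : G, Subgroup.closure {a, b} ≠ ⊤) {x y z : G}
    (h : Generates x y z) (ι : Multiplicative Φ →* G) (hι : ∀ φ g, Commute (ι φ) g)
    (hx : x * x = ι (.ofAdd d.sx)) (hy : y * y = ι (.ofAdd d.sy)) (hz : z * z = ι (.ofAdd d.sz))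
    (hyx : y * x = x * (y * ι (.ofAdd d.cyx))) (hzx : z * x = x * (z * ι (.ofAdd d.czx)))
    (hzy : z * y = y * (z * ι (.ofAdd d.czy))) (hinj : ∀ φ, ι (.ofAdd φ) = 1 → φ = 0)
    (hsq : ∀ φ, ι φ ∈ Subgroup.closure (Set.range fun u : G => u * u)) :
    Nonempty (Quad d ≃* G) := by
  refine ⟨MulEquiv.ofBijective (lift x y z ι hι hx hy hz hyx hzx hzy)
    ⟨?_, lift_surjective x y z ι hι hx hy hz hyx hzx hzy h⟩⟩
  rw [injective_iff_map_eq_one]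
  rintro ⟨i, j, k, φ⟩ ha
  rw [lift_apply] at ha
  simp only at ha
  have h01 : ∀ i : ZMod 2, i = 0 ∨ i = 1 := by decide
  have hc2 : ι (.ofAdd φ) * ι (.ofAdd φ) = 1 := by
    rw [← map_mul, ← ofAdd_add]
    have : φ + φ = 0 := by
      rw [← two_smul (ZMod 2) φ, show (2 : ZMod 2) = 0 from rfl, zero_smul]
    rw [this, ofAdd_zero, map_one]
  have hci : (ι (.ofAdd φ))⁻¹ = ι (.ofAdd φ) := inv_eq_of_mul_eq_one_left hc2
  -- A kernel element with `(i, j, k) ≠ 0` would make `x^i y^j z^k`, a member of a generating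
  -- triple, equal to a central element of trivial square that is a product of squares. This
  -- replaces a comparison of orders.
  have hcon : ∀ {g u v : G}, Generates g u v → g = ι (.ofAdd φ) → False := by
    rintro g u v hg rfl
    exact notMem_closure_squares h2 hg (hι _) hc2 (hsq _)
  have hw : x ^ i.val * (y ^ j.val * z ^ k.val) = ι (.ofAdd φ) := by
    rw [← hci, ← mul_eq_one_iff_eq_inv]
    simpa only [mul_assoc] using ha
  rcases h01 i with rfl | rfl
  · rcases h01 j with rfl | rfl
    · rcases h01 k with rfl | rfl
      · simp only [ZMod.val_zero, pow_zero, one_mul] at ha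
        rw [hinj φ ha]; rfl
      · exact (hcon h.swap₂₃.swap₁₂ (by simpa [ZMod.val_one] using hw)).elim
    · have hg := h.swap₂₃.mul₃_right (pow_mem (right_mem x z) k.val)
      exact (hcon hg.swap₂₃.swap₁₂ (by simpa [ZMod.val_one] using hw)).elim
  · have hg := h.swap₁₂.swap₂₃.mul₃_right
      (mul_mem (pow_mem (left_mem y z) j.val) (pow_mem (right_mem y z) k.val))
    exact (hcon hg.swap₂₃.swap₁₂ (by simpa [ZMod.val_one] using hw)).elim

end Quad
end Quadratic

/-! ### Explicit representations in orders 16, 32 and 64 -/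

section Representations

/-- The direct product of a quaternion group and a group of order `2`. -/
def dataQ8C2 : QuadData (ZMod 2) := ⟨1, 1, 0, 1, 0, 0⟩

/-- Order `32`: `x ^ 2 = (x * y) ^ 2`, `(x * z) ^ 2 = (x * y * z) ^ 2`, `y`, `z` commuting
involutions. -/
def data32 : QuadData (ZMod 2 × ZMod 2) := ⟨(1, 0), 0, 0, 0, (1, 1), 0⟩

/-- Order `64`: `x ^ 2`, `(x * y) ^ 2`, `(x * z) ^ 2` independent, `y`, `z` commuting
involutions. -/
def data64 : QuadData (ZMod 2 × ZMod 2 × ZMod 2) := ⟨(1, 0, 0), 0, 0, (1, 1, 0), (1, 0, 1), 0⟩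

theorem closure_range_eq_top {G : Type*} [Group G] {n : ℕ} {e : Fin n → G}
    (w : G → List (Fin n)) (hw : ∀ a, ((w a).map e).prod = a) :
    Subgroup.closure (Set.range e) = ⊤ := by
  refine top_le_iff.1 fun a _ => ?_
  rw [← hw a]
  refine list_prod_mem fun g hg => ?_
  obtain ⟨i, -, rfl⟩ := List.mem_map.1 hg
  exact Subgroup.subset_closure ⟨i, rfl⟩

/-- The list `l` if the exponent `a` is not zero. -/
def powWord {n : ℕ} (a : ZMod 2) (l : List (Fin n)) : List (Fin n) := if a = 0 then [] else l

/-- Connection set of an oriented regular representation. -/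
def gens64 : Fin 6 → Quad data64 :=
  ![⟨1, 0, 0, (0, 0, 0)⟩, ⟨1, 1, 0, (0, 0, 0)⟩, ⟨1, 0, 1, (0, 0, 0)⟩, ⟨1, 1, 1, (1, 1, 1)⟩,
    ⟨1, 1, 0, (1, 0, 0)⟩, ⟨1, 0, 1, (1, 0, 1)⟩]

/-- All weights are below `100`: no arc joins two elements of the connection set, and paths of
length two alone tell its elements apart. The same holds for `admitsORR_data32`. -/
theorem admitsORR_data64 : AdmitsORR (Quad data64) :=
  admitsORR_of_pathWeight gens64 (by decide +kernel) (by decide +kernel)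
    -- The words are `y = x³ · xy`, `z = x³ · xz`, and the squares of `x`, `xy`, `xz` for the basis
    -- of the central part.
    (closure_range_eq_top (fun a => powWord a.i [0] ++ powWord a.j [0, 0, 0, 1] ++
      powWord a.k [0, 0, 0, 2] ++ powWord a.φ.1 [0, 0] ++ powWord a.φ.2.1 [1, 1] ++
      powWord a.φ.2.2 [2, 2]) (by decide +kernel))
    ![![0, 2, 1, 1, 1, 1], ![2, 0, 2, 0, 3, 1], ![1, 2, 0, 0, 1, 0], ![1, 0, 0, 0, 0, 1],
      ![1, 3, 1, 0, 0, 1], ![1, 1, 0, 1, 1, 0]] (by decide +kernel) (by decide +kernel)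

/-- Connection set of an oriented regular representation. -/
def gens32 : Fin 6 → Quad data32 :=
  ![⟨1, 0, 0, (0, 0)⟩, ⟨1, 1, 0, (0, 0)⟩, ⟨1, 0, 1, (0, 0)⟩, ⟨1, 1, 1, (0, 0)⟩,
    ⟨1, 0, 1, (1, 0)⟩, ⟨1, 0, 0, (1, 1)⟩]

theorem admitsORR_data32 : AdmitsORR (Quad data32) :=
  admitsORR_of_pathWeight gens32 (by decide +kernel) (by decide +kernel)
    (closure_range_eq_top (fun a => powWord a.i [0] ++ powWord a.j [0, 0, 0, 1] ++
      powWord a.k [0, 0, 0, 2] ++ powWord a.φ.1 [0, 0] ++ powWord a.φ.2 [2, 2])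
      (by decide +kernel))
    ![![0, 0, 2, 1, 3, 2], ![0, 0, 1, 2, 3, 2], ![2, 1, 0, 0, 3, 2], ![1, 2, 0, 0, 2, 1],
      ![3, 3, 3, 2, 0, 3], ![2, 2, 2, 1, 3, 0]] (by decide +kernel) (by decide +kernel)

/-- Connection set of an oriented regular representation. -/
def gensQ8C2 : Fin 4 → Quad dataQ8C2 :=
  ![⟨1, 0, 0, 0⟩, ⟨0, 1, 0, 0⟩, ⟨1, 1, 0, 0⟩, ⟨1, 0, 1, 0⟩]

theorem admitsORR_dataQ8C2 : AdmitsORR (Quad dataQ8C2) :=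
  admitsORR_of_pathWeight gensQ8C2 (by decide +kernel) (by decide +kernel)
    (closure_range_eq_top (fun a => powWord a.i [0] ++ powWord a.j [1] ++
      powWord a.k [0, 0, 0, 3] ++ powWord a.φ [0, 0]) (by decide +kernel))
    ![![0, 101, 1, 0], ![1, 0, 101, 1], ![101, 1, 0, 1], ![0, 1, 1, 0]]
    (by decide +kernel) (by decide +kernel)

end Representations

/-! ### The abelian groups `C₃³` and `C₃ × C₂³` -/

section AbelianModels

/-- Connection set of an oriented regular representation. -/
def gens27 : Fin 6 → C 3 × C 3 × C 3 :=
  ![(.ofAdd 1, .ofAdd 0, .ofAdd 0), (.ofAdd 0, .ofAdd 1, .ofAdd 0), (.ofAdd 1, .ofAdd 1, .ofAdd 0),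
    (.ofAdd 1, .ofAdd 2, .ofAdd 0), (.ofAdd 0, .ofAdd 0, .ofAdd 1), (.ofAdd 1, .ofAdd 0, .ofAdd 1)]

theorem admitsORR_C3_C3_C3 : AdmitsORR (C 3 × C 3 × C 3) :=
  admitsORR_of_pathWeight gens27 (by decide +kernel) (by decide +kernel)
    (closure_range_eq_top (fun a => List.replicate a.1.toAdd.val 0 ++
      List.replicate a.2.1.toAdd.val 1 ++ List.replicate a.2.2.toAdd.val 4) (by decide +kernel))
    ![![0, 3, 100, 1, 2, 100], ![102, 0, 102, 102, 0, 2], ![1, 3, 0, 100, 2, 0],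
      ![100, 3, 1, 0, 2, 2], ![2, 0, 0, 0, 0, 102], ![1, 0, 0, 0, 3, 0]]
    (by decide +kernel) (by decide +kernel)

variable {G : Type*} [Group G]

theorem Generates.mul_comm {x y z : G} (h : Generates x y z) (hxy : Commute x y)
    (hxz : Commute x z) (hyz : Commute y z) (a b : G) : a * b = b * a := by
  have := Subgroup.isMulCommutative_closure (k := {x, y, z}) (by
    rintro a (rfl | rfl | rfl) b (rfl | rfl | rfl) <;>
      first | rfl | exact hxy.eq | exact hxz.eq | exact hyz.eq | exact hxy.symm.eq |
        exact hxz.symm.eq | exact hyz.symm.eq)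
  have htop : ∀ g : G, g ∈ Subgroup.closure {x, y, z} := fun g => by rw [h]; trivial
  exact setLike_mul_comm (htop a) (htop b)

/-- A nonzero exponent is invertible modulo `p`, so `g` would be a power of an element of `H`. -/
theorem eq_zero_of_pow_val_mem {H : Subgroup G} {g : G} {p : ℕ} [Fact p.Prime] (hg : g ^ p = 1)
    (hgH : g ∉ H) {a : ZMod p} (ha : g ^ a.val ∈ H) : a = 0 := by
  by_contra ha0
  have hcop : a.val.Coprime p := by
    refine (Nat.coprime_of_lt_prime ?_ (ZMod.val_lt a) Fact.out).symm
    simpa using ha0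
  obtain ⟨m, hm⟩ := exists_pow_eq_self_of_coprime
    (hcop.coprime_dvd_right (orderOf_dvd_of_pow_eq_one hg))
  exact hgH (hm ▸ pow_mem ha m)

/-- No generator lies in the subgroup of the other two; as the exponents live modulo the prime `3`,
the generators are independent. -/
theorem nonempty_mulEquiv_C3 (h2 : ∀ a b : G, Subgroup.closure {a, b} ≠ ⊤) {x y z : G}
    (h : Generates x y z) (hxy : Commute x y) (hxz : Commute x z) (hyz : Commute y z)
    (hx : x ^ 3 = 1) (hy : y ^ 3 = 1) (hz : z ^ 3 = 1) : Nonempty (C 3 × C 3 × C 3 ≃* G) := by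
  have hc := h.mul_comm hxy hxz hyz
  let f : C 3 × C 3 × C 3 →* G := MonoidHom.mk'
    (fun a => x ^ a.1.toAdd.val * (y ^ a.2.1.toAdd.val * z ^ a.2.2.toAdd.val)) (by
      intro a b
      let _ : CommGroup G := { (inferInstance : Group G) with mul_comm := hc }
      simp only [Prod.fst_mul, Prod.snd_mul, toAdd_mul, Quad.pow_val_add hx, Quad.pow_val_add hy,
        Quad.pow_val_add hz]
      rw [mul_mul_mul_comm (y ^ _), mul_mul_mul_comm (x ^ _)])
  have hf : ∀ a, f a = x ^ a.1.toAdd.val * (y ^ a.2.1.toAdd.val * z ^ a.2.2.toAdd.val) :=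
    fun _ => rfl
  refine ⟨MulEquiv.ofBijective f ⟨?_, ?_⟩⟩
  · rw [injective_iff_map_eq_one]
    rintro ⟨a, b, c⟩ habc
    rw [hf] at habc
    simp only at habc
    have ha : a.toAdd = 0 := by
      refine eq_zero_of_pow_val_mem hx (not_mem_closure h2 h.swap₁₂.swap₂₃) ?_
      rw [eq_inv_of_mul_eq_one_left habc]
      exact inv_mem (mul_mem (pow_mem (left_mem _ _) _) (pow_mem (right_mem _ _) _))
    rw [ha, ZMod.val_zero, pow_zero, one_mul] at habc
    have hb : b.toAdd = 0 := by
      refine eq_zero_of_pow_val_mem hy (not_mem_closure h2 h.swap₂₃) ?_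
      rw [eq_inv_of_mul_eq_one_left habc]
      exact inv_mem (pow_mem (right_mem _ _) _)
    rw [hb, ZMod.val_zero, pow_zero, one_mul] at habc
    have hc : c.toAdd = 0 := by
      refine eq_zero_of_pow_val_mem hz (not_mem_closure h2 h) ?_
      rw [habc]
      exact one_mem _
    exact Prod.ext ha (Prod.ext hb hc)
  · rw [← MonoidHom.range_eq_top, ← top_le_iff, ← h, Subgroup.closure_le]
    rintro _ (rfl | rfl | rfl)
    · exact ⟨(.ofAdd 1, 1, 1), by simp [hf, ZMod.val_one]⟩
    · exact ⟨(1, .ofAdd 1, 1), by simp [hf, ZMod.val_one]⟩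
    · exact ⟨(1, 1, .ofAdd 1), by simp [hf, ZMod.val_one]⟩

/-- The element `x` of order `6` splits as `x⁴ · x³ = x⁷` into its `3`-part and its `2`-part. -/
theorem nonempty_mulEquiv_C3_C2 (h2 : ∀ a b : G, Subgroup.closure {a, b} ≠ ⊤) {x y z : G}
    (h : Generates x y z) (hxy : Commute x y) (hxz : Commute x z) (hyz : Commute y z)
    (hx : x ^ 6 = 1) (hx2 : x ^ 2 ≠ 1) (hx3 : x ^ 3 ≠ 1) (hy : y ^ 2 = 1) (hz : z ^ 2 = 1) :
    Nonempty (C 3 × (Fin 3 → C 2) ≃* G) := by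
  have hc := h.mul_comm hxy hxz hyz
  have hu : (x ^ 4) ^ 3 = 1 := by rw [← pow_mul, show 4 * 3 = 6 * 2 from rfl, pow_mul, hx, one_pow]
  have hv : (x ^ 3) ^ 2 = 1 := by rw [← pow_mul, hx]
  let f : C 3 × (Fin 3 → C 2) →* G := MonoidHom.mk'
    (fun a => (x ^ 4) ^ a.1.toAdd.val * ((x ^ 3) ^ (a.2 0).toAdd.val *
      (y ^ (a.2 1).toAdd.val * z ^ (a.2 2).toAdd.val))) (by
      intro a b
      let _ : CommGroup G := { (inferInstance : Group G) with mul_comm := hc }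
      simp only [Prod.fst_mul, Prod.snd_mul, Pi.mul_apply, toAdd_mul, Quad.pow_val_add hu,
        Quad.pow_val_add hv, Quad.pow_val_add hy, Quad.pow_val_add hz]
      rw [mul_mul_mul_comm (y ^ _), mul_mul_mul_comm ((x ^ 3) ^ _),
        mul_mul_mul_comm ((x ^ 4) ^ _)])
  have hf : ∀ a, f a = (x ^ 4) ^ a.1.toAdd.val * ((x ^ 3) ^ (a.2 0).toAdd.val *
      (y ^ (a.2 1).toAdd.val * z ^ (a.2 2).toAdd.val)) := fun _ => rfl
  refine ⟨MulEquiv.ofBijective f ⟨?_, ?_⟩⟩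
  · rw [injective_iff_map_eq_one]
    rintro ⟨a, b⟩ habc
    rw [hf] at habc
    simp only at habc
    have hz0 : (b 2).toAdd = 0 := by
      refine eq_zero_of_pow_val_mem hz (not_mem_closure h2 h) ?_
      rw [← mul_assoc, ← mul_assoc] at habc
      rw [eq_inv_of_mul_eq_one_right habc]
      exact inv_mem (mul_mem (mul_mem (pow_mem (pow_mem (left_mem _ _) _) _)
        (pow_mem (pow_mem (left_mem _ _) _) _)) (pow_mem (right_mem _ _) _))
    rw [hz0, ZMod.val_zero, pow_zero, mul_one] at habc
    have hy0 : (b 1).toAdd = 0 := by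
      refine eq_zero_of_pow_val_mem hy (not_mem_closure h2 h.swap₂₃) ?_
      rw [← mul_assoc] at habc
      rw [eq_inv_of_mul_eq_one_right habc]
      exact inv_mem (mul_mem (pow_mem (pow_mem (left_mem _ _) _) _)
        (pow_mem (pow_mem (left_mem _ _) _) _))
    rw [hy0, ZMod.val_zero, pow_zero, mul_one] at habc
    have h4 : x ^ 4 ≠ 1 := fun h4 => hx2 (by
      rw [show 6 = 4 + 2 from rfl, pow_add, h4, one_mul] at hx; exact hx)
    have key : ∀ a : ZMod 3, ∀ b : ZMod 2, (x ^ 4) ^ a.val * (x ^ 3) ^ b.val = 1 →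
        a = 0 ∧ b = 0 := by
      intro a b hab
      -- Cubing kills the factor of order `3` and fixes the involution.
      have h1 : ((x ^ 4) ^ a.val * (x ^ 3) ^ b.val) ^ 3 = (x ^ 3) ^ b.val := by
        rw [← pow_mul, ← pow_mul, ← pow_add, ← pow_mul,
          show (4 * a.val + 3 * b.val) * 3 = 6 * (2 * a.val + b.val) + 3 * b.val by ring, pow_add,
          pow_mul, hx, one_pow, one_mul]
      rw [hab, one_pow] at h1
      have hb : b = 0 := eq_zero_of_pow_val_mem (H := ⊥) hv (by simpa using hx3)
        (by simpa using h1.symm)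
      rw [← h1, mul_one] at hab
      exact ⟨eq_zero_of_pow_val_mem (H := ⊥) hu (by simpa using h4) (by simpa using hab), hb⟩
    obtain ⟨ha, hb⟩ := key _ _ habc
    refine Prod.ext ha (funext fun i => ?_)
    fin_cases i
    · exact hb
    · exact hy0
    · exact hz0
  · rw [← MonoidHom.range_eq_top, ← top_le_iff, ← h, Subgroup.closure_le]
    rintro g (rfl | rfl | rfl)
    · refine ⟨(.ofAdd 1, ![.ofAdd 1, 1, 1]), ?_⟩
      rw [hf]
      change (g ^ 4) ^ 1 * ((g ^ 3) ^ 1 * (y ^ 0 * z ^ 0)) = g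
      rw [pow_zero, pow_zero, mul_one, mul_one, pow_one, pow_one, ← pow_add,
        show 4 + 3 = 6 + 1 from rfl, pow_succ, hx, one_mul]
    · exact ⟨(1, ![1, .ofAdd 1, 1]), by simp [hf, ZMod.val_one]⟩
    · exact ⟨(1, ![1, 1, .ofAdd 1]), by simp [hf, ZMod.val_one]⟩

end AbelianModels

/-! ### Groups in which every admissible set has a nontrivial stabilizer -/

section NoRepresentation

variable {M : Type*} [Group M]

/-- A group automorphism preserving `S` is an automorphism of the Cayley digraph that fixes `1`;
among right translations only the identity fixes `1`. -/
theorem not_admitsORR_of_stabilizer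
    (h : ∀ S : Set M, S ∩ S⁻¹ = ∅ → ∃ α : M ≃* M, (∃ a, α a ≠ a) ∧ ∀ a, α a ∈ S ↔ a ∈ S) :
    ¬ AdmitsORR M := by
  rintro ⟨S, hS, haut⟩
  obtain ⟨α, ⟨a, ha⟩, hα⟩ := h S hS
  have hmem : α.toEquiv ∈ digraphAut (cayley S) := by
    rw [mem_digraphAut_cayley]
    intro x y
    have := hα (y * x⁻¹)
    rwa [map_mul, map_inv] at this
  rw [haut, mem_rightRegular] at hmem
  obtain ⟨g, hg⟩ := hmem
  have h1 : g = 1 := by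
    have := hg 1
    simpa using this.symm
  refine ha ?_
  have := hg a
  rwa [h1, mul_one] at this

/-- Subsets without inverse pairs are coded by functions `c` to `Fin 3`, where `r` lists
representatives of the pairs of elements that are not involutions, and `c i` tells which of
`r i`, `(r i)⁻¹` occurs. Automorphisms act on the codes by signed permutations. -/
theorem not_admitsORR_of_codes [Finite M] {ι κ : Type*} (r : ι → M) (α : κ → M →* M)
    (hinj : ∀ k a, α k a = 1 → a = 1)
    (hne : ∀ k, ∃ a, α k a ≠ a) (hr : ∀ a, a * a = 1 ∨ ∃ i, a = r i ∨ a = (r i)⁻¹)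
    (P : κ → ι → ι) (s : κ → ι → Bool)
    (hP : ∀ k i, α k (r i) = if s k i then (r (P k i))⁻¹ else r (P k i))
    (key : ∀ c : ι → Fin 3, ∃ k, ∀ i, c (P k i) = if s k i then -c i else c i) :
    ¬ AdmitsORR M := by
  classical
  refine not_admitsORR_of_stabilizer fun S hS => ?_
  have hdisj : ∀ a ∈ S, a⁻¹ ∉ S := fun a ha ha' =>
    Set.eq_empty_iff_forall_notMem.1 hS a ⟨ha, ha'⟩
  let c : ι → Fin 3 := fun i => if r i ∈ S then 1 else if (r i)⁻¹ ∈ S then -1 else 0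
  have h1 : (1 : Fin 3) ≠ -1 := by decide
  have c1 : ∀ i, r i ∈ S ↔ c i = 1 := by
    intro i
    by_cases h : r i ∈ S
    · simp [c, h]
    · by_cases h' : (r i)⁻¹ ∈ S <;> simp [c, h, h', h1.symm]
  have c2 : ∀ i, (r i)⁻¹ ∈ S ↔ c i = -1 := by
    intro i
    by_cases h : r i ∈ S
    · simp [c, h, hdisj _ h, h1]
    · by_cases h' : (r i)⁻¹ ∈ S <;> simp [c, h, h']
  obtain ⟨k, hk⟩ := key c
  have hf : Function.Injective (α k) := (injective_iff_map_eq_one _).2 (hinj k)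
  refine ⟨MulEquiv.ofBijective (α k) (Finite.injective_iff_bijective.1 hf), hne k, fun a => ?_⟩
  change α k a ∈ S ↔ a ∈ S
  have hone : ∀ b : M, b * b = 1 → b ∉ S := fun b hb hbS =>
    hdisj b hbS ((eq_inv_of_mul_eq_one_left hb) ▸ hbS)
  have hneg : ∀ a b : Fin 3, -a = b ↔ a = -b := by decide
  rcases hr a with ha | ⟨i, rfl | rfl⟩
  · refine iff_of_false (hone _ ?_) (hone _ ha)
    rw [← map_mul, ha, map_one]
  · have := hk i
    rw [hP]
    cases hs : s k i
    · simp only [hs, Bool.false_eq_true, if_false] at this ⊢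
      rw [c1, c1, this]
    · simp only [hs, if_true] at this ⊢
      rw [c2, c1, this, hneg, neg_neg]
  · have := hk i
    rw [map_inv, hP]
    cases hs : s k i
    · simp only [hs, Bool.false_eq_true, if_false] at this ⊢
      rw [c2, c2, this]
    · simp only [hs, if_true, inv_inv] at this ⊢
      rw [c1, c2, this, hneg]

/-- The conditions under which `x`, `y`, `z` and the map `m` on `Φ` define an endomorphism of
`Quad d`. -/
def Quad.IsEnd {Φ : Type*} [AddCommGroup Φ] [Module (ZMod 2) Φ] {d : QuadData Φ} (m : Φ →+ Φ)
    (t : Quad d × Quad d × Quad d) : Prop :=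
  t.1 * t.1 = ⟨0, 0, 0, m d.sx⟩ ∧ t.2.1 * t.2.1 = ⟨0, 0, 0, m d.sy⟩ ∧
    t.2.2 * t.2.2 = ⟨0, 0, 0, m d.sz⟩ ∧ t.2.1 * t.1 = t.1 * (t.2.1 * ⟨0, 0, 0, m d.cyx⟩) ∧
    t.2.2 * t.1 = t.1 * (t.2.2 * ⟨0, 0, 0, m d.czx⟩) ∧
    t.2.2 * t.2.1 = t.2.1 * (t.2.2 * ⟨0, 0, 0, m d.czy⟩)

instance {Φ : Type*} [AddCommGroup Φ] [Module (ZMod 2) Φ] [DecidableEq Φ] {d : QuadData Φ}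
    (m : Φ →+ Φ) (t : Quad d × Quad d × Quad d) : Decidable (Quad.IsEnd m t) := by
  unfold Quad.IsEnd; infer_instance

/-- The endomorphism of `Quad d` given by the images of `x`, `y`, `z` and a map on `Φ`. -/
def Quad.mapOf {Φ : Type*} [AddCommGroup Φ] [Module (ZMod 2) Φ] {d : QuadData Φ} (m : Φ →+ Φ)
    (t : Quad d × Quad d × Quad d) (ht : Quad.IsEnd m t) : Quad d →* Quad d :=
  Quad.lift t.1 t.2.1 t.2.2
    (MonoidHom.mk' (fun φ : Multiplicative Φ => (⟨0, 0, 0, m φ.toAdd⟩ : Quad d)) (by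
      intro a b
      simp [Quad.mul_def, QuadData.cocycle]))
    (by
      intro φ g
      rw [Commute, SemiconjBy]
      simp [Quad.mul_def, QuadData.cocycle, add_comm])
    ht.1 ht.2.1 ht.2.2.1 ht.2.2.2.1 ht.2.2.2.2.1 ht.2.2.2.2.2

/-- The direct product of a cyclic group of order `4` and two groups of order `2`. -/
def dataC4 : QuadData (ZMod 2) := ⟨1, 0, 0, 0, 0, 0⟩

/-- The central product of a quaternion group and a cyclic group of order `4`. -/
def data16 : QuadData (ZMod 2) := ⟨1, 1, 1, 0, 1, 0⟩

/-- Order `32`: `x ^ 2 * y ^ 2 * z ^ 2 = 1`, all products of distinct generators are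
involutions. -/
def data32' : QuadData (ZMod 2 × ZMod 2) := ⟨(1, 0), (0, 1), (1, 1), (1, 1), (0, 1), (1, 0)⟩

/-- Images of the generators under automorphisms of `Quad dataC4`. -/
def autC4 : Fin 6 → Quad dataC4 × Quad dataC4 × Quad dataC4 :=
  ![(⟨1, 0, 0, 0⟩, ⟨0, 1, 0, 0⟩, ⟨0, 1, 1, 0⟩), (⟨1, 0, 0, 0⟩, ⟨0, 1, 0, 0⟩, ⟨0, 1, 1, 1⟩),
    (⟨1, 0, 0, 0⟩, ⟨0, 0, 1, 0⟩, ⟨0, 1, 0, 0⟩), (⟨1, 0, 0, 0⟩, ⟨0, 1, 1, 0⟩, ⟨0, 0, 1, 0⟩),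
    (⟨1, 0, 0, 0⟩, ⟨0, 0, 1, 1⟩, ⟨0, 1, 0, 1⟩), (⟨1, 0, 0, 0⟩, ⟨0, 1, 1, 1⟩, ⟨0, 0, 1, 0⟩)]

theorem isEnd_autC4 : ∀ k, Quad.IsEnd (.id _) (autC4 k) := by decide +kernel

theorem forall_fin_four {β : Type*} {p : (Fin 4 → β) → Prop}
    (h : ∀ a b c d, p ![a, b, c, d]) (f : Fin 4 → β) : p f := by
  have : f = ![f 0, f 1, f 2, f 3] := by ext i; fin_cases i <;> rfl
  exact this ▸ h _ _ _ _

theorem forall_fin_six {β : Type*} {p : (Fin 6 → β) → Prop}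
    (h : ∀ a b c d e g, p ![a, b, c, d, e, g]) (f : Fin 6 → β) : p f := by
  have : f = ![f 0, f 1, f 2, f 3, f 4, f 5] := by ext i; fin_cases i <;> rfl
  exact this ▸ h _ _ _ _ _ _

/-- Up to sign the codes of `xy`, `xz`, `xyz` take only the values `0` and `1`, so two agree up to
sign. The automorphisms fix `x` and interchange two of these three elements, with or without
inversion. -/
theorem not_admitsORR_dataC4 : ¬ AdmitsORR (Quad dataC4) :=
  not_admitsORR_of_codes (ι := Fin 4) (κ := Fin 6)
    ![⟨1, 0, 0, 0⟩, ⟨1, 1, 0, 0⟩, ⟨1, 0, 1, 0⟩, ⟨1, 1, 1, 0⟩]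
    (fun k => Quad.mapOf (.id _) (autC4 k) (isEnd_autC4 k))
    (by decide +kernel) (by decide +kernel) (by decide +kernel)
    ![![0, 1, 3, 2], ![0, 1, 3, 2], ![0, 2, 1, 3], ![0, 3, 2, 1], ![0, 2, 1, 3], ![0, 3, 2, 1]]
    ![![false, false, false, false], ![false, false, true, true], ![false, false, false, false],
      ![false, false, false, false], ![false, true, true, false], ![false, true, false, true]]
    (by decide +kernel) (forall_fin_four (by decide +kernel))

/-- Images of the generators under automorphisms of `Quad data16`. -/
def aut16 : Fin 14 → Quad data16 × Quad data16 × Quad data16 :=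
  ![(⟨1, 0, 0, 0⟩, ⟨0, 1, 0, 1⟩, ⟨0, 0, 1, 0⟩), (⟨1, 0, 0, 0⟩, ⟨0, 1, 0, 0⟩, ⟨1, 0, 1, 0⟩),
    (⟨0, 0, 1, 0⟩, ⟨0, 1, 0, 0⟩, ⟨1, 0, 0, 0⟩), (⟨0, 0, 1, 0⟩, ⟨0, 1, 0, 0⟩, ⟨1, 0, 1, 0⟩),
    (⟨0, 0, 1, 0⟩, ⟨0, 1, 0, 0⟩, ⟨1, 0, 0, 1⟩), (⟨0, 0, 1, 0⟩, ⟨0, 1, 0, 0⟩, ⟨1, 0, 1, 1⟩),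
    (⟨1, 0, 1, 0⟩, ⟨0, 1, 0, 0⟩, ⟨0, 0, 1, 0⟩), (⟨1, 0, 1, 0⟩, ⟨0, 1, 0, 0⟩, ⟨1, 0, 0, 1⟩),
    (⟨1, 0, 1, 0⟩, ⟨0, 1, 0, 0⟩, ⟨0, 0, 1, 1⟩), (⟨1, 0, 0, 1⟩, ⟨0, 1, 0, 0⟩, ⟨1, 0, 1, 0⟩),
    (⟨1, 0, 0, 1⟩, ⟨0, 1, 0, 0⟩, ⟨1, 0, 1, 1⟩), (⟨0, 0, 1, 1⟩, ⟨0, 1, 0, 0⟩, ⟨1, 0, 1, 0⟩),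
    (⟨0, 0, 1, 1⟩, ⟨0, 1, 0, 0⟩, ⟨1, 0, 0, 1⟩), (⟨1, 0, 1, 1⟩, ⟨0, 1, 0, 0⟩, ⟨0, 0, 1, 1⟩)]

theorem isEnd_aut16 : ∀ k, Quad.IsEnd (.id _) (aut16 k) := by decide +kernel

/-- Automorphisms of the quaternion subgroup act on the codes of `x`, `z`, `xz` as rotations of the
cube. Every vector in `{0, ±1}³` lies on one of its `13` rotation axes; the last `13` automorphisms
fix `y` and supply one rotation for each axis. -/
theorem not_admitsORR_data16 : ¬ AdmitsORR (Quad data16) :=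
  not_admitsORR_of_codes (ι := Fin 4) (κ := Fin 14)
    ![⟨1, 0, 0, 0⟩, ⟨0, 1, 0, 0⟩, ⟨0, 0, 1, 0⟩, ⟨1, 0, 1, 0⟩]
    (fun k => Quad.mapOf (.id _) (aut16 k) (isEnd_aut16 k))
    (by decide +kernel) (by decide +kernel) (by decide +kernel)
    ![![0, 1, 2, 3], ![0, 1, 3, 2], ![2, 1, 0, 3], ![2, 1, 3, 0], ![2, 1, 0, 3],
      ![2, 1, 3, 0], ![3, 1, 2, 0], ![3, 1, 0, 2], ![3, 1, 2, 0], ![0, 1, 3, 2],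
      ![0, 1, 3, 2], ![2, 1, 3, 0], ![2, 1, 0, 3], ![3, 1, 2, 0]]
    ![![false, true, false, false], ![false, false, false, true],
      ![false, false, false, true], ![false, false, false, false],
      ![false, false, true, false], ![false, false, true, true],
      ![false, false, false, true], ![false, false, true, true],
      ![false, false, true, false], ![true, false, false, false],
      ![true, false, true, true], ![true, false, false, true],
      ![true, false, true, true], ![true, false, true, true]]
    (by decide +kernel) (forall_fin_four (by decide +kernel))

/-- The automorphism of the centre of `Quad data32'` that fixes `x ^ 2` and interchanges `y ^ 2`
and `z ^ 2`. -/
def shear : ZMod 2 × ZMod 2 →+ ZMod 2 × ZMod 2 where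
  toFun a := (a.1 + a.2, a.2)
  map_zero' := rfl
  map_add' := by decide

/-- Images of the generators under automorphisms of `Quad data32'`. -/
def aut32 : Fin 14 → Quad data32' × Quad data32' × Quad data32' :=
  ![(⟨1, 0, 0, (0, 0)⟩, ⟨0, 1, 0, (0, 0)⟩, ⟨0, 0, 1, (1, 0)⟩),
    (⟨1, 0, 0, (0, 0)⟩, ⟨0, 1, 0, (0, 0)⟩, ⟨0, 0, 1, (0, 1)⟩),
    (⟨1, 0, 0, (0, 0)⟩, ⟨0, 1, 0, (1, 0)⟩, ⟨0, 0, 1, (0, 0)⟩),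
    (⟨1, 0, 0, (0, 0)⟩, ⟨0, 1, 0, (1, 1)⟩, ⟨0, 0, 1, (0, 0)⟩),
    (⟨1, 0, 0, (0, 1)⟩, ⟨0, 1, 0, (0, 0)⟩, ⟨0, 0, 1, (0, 0)⟩),
    (⟨1, 0, 0, (1, 1)⟩, ⟨0, 1, 0, (0, 0)⟩, ⟨0, 0, 1, (0, 0)⟩),
    (⟨1, 0, 0, (0, 0)⟩, ⟨0, 0, 1, (0, 0)⟩, ⟨0, 1, 0, (0, 0)⟩),
    (⟨1, 0, 0, (0, 0)⟩, ⟨0, 0, 1, (1, 0)⟩, ⟨0, 1, 0, (1, 0)⟩),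
    (⟨1, 0, 0, (0, 0)⟩, ⟨0, 0, 1, (0, 1)⟩, ⟨0, 1, 0, (1, 1)⟩),
    (⟨1, 0, 0, (0, 0)⟩, ⟨0, 0, 1, (1, 1)⟩, ⟨0, 1, 0, (0, 1)⟩),
    (⟨1, 0, 0, (1, 0)⟩, ⟨0, 0, 1, (0, 0)⟩, ⟨0, 1, 0, (0, 0)⟩),
    (⟨1, 0, 0, (1, 0)⟩, ⟨0, 0, 1, (1, 0)⟩, ⟨0, 1, 0, (1, 0)⟩),
    (⟨1, 0, 0, (1, 0)⟩, ⟨0, 0, 1, (0, 1)⟩, ⟨0, 1, 0, (1, 1)⟩),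
    (⟨1, 0, 0, (1, 0)⟩, ⟨0, 0, 1, (1, 1)⟩, ⟨0, 1, 0, (0, 1)⟩)]

/-- The action of the automorphisms `aut32` on the centre. -/
def aut32Center (k : Fin 14) : ZMod 2 × ZMod 2 →+ ZMod 2 × ZMod 2 := if k < 6 then .id _ else shear

theorem isEnd_aut32 : ∀ k, Quad.IsEnd (aut32Center k) (aut32 k) := by decide +kernel

/-- The representatives form three pairs, in the cosets of `x`, `y` and `z` modulo the central part.
If the two codes of a pair agree up to sign, one of the first six automorphisms works. Otherwise
each pair has exactly one nonzero code, and one of the remaining eight matches the pairs of `y` and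
`z` while inverting only the element of the pair of `x` whose code is `0`. -/
theorem not_admitsORR_data32' : ¬ AdmitsORR (Quad data32') :=
  not_admitsORR_of_codes (ι := Fin 6) (κ := Fin 14)
    ![⟨1, 0, 0, (0, 0)⟩, ⟨0, 1, 0, (0, 0)⟩, ⟨0, 0, 1, (0, 0)⟩,
      ⟨0, 1, 0, (1, 0)⟩, ⟨0, 0, 1, (1, 0)⟩, ⟨1, 0, 0, (0, 1)⟩]
    (fun k => Quad.mapOf (aut32Center k) (aut32 k) (isEnd_aut32 k))
    (by decide +kernel) (by decide +kernel) (by decide +kernel)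
    ![![0, 1, 4, 3, 2, 5], ![0, 1, 4, 3, 2, 5], ![0, 3, 2, 1, 4, 5], ![0, 3, 2, 1, 4, 5],
      ![5, 1, 2, 3, 4, 0], ![5, 1, 2, 3, 4, 0], ![0, 2, 1, 4, 3, 5], ![0, 4, 3, 2, 1, 5],
      ![0, 4, 3, 2, 1, 5], ![0, 2, 1, 4, 3, 5], ![0, 2, 1, 4, 3, 5], ![0, 4, 3, 2, 1, 5],
      ![0, 4, 3, 2, 1, 5], ![0, 2, 1, 4, 3, 5]]
    ![![false, false, false, false, false, false], ![false, false, true, false, true, false],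
      ![false, false, false, false, false, false], ![false, true, false, true, false, false],
      ![false, false, false, false, false, false], ![true, false, false, false, false, true],
      ![false, false, false, false, false, true], ![false, false, false, false, false, true],
      ![false, true, true, true, true, true], ![false, true, true, true, true, true],
      ![true, false, false, false, false, false], ![true, false, false, false, false, false],
      ![true, true, true, true, true, false], ![true, true, true, true, true, false]]
    (by decide +kernel) (forall_fin_six (by decide +kernel))

end NoRepresentation

/-! ### Three-colourings of `F₂³` and the group `C₃ × C₂³` -/

section Transvections

/-- The binary digits of `i`. -/
def digits (i : Fin 8) (b : Fin 3) : ZMod 2 := if i.val.testBit b.val then 1 else 0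

/-- The linear forms and vectors that define transvections of a vector space of order `8`. -/
def transvectionData : Fin 21 → Fin 8 × Fin 8 :=
  ![(1, 2), (2, 1), (3, 3), (5, 5), (6, 6), (1, 4), (4, 1), (6, 7), (7, 6), (2, 4), (3, 7),
    (1, 6), (2, 5), (3, 4), (4, 2), (4, 3), (5, 2), (5, 7), (6, 1), (7, 3), (7, 5)]

/-- The automorphism that is the transvection `v ↦ v + l v • w` on `Fin 3 → C 2`. -/
def transvectionHom (l w : Fin 3 → ZMod 2) : C 3 × (Fin 3 → C 2) →* C 3 × (Fin 3 → C 2) :=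
  MonoidHom.mk' (fun a => (a.1, fun b => a.2 b * Multiplicative.ofAdd
    ((l 0 * (a.2 0).toAdd + l 1 * (a.2 1).toAdd + l 2 * (a.2 2).toAdd) * w b))) (by
    intro a a'
    refine Prod.ext rfl (funext fun b => ?_)
    simp only [Prod.snd_mul, Pi.mul_apply, toAdd_mul]
    rw [mul_mul_mul_comm, ← ofAdd_add]
    congr 2
    ring)

/-- The action of a transvection on binary representations. -/
def transvectionPerm (t : Fin 8 × Fin 8) (i : Fin 8) : Fin 8 :=
  if (i.val.testBit 0 && t.1.val.testBit 0) ^^ (i.val.testBit 1 && t.1.val.testBit 1) ^^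
    (i.val.testBit 2 && t.1.val.testBit 2) then i ^^^ t.2 else i

/-- The pairs of vectors interchanged by the transvections. -/
def transvectionPairs : Fin 21 → Fin 8 × Fin 8 × Fin 8 × Fin 8 :=
  ![(1, 3, 5, 7), (2, 3, 6, 7), (1, 2, 5, 6), (1, 4, 3, 6), (2, 4, 3, 5), (1, 5, 3, 7),
    (4, 5, 6, 7),
    (2, 5, 3, 4), (1, 7, 2, 4), (2, 6, 3, 7), (1, 6, 2, 5), (1, 7, 3, 5), (2, 7, 3, 6),
    (1, 5, 2, 6),
    (4, 6, 5, 7), (4, 7, 5, 6), (1, 3, 4, 6), (1, 6, 3, 4), (2, 3, 4, 5), (1, 2, 4, 7),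
    (1, 4, 2, 7)]

theorem transvectionPerm_eq : ∀ k i, transvectionPerm (transvectionData k) i = i ∨
    (i, transvectionPerm (transvectionData k) i) ∈
      [((transvectionPairs k).1, (transvectionPairs k).2.1),
        ((transvectionPairs k).2.1, (transvectionPairs k).1),
        ((transvectionPairs k).2.2.1, (transvectionPairs k).2.2.2),
        ((transvectionPairs k).2.2.2, (transvectionPairs k).2.2.1)] := by
  decide +kernel

-- A transvection fixes a plane and interchanges the other four vectors in two pairs, so it
-- preserves a colouring once both pairs are monochromatic. For all `3⁷` colourings of the nonzero
-- vectors one of the `21` transvections does.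
set_option synthInstance.maxSize 2000 in
set_option synthInstance.maxHeartbeats 200000 in
theorem exists_transvectionPairs (a b c d e f g : Fin 3) : ∃ k,
    ![0, a, b, c, d, e, f, g] (transvectionPairs k).1 =
      ![0, a, b, c, d, e, f, g] (transvectionPairs k).2.1 ∧
    ![0, a, b, c, d, e, f, g] (transvectionPairs k).2.2.1 =
      ![0, a, b, c, d, e, f, g] (transvectionPairs k).2.2.2 := by
  have key : ∀ a b c d e f g : Fin 3,
      a = c ∧ e = g ∨ b = c ∧ f = g ∨ a = b ∧ e = f ∨ a = d ∧ c = f ∨ b = d ∧ c = e ∨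
      a = e ∧ c = g ∨ d = e ∧ f = g ∨ b = e ∧ c = d ∨ a = g ∧ b = d ∨ b = f ∧ c = g ∨
      a = f ∧ b = e ∨ a = g ∧ c = e ∨ b = g ∧ c = f ∨ a = e ∧ b = f ∨ d = f ∧ e = g ∨
      d = g ∧ e = f ∨ a = c ∧ d = f ∨ a = f ∧ c = d ∨ b = c ∧ d = e ∨ a = b ∧ d = g ∨
      a = d ∧ b = g := by
    decide +kernel
  rcases key a b c d e f g with h | h | h | h | h | h | h | h | h | h | h | h | h | h | h |
    h | h | h | h | h | h
  exacts [⟨0, h⟩, ⟨1, h⟩, ⟨2, h⟩, ⟨3, h⟩, ⟨4, h⟩, ⟨5, h⟩, ⟨6, h⟩, ⟨7, h⟩, ⟨8, h⟩, ⟨9, h⟩, ⟨10, h⟩,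
    ⟨11, h⟩, ⟨12, h⟩, ⟨13, h⟩, ⟨14, h⟩, ⟨15, h⟩, ⟨16, h⟩, ⟨17, h⟩, ⟨18, h⟩, ⟨19, h⟩, ⟨20, h⟩]

theorem transvectionPerm_colouring (a b c d e f g : Fin 3) : ∃ k, ∀ i,
    ![0, a, b, c, d, e, f, g] (transvectionPerm (transvectionData k) i) =
      ![0, a, b, c, d, e, f, g] i := by
  obtain ⟨k, h1, h2⟩ := exists_transvectionPairs a b c d e f g
  refine ⟨k, fun i => ?_⟩
  rcases transvectionPerm_eq k i with h | h
  · rw [h]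
  · simp only [List.mem_cons, Prod.mk.injEq, List.not_mem_nil, or_false] at h
    rcases h with ⟨h, h'⟩ | ⟨h, h'⟩ | ⟨h, h'⟩ | ⟨h, h'⟩ <;> rw [h', h]
    · exact h1.symm
    · exact h1
    · exact h2.symm
    · exact h2

/-- The elements with nontrivial square are `(±1, v)`, so a code is a three-colouring of the vectors
`v`. Transvections act trivially on `C₃`, hence without signs, and fix `v = 0`, whose colour may be
ignored. -/
theorem not_admitsORR_C3_C2 : ¬ AdmitsORR (C 3 × (Fin 3 → C 2)) := by
  refine not_admitsORR_of_codes (ι := Fin 8) (κ := Fin 21)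
    (fun i => (.ofAdd 1, fun b => .ofAdd (digits i b)))
    (fun k => transvectionHom (digits (transvectionData k).1) (digits (transvectionData k).2))
    (by decide +kernel) (by decide +kernel) (by decide +kernel)
    (fun k => transvectionPerm (transvectionData k)) (fun _ _ => false) (by decide +kernel) ?_
  intro c
  obtain ⟨k, hk⟩ := transvectionPerm_colouring (c 1) (c 2) (c 3) (c 4) (c 5) (c 6) (c 7)
  refine ⟨k, fun i => ?_⟩
  have h0 : ∀ k, transvectionPerm (transvectionData k) 0 = 0 := by decide +kernel
  have hne : ∀ k i, i ≠ 0 → transvectionPerm (transvectionData k) i ≠ 0 := by decide +kernel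
  have hc : ∀ j : Fin 8, j ≠ 0 → ![0, c 1, c 2, c 3, c 4, c 5, c 6, c 7] j = c j := by
    intro j hj
    fin_cases j
    · exact absurd rfl hj
    all_goals rfl
  by_cases hi : i = 0
  · rw [hi, h0]; rfl
  · have := hk i
    rw [hc _ (hne k i hi), hc i hi] at this
    exact this

end Transvections

/-! ### Consequences of the two presentations -/

section Presentations

variable {G : Type*} [Group G]

/-- The homomorphism that maps the generator of `ZMod 2` to `q`. -/
def iota₁ (q : G) (hq : q * q = 1) : Multiplicative (ZMod 2) →* G :=
  MonoidHom.mk' (fun a => q ^ a.toAdd.val) fun a b => by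
    rw [toAdd_mul, Quad.pow_val_add (by rw [pow_two, hq])]

/-- The homomorphism that maps the two basis vectors to `q` and `r`. -/
def iota₂ (q r : G) (hq : q * q = 1) (hr : r * r = 1) (hqr : Commute q r) :
    Multiplicative (ZMod 2 × ZMod 2) →* G :=
  MonoidHom.mk' (fun a => q ^ a.toAdd.1.val * r ^ a.toAdd.2.val) fun a b => by
    rw [toAdd_mul, Prod.fst_add, Prod.snd_add, Quad.pow_val_add (by rw [pow_two, hq]),
      Quad.pow_val_add (by rw [pow_two, hr])]
    exact (hqr.pow_pow _ _).mul_mul_mul_comm _ _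

/-- The homomorphism that maps the three basis vectors to `q`, `r` and `s`. -/
def iota₃ (q r s : G) (hq : q * q = 1) (hr : r * r = 1) (hs : s * s = 1) (hqr : Commute q r)
    (hqs : Commute q s) (hrs : Commute r s) : Multiplicative (ZMod 2 × ZMod 2 × ZMod 2) →* G :=
  MonoidHom.mk' (fun a => q ^ a.toAdd.1.val * (r ^ a.toAdd.2.1.val * s ^ a.toAdd.2.2.val))
    fun a b => by
    rw [toAdd_mul, Prod.fst_add, Prod.snd_add, Prod.fst_add, Prod.snd_add,
      Quad.pow_val_add (by rw [pow_two, hq]), Quad.pow_val_add (by rw [pow_two, hr]),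
      Quad.pow_val_add (by rw [pow_two, hs]), (hrs.pow_pow _ _).mul_mul_mul_comm,
      ((hqr.pow_pow _ _).mul_right (hqs.pow_pow _ _)).mul_mul_mul_comm]

theorem iota₁_apply (q : G) (hq : q * q = 1) (a : Multiplicative (ZMod 2)) :
    iota₁ q hq a = q ^ a.toAdd.val := rfl

theorem iota₂_apply (q r : G) (hq : q * q = 1) (hr : r * r = 1) (hqr : Commute q r)
    (a : Multiplicative (ZMod 2 × ZMod 2)) :
    iota₂ q r hq hr hqr a = q ^ a.toAdd.1.val * r ^ a.toAdd.2.val := rfl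

theorem iota₃_apply (q r s : G) (hq : q * q = 1) (hr : r * r = 1) (hs : s * s = 1)
    (hqr : Commute q r) (hqs : Commute q s) (hrs : Commute r s)
    (a : Multiplicative (ZMod 2 × ZMod 2 × ZMod 2)) :
    iota₃ q r s hq hr hs hqr hqs hrs a =
      q ^ a.toAdd.1.val * (r ^ a.toAdd.2.1.val * s ^ a.toAdd.2.2.val) := rfl

/-- The commutator of two elements in terms of central squares. -/
theorem mul_eq_of_squares {x y q r s : G} (hx : x * x = q) (hy : y * y = r)
    (hs : x * y * (x * y) = s) (hq1 : q * q = 1) (hr1 : r * r = 1) (hq : ∀ g, Commute q g)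
    (hr : ∀ g, Commute r g) (hsc : ∀ g, Commute s g) : y * x = x * (y * (q * (r * s))) := by
  have hxi : x⁻¹ = x * q := inv_eq_of_mul_eq_one_right (by rw [← mul_assoc, hx, hq1])
  have hyi : y⁻¹ = r * y := inv_eq_of_mul_eq_one_left (by rw [mul_assoc, hy, hr1])
  have : y * x = x⁻¹ * (x * y * (x * y)) * y⁻¹ := by group
  rw [this, hs, hxi, hyi, (hr y).eq, mul_assoc x q s, mul_assoc x, ← mul_assoc (q * s),
    ((hq y).mul_left (hsc y)).eq, mul_assoc y, mul_assoc q, (hr s).eq]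

theorem Generates.central {x y z g : G} (h : Generates x y z) (hx : Commute g x)
    (hy : Commute g y) (hz : Commute g z) (u : G) : Commute g u := by
  have hu : u ∈ Subgroup.closure {x, y, z} := by rw [h]; trivial
  have hle : Subgroup.closure {x, y, z} ≤ Subgroup.centralizer {g} := by
    rw [Subgroup.closure_le]
    rintro _ (rfl | rfl | rfl) <;>
      simp only [SetLike.mem_coe, Subgroup.mem_centralizer_singleton_iff]
    · exact hx.symm.eq
    · exact hy.symm.eq
    · exact hz.symm.eq
  exact (Subgroup.mem_centralizer_singleton_iff.1 (hle hu)).symm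

theorem mul_self_mul_self {x : G} (hx : x ^ 4 = 1) : x * x * (x * x) = 1 := by
  simpa only [pow_succ, pow_zero, one_mul, mul_assoc] using hx

/-- From `xyx = y⁻¹` and `xy⁻¹x = y` follows `x²yx² = y`, and `x²` is its own inverse. -/
theorem commute_mul_self {x y : G} (hx : x ^ 4 = 1) (h : (x * y) ^ 2 = 1)
    (h' : (x * y⁻¹) ^ 2 = 1) : Commute (x * x) y := by
  have h1 : x * y * x = y⁻¹ := eq_inv_of_mul_eq_one_left (by rw [← h, pow_two]; group)
  have h2 : x * y⁻¹ * x = y := eq_of_mul_inv_eq_one (by rw [← h', pow_two]; group)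
  have h3 : x * x * y * (x * x) = y := by
    calc x * x * y * (x * x) = x * (x * y * x) * x := by group
      _ = y := by rw [h1, h2]
  calc x * x * y = x * x * y * (x * x * (x * x)) := by rw [mul_self_mul_self hx, mul_one]
    _ = x * x * y * (x * x) * (x * x) := by group
    _ = y * (x * x) := by rw [h3]

/-- The common square `q` of the generators is central; `(yx)² = (yz)² = 1` then makes `y` commute
with `x` and `z`, and the conjugation relation reads `zx = xzq`. -/
theorem exists_hom_data16 {x y z : G} (h : Generates x y z)
    (hrel : ∀ r ∈ relators16 x y z, r = 1) : ∃ f : Quad data16 →* G,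
      f ⟨1, 0, 0, 0⟩ = x ∧ f ⟨0, 1, 0, 0⟩ = y ∧ f ⟨0, 0, 1, 0⟩ = z := by
  simp only [relators16, Set.mem_insert_iff, Set.mem_singleton_iff, forall_eq_or_imp, forall_eq,
    mul_inv_eq_one, inv_inv] at hrel
  obtain ⟨x4, -, -, yx, -, yz, -, xz, zxz, xy⟩ := hrel
  obtain ⟨q, hq⟩ : ∃ q, x * x = q := ⟨_, rfl⟩
  have hy : y * y = q := by rw [← hq, ← pow_two, ← pow_two, xy]
  have hz : z * z = q := by rw [← hq, ← pow_two, ← pow_two, xz]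
  have hq1 : q * q = 1 := hq ▸ mul_self_mul_self x4
  have hc := h.central (hq ▸ (Commute.refl x).mul_left (Commute.refl x))
    (hy ▸ (Commute.refl y).mul_left (Commute.refl y))
    (hz ▸ (Commute.refl z).mul_left (Commute.refl z))
  have hzx : z * x = x * (z * q) := by
    have hxi : x⁻¹ = x * q := inv_eq_of_mul_eq_one_right (by rw [← mul_assoc, hq, hq1])
    have : x * z = z * (x * q) := by
      rw [← hxi, ← eq_inv_of_mul_eq_one_left zxz]; group
    rw [← mul_assoc, this, mul_assoc, mul_assoc, hq1, mul_one]
  have hyx := mul_eq_of_squares hy hq (by rw [← pow_two, yx]) hq1 hq1 hc hc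
    fun g => Commute.one_left g
  have hyz := mul_eq_of_squares hy hz (by rw [← pow_two, yz]) hq1 hq1 hc hc
    fun g => Commute.one_left g
  rw [mul_one, hq1, mul_one] at hyx hyz
  refine ⟨Quad.lift x y z (iota₁ q hq1) (fun φ g => ?_) ?_ ?_ ?_ ?_ ?_ ?_, ?_, ?_, ?_⟩
  · rw [iota₁_apply]; exact (hc g).pow_left _
  iterate 6 simp [data16, iota₁_apply, ZMod.val_one, *]
  all_goals exact (Quad.lift_apply ..).trans (by simp [ZMod.val_one])

/-- The relations make `x²` and `y²` central and give `z² = x²y²`. As the products of two generators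
have trivial square, each commutator is the product of two squares. -/
theorem exists_hom_data32' {x y z : G} (h : Generates x y z)
    (hrel : ∀ r ∈ relators32 x y z, r = 1) : ∃ f : Quad data32' →* G,
      f ⟨1, 0, 0, 0⟩ = x ∧ f ⟨0, 1, 0, 0⟩ = y ∧ f ⟨0, 0, 1, 0⟩ = z := by
  simp only [relators32, Set.mem_insert_iff, Set.mem_singleton_iff, forall_eq_or_imp,
    forall_eq] at hrel
  obtain ⟨x4, y4, z4, xy, xy', xz, xz', yz, yz', xyz⟩ := hrel
  have swap : ∀ {a b : G}, (a * b) ^ 2 = 1 → (b * a) ^ 2 = 1 := by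
    intro a b hab
    calc (b * a) ^ 2 = b * (a * b) ^ 2 * b⁻¹ := by rw [pow_two, pow_two]; group
      _ = 1 := by rw [hab]; group
  have swap' : ∀ {a b : G}, (a * b⁻¹) ^ 2 = 1 → (b * a⁻¹) ^ 2 = 1 := by
    intro a b hab
    rw [← inv_inv (b * a⁻¹), inv_pow, mul_inv_rev, inv_inv, hab, inv_one]
  have self : ∀ a : G, Commute (a * a) a := fun a => (Commute.refl a).mul_left (Commute.refl a)
  have hcq := h.central (self x) (commute_mul_self x4 xy xy') (commute_mul_self x4 xz xz')
  have hcr := h.central (commute_mul_self y4 (swap xy) (swap' xy')) (self y)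
    (commute_mul_self y4 yz yz')
  have hz : z * z = x * x * (y * y) := by
    rw [eq_inv_of_mul_eq_one_left (mul_self_mul_self z4), ← pow_two, ← pow_two, ← pow_two,
      ← eq_inv_of_mul_eq_one_left xyz]
  have hq1 := mul_self_mul_self x4
  have hr1 := mul_self_mul_self y4
  obtain ⟨q, hq⟩ : ∃ q, x * x = q := ⟨_, rfl⟩
  obtain ⟨r, hr⟩ : ∃ r, y * y = r := ⟨_, rfl⟩
  rw [hq] at hcq hz hq1
  rw [hr] at hcr hz hr1
  have hct : ∀ g, Commute (q * r) g := fun g => (hcq g).mul_left (hcr g)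
  have hqr : q * r * (q * r) = 1 := by rw [(hcr q).mul_mul_mul_comm, hq1, hr1, mul_one]
  have hyx := mul_eq_of_squares hq hr (by rw [← pow_two, xy]) hq1 hr1 hcq hcr Commute.one_left
  have hzx := mul_eq_of_squares hq hz (by rw [← pow_two, xz]) hq1 hqr hcq hct Commute.one_left
  have hzy := mul_eq_of_squares hr hz (by rw [← pow_two, yz]) hr1 hqr hcr hct Commute.one_left
  rw [mul_one] at hyx hzx hzy
  rw [← mul_assoc q, hq1, one_mul] at hzx
  rw [(hcq r).eq, ← mul_assoc r, hr1, one_mul] at hzy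
  refine ⟨Quad.lift x y z (iota₂ q r hq1 hr1 (hcq r)) (fun φ g => ?_) ?_ ?_ ?_ ?_ ?_ ?_, ?_, ?_, ?_⟩
  · rw [iota₂_apply]; exact ((hcq g).pow_left _).mul_left ((hcr g).pow_left _)
  iterate 6 simp [data32', iota₂_apply, ZMod.val_one, *]
  all_goals exact (Quad.lift_apply ..).trans (by simp [ZMod.val_one])

end Presentations

/-! ### The models of the exceptional groups -/

section Isomorphisms

theorem nonempty_mulEquiv_presentedGroup {H : Type*} [Group H] {rels : Set (FreeGroup (Fin 3))}
    {e : Fin 3 → H} (he : Subgroup.closure (Set.range e) = ⊤)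
    (hrel : ∀ r ∈ rels, FreeGroup.lift e r = 1)
    (hf : ∃ f : H →* PresentedGroup rels, ∀ i, f (e i) = PresentedGroup.of i) :
    Nonempty (H ≃* PresentedGroup rels) := by
  obtain ⟨f, hf⟩ := hf
  have h1 : f.comp (PresentedGroup.toGroup hrel) = MonoidHom.id _ :=
    PresentedGroup.ext fun i => by simp [hf]
  have h2 : (PresentedGroup.toGroup hrel).comp f = MonoidHom.id _ := by
    refine MonoidHom.eq_of_eqOn_dense he ?_
    rintro _ ⟨i, rfl⟩
    simp [hf]
  exact ⟨f.toMulEquiv _ h2 h1⟩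

theorem generates_of {rels : Set (FreeGroup (Fin 3))} :
    Generates (PresentedGroup.of (rels := rels) 0) (PresentedGroup.of 1) (PresentedGroup.of 2) := by
  unfold Generates
  rw [← PresentedGroup.closure_range_of rels]
  congr 1
  ext g
  simp [Fin.exists_fin_succ, eq_comm]

theorem map_relators16 {F H : Type*} [Group F] [Group H] (f : F →* H) (x y z : F) :
    f '' relators16 x y z = relators16 (f x) (f y) (f z) := by
  simp [relators16, Set.image_insert_eq]

theorem map_relators32 {F H : Type*} [Group F] [Group H] (f : F →* H) (x y z : F) :
    f '' relators32 x y z = relators32 (f x) (f y) (f z) := by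
  simp [relators32, Set.image_insert_eq]

/-- The standard generators. -/
def Quad.gens {Φ : Type*} [AddCommGroup Φ] (d : QuadData Φ) : Fin 3 → Quad d :=
  ![⟨1, 0, 0, 0⟩, ⟨0, 1, 0, 0⟩, ⟨0, 0, 1, 0⟩]

theorem nonempty_mulEquiv_Group16 : Nonempty (Quad data16 ≃* Group16) := by
  refine nonempty_mulEquiv_presentedGroup (e := Quad.gens data16)
    (closure_range_eq_top (fun a => powWord a.i [0] ++ powWord a.j [1] ++ powWord a.k [2] ++
      powWord a.φ [0, 0]) (by decide +kernel)) (fun r hr => ?_) ?_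
  · have := Set.mem_image_of_mem (FreeGroup.lift (Quad.gens data16)) hr
    rw [map_relators16] at this
    simp only [FreeGroup.lift_apply_of, relators16, Set.mem_insert_iff,
      Set.mem_singleton_iff] at this
    rcases this with h | h | h | h | h | h | h | h | h | h <;> rw [h] <;> decide +kernel
  · obtain ⟨f, h0, h1, h2⟩ := exists_hom_data16 generates_of (by
      rintro _ hr
      erw [← map_relators16 (PresentedGroup.mk _)] at hr
      obtain ⟨r, hr, rfl⟩ := hr
      exact PresentedGroup.one_of_mem hr)
    exact ⟨f, fun i => by fin_cases i <;> assumption⟩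

theorem nonempty_mulEquiv_Group32 : Nonempty (Quad data32' ≃* Group32) := by
  refine nonempty_mulEquiv_presentedGroup (e := Quad.gens data32')
    (closure_range_eq_top (fun a => powWord a.i [0] ++ powWord a.j [1] ++ powWord a.k [2] ++
      powWord a.φ.1 [0, 0] ++ powWord a.φ.2 [1, 1]) (by decide +kernel)) (fun r hr => ?_) ?_
  · have := Set.mem_image_of_mem (FreeGroup.lift (Quad.gens data32')) hr
    rw [map_relators32] at this
    simp only [FreeGroup.lift_apply_of, relators32, Set.mem_insert_iff,
      Set.mem_singleton_iff] at this
    rcases this with h | h | h | h | h | h | h | h | h | h <;> rw [h] <;> decide +kernel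
  · obtain ⟨f, h0, h1, h2⟩ := exists_hom_data32' generates_of (by
      rintro _ hr
      erw [← map_relators32 (PresentedGroup.mk _)] at hr
      obtain ⟨r, hr, rfl⟩ := hr
      exact PresentedGroup.one_of_mem hr)
    exact ⟨f, fun i => by fin_cases i <;> assumption⟩

theorem card_Group16 : Nat.card Group16 = 16 := by
  obtain ⟨f⟩ := nonempty_mulEquiv_Group16
  rw [← Nat.card_congr f.toEquiv, Nat.card_congr (Quad.equivProd _)]
  simp

theorem card_Group32 : Nat.card Group32 = 32 := by
  obtain ⟨f⟩ := nonempty_mulEquiv_Group32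
  rw [← Nat.card_congr f.toEquiv, Nat.card_congr (Quad.equivProd _)]
  simp

theorem nonempty_mulEquiv_C4 : Nonempty (Quad dataC4 ≃* C 4 × (Fin 2 → C 2)) := by
  let f : Quad dataC4 →* C 4 × (Fin 2 → C 2) :=
    -- The central part is generated by `x²`, so `i + 2φ` is the exponent of `x` modulo `4`.
    MonoidHom.mk' (fun a => (.ofAdd (a.i.val + 2 * a.φ.val : ℕ), ![.ofAdd a.j, .ofAdd a.k]))
      (by decide +kernel)
  have hf : Function.Bijective f := by
    rw [Fintype.bijective_iff_injective_and_card]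
    exact ⟨by decide +kernel, by decide +kernel⟩
  exact ⟨MulEquiv.ofBijective f hf⟩

theorem IsExceptional.not_admitsORR {G : Type*} [Group G] (hG : IsExceptional G) :
    ¬ AdmitsORR G := by
  intro h
  rcases hG with f | f | f | f
  · exact not_admitsORR_dataC4 (h.of_mulEquiv (f.some.trans nonempty_mulEquiv_C4.some.symm))
  · exact not_admitsORR_C3_C2 (h.of_mulEquiv f.some)
  · exact not_admitsORR_data32' (h.of_mulEquiv (f.some.trans nonempty_mulEquiv_Group32.some.symm))
  · exact not_admitsORR_data16 (h.of_mulEquiv (f.some.trans nonempty_mulEquiv_Group16.some.symm))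

end Isomorphisms

/-! ### Generating triples containing `x` with `x⁴ ≠ 1` -/

section OrderNotFour

variable {G : Type*} [Group G] [Finite G]

/-- Of the alternatives in `pair_cases`, the last contains `x⁴ = 1` and the quaternion one implies
it. -/
theorem commute_or_inverts (h2 : ∀ a b : G, Subgroup.closure {a, b} ≠ ⊤)
    (hD : ¬ IsGeneralizedDihedral G) (hO : ¬ AdmitsORR G) {x y z : G} (h : Generates x y z)
    (hx : x ^ 4 ≠ 1) : Commute x y ∨ (y ^ 2 = 1 ∧ x * y = y * x⁻¹) := by
  have hx2 : x ^ 2 ≠ 1 := fun h' => hx (by rw [show 4 = 2 * 2 from rfl, pow_mul, h', one_pow])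
  rcases pair_cases h2 hD hO h hx2 with hc | hc | ⟨hc, hs⟩ | ⟨hc, -⟩
  · exact Or.inl hc
  · exact Or.inr hc
  · refine (hx ?_).elim
    have h3 : x ^ 2 * y = y * (x ^ 2)⁻¹ := by
      rw [pow_two, mul_assoc, hc, ← mul_assoc, hc]; group
    rw [hs, ← pow_succ, ← hs, ← mul_left_cancel_iff (a := y⁻¹)] at h3
    have h4 : x ^ 2 = (x ^ 2)⁻¹ := by
      rw [inv_mul_cancel_left] at h3
      rw [← h3, hs]; group
    rw [show 4 = 2 * 2 from rfl, pow_mul, pow_two (x ^ 2)]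
    exact mul_eq_one_iff_eq_inv.2 h4
  · exact (hx hc).elim

/-- Otherwise `y` is an involution inverting `x`. One of `z`, `yz` commutes with `x`; call it `w`.
Then `wy` inverts `x`, so it is an involution too, `y` inverts `w`, and `G` is generalized dihedral.
-/
theorem commute_of_pow_four_ne_one (h2 : ∀ a b : G, Subgroup.closure {a, b} ≠ ⊤)
    (hD : ¬ IsGeneralizedDihedral G) (hO : ¬ AdmitsORR G) {x y z : G} (h : Generates x y z)
    (hx : x ^ 4 ≠ 1) : Commute x y := by
  by_contra hc
  obtain ⟨hy, hxy⟩ := (commute_or_inverts h2 hD hO h hx).resolve_left hc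
  have hyi : y⁻¹ = y := inv_eq_of_mul_eq_one_left (by rw [← pow_two, hy])
  have hx1 : x ≠ x⁻¹ := fun h' => hc (by rw [← h'] at hxy; exact hxy)
  have key : ∀ w, Generates x y w → Commute x w → False := by
    intro w hw hxw
    have hinv : x * (w * y) = w * y * x⁻¹ := by
      rw [← mul_assoc, hxw.eq, mul_assoc, hxy, mul_assoc]
    rcases commute_or_inverts h2 hD hO (hw.mul₃_right (right_mem x y)).swap₂₃ hx with h3 | ⟨h3, -⟩
    · rw [h3.eq] at hinv
      exact hx1 (mul_left_cancel hinv)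
    · refine hD (isGeneralizedDihedral_of_pair h2 hw.swap₂₃ hxw.eq hy ?_ ?_)
      · rw [mul_assoc, hxy, inv_mul_cancel_left]
      · rw [pow_two, mul_assoc] at h3
        rw [hyi, inv_eq_of_mul_eq_one_right h3, mul_assoc]
  rcases commute_or_inverts h2 hD hO h.swap₂₃ hx with h3 | ⟨-, h3⟩
  · exact key z h h3
  · refine key (y * z) (h.mul₃_left (right_mem x y)) ?_
    have hxy' : x⁻¹ * y = y * x := by
      have := congrArg (fun g => y⁻¹ * g * y⁻¹) hxy
      simp only [← mul_assoc, inv_mul_cancel, one_mul] at this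
      rw [mul_inv_cancel_right, hyi] at this
      exact this.symm
    have hzx : x⁻¹ * z = z * x := by
      rw [inv_mul_eq_iff_eq_mul, ← mul_assoc, h3, inv_mul_cancel_right]
    change x * (y * z) = y * z * x
    rw [← mul_assoc, hxy, mul_assoc, hzx, mul_assoc]

theorem nonempty_mulEquiv_of_pow_four_ne_one (h2 : ∀ a b : G, Subgroup.closure {a, b} ≠ ⊤)
    (hD : ¬ IsGeneralizedDihedral G) (hO : ¬ AdmitsORR G) {x y z : G} (h : Generates x y z)
    (hx : x ^ 4 ≠ 1) : Nonempty (C 3 × (Fin 3 → C 2) ≃* G) := by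
  have hx2 : x ^ 2 ≠ 1 := fun h' => hx (by rw [show 4 = 2 * 2 from rfl, pow_mul, h', one_pow])
  have hxc : ∀ {u v}, Generates x u v → Commute x u :=
    fun h' => commute_of_pow_four_ne_one h2 hD hO h' hx
  have cases : ∀ {u v}, Generates x u v → (x ^ 3 = 1 ∧ u ^ 3 = 1) ∨
      (x ^ 6 = 1 ∧ x ^ 3 ≠ 1 ∧ ∃ j : ℕ, (u * x ^ j) ^ 2 = 1) := by
    intro u v h'
    rcases commute_cases h2 hD hO h' (hxc h') hx2 with h3 | ⟨h3, -⟩ | h3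
    · exact Or.inl h3
    · exact (hx h3).elim
    · exact Or.inr h3
  rcases cases h with ⟨hx3, hy3⟩ | ⟨hx6, hx3, j, hj⟩
  · have hz3 : z ^ 3 = 1 := by
      rcases cases h.swap₂₃ with h3 | h3
      · exact h3.2
      · exact (h3.2.1 hx3).elim
    have hy : y ^ 4 ≠ 1 := by
      intro h4
      refine not_mem_closure h2 h.swap₂₃ ?_
      rw [pow_succ, hy3, one_mul] at h4
      rw [h4]
      exact one_mem _
    have hyz := commute_of_pow_four_ne_one h2 hD hO h.swap₁₂.swap₂₃ hy
    obtain ⟨f⟩ := nonempty_mulEquiv_C3 h2 h (hxc h) (hxc h.swap₂₃) hyz hx3 hy3 hz3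
    exact (hO (admitsORR_C3_C3_C3.of_mulEquiv f)).elim
  · obtain ⟨k, hk⟩ : ∃ k : ℕ, (z * x ^ k) ^ 2 = 1 := by
      rcases cases h.swap₂₃ with h3 | h3
      · exact (hx3 h3.1).elim
      · exact h3.2.2
    have h1 : Generates x (y * x ^ j) z := (h.swap₂₃.mul₃_right (pow_mem (left_mem _ _) j)).swap₂₃
    have h3 : Generates x (y * x ^ j) (z * x ^ k) := h1.mul₃_right (pow_mem (left_mem _ _) k)
    generalize y * x ^ j = u at hj h3
    generalize z * x ^ k = v at hk h3
    have hxu := hxc h3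
    have hxv := hxc h3.swap₂₃
    -- Since `(xu)⁴ = x⁴ ≠ 1`, the element `v` commutes with `xu` as well as with `x`, hence with
    -- `u`.
    have h4 : Generates (x * u) v u :=
      (h3.swap₁₂.swap₂₃.mul₃_right (left_mem _ _)).swap₂₃.swap₁₂.swap₂₃
    have h5 := commute_of_pow_four_ne_one h2 hD hO h4 (by
      rwa [hxu.mul_pow, show 4 = 2 * 2 from rfl, pow_mul u, hj, one_pow, mul_one])
    have huv : Commute u v := by simpa using hxv.inv_left.mul_left h5
    exact nonempty_mulEquiv_C3_C2 h2 h3 hxu hxv huv hx6 hx2 hx3 hj hk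

end OrderNotFour

open scoped IsMulCommutative

/-! ### Central squares: quadratic maps on the Fano plane -/

section OrderFour

variable {G : Type*} [Group G]

/-- The generators `x`, `y`, `z` and the products `x * y`, `x * z`, `y * z` have the prescribed
squares, all central of order at most `2`. -/
structure CentralSquares (x y z : G) (a b c d e f : Subgroup.center G) : Prop where
  generates : Generates x y z
  sq_x : x * x = a
  sq_y : y * y = b
  sq_z : z * z = c
  sq_xy : x * y * (x * y) = d
  sq_xz : x * z * (x * z) = e
  sq_yz : y * z * (y * z) = f
  ha : a * a = 1
  hb : b * b = 1
  hc : c * c = 1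
  hd : d * d = 1
  he : e * e = 1
  hf : f * f = 1

theorem center_commute (a : Subgroup.center G) (g : G) : Commute (a : G) g :=
  (Subgroup.mem_center_iff.1 a.2 g).symm

theorem mul_self_comm {x y : G} {d : Subgroup.center G} (h : x * y * (x * y) = d) :
    y * x * (y * x) = d := by
  calc y * x * (y * x) = y * (x * y * (x * y)) * y⁻¹ := by group
    _ = d := by rw [h, ← (center_commute d y).eq, mul_inv_cancel_right]

theorem mul_self_of_commutators {x y z p r s : G} (hyx : y * x = x * (y * p))
    (hzx : z * x = x * (z * r)) (hzy : z * y = y * (z * s)) (hp : ∀ g, Commute p g)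
    (hr : ∀ g, Commute r g) (hs : ∀ g, Commute s g) :
    x * y * z * (x * y * z) = x * x * (y * y) * (z * z) * (p * s * r) :=
  calc x * y * z * (x * y * z) = x * y * (z * x) * (y * z) := by group
    _ = x * y * x * z * (r * (y * z)) := by rw [hzx]; group
    _ = x * (y * x) * (z * y) * z * r := by rw [(hr _).eq]; group
    _ = x * x * y * (p * (y * z)) * (s * z) * r := by rw [hyx, hzy]; group
    _ = x * x * (y * y) * z * (p * z) * s * r := by rw [(hp _).eq, (hs z).eq]; group
    _ = x * x * (y * y) * (z * z) * (p * s * r) := by rw [(hp z).eq]; group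

namespace CentralSquares

variable {x y z : G} {a b c d e f : Subgroup.center G}

theorem mul_yx (h : CentralSquares x y z a b c d e f) :
    y * x = x * (y * (a * (b * d) : Subgroup.center G)) :=
  mul_eq_of_squares h.sq_x h.sq_y h.sq_xy (by exact_mod_cast h.ha) (by exact_mod_cast h.hb)
    (center_commute a) (center_commute b) (center_commute d)

theorem swap₁₂ (h : CentralSquares x y z a b c d e f) : CentralSquares y x z b a c d f e :=
  ⟨h.generates.swap₁₂, h.sq_y, h.sq_x, h.sq_z, mul_self_comm h.sq_xy, h.sq_yz, h.sq_xz,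
    h.hb, h.ha, h.hc, h.hd, h.hf, h.he⟩

theorem swap₂₃ (h : CentralSquares x y z a b c d e f) : CentralSquares x z y a c b e d f :=
  ⟨h.generates.swap₂₃, h.sq_x, h.sq_z, h.sq_y, h.sq_xz, h.sq_xy, mul_self_comm h.sq_yz,
    h.ha, h.hc, h.hb, h.he, h.hd, h.hf⟩

theorem mul_zx (h : CentralSquares x y z a b c d e f) :
    z * x = x * (z * (a * (c * e) : Subgroup.center G)) := h.swap₂₃.mul_yx

theorem mul_zy (h : CentralSquares x y z a b c d e f) :
    z * y = y * (z * (b * (c * f) : Subgroup.center G)) := h.swap₁₂.swap₂₃.mul_yx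

/-- Squaring is quadratic modulo the centre, so the squares at the seven points of the Fano plane
have product `1`. -/
theorem sq_xyz (h : CentralSquares x y z a b c d e f) :
    x * y * z * (x * y * z) = (a * b * c * d * e * f : Subgroup.center G) := by
  have key : (a * (b * d)) * (b * (c * f)) * (a * (c * e)) * a * b * c = a * b * c * d * e * f := by
    calc (a * (b * d)) * (b * (c * f)) * (a * (c * e)) * a * b * c
        = (a * a) * (b * b) * (c * c) * (a * b * c * d * e * f) := by
          ac_rfl
      _ = _ := by rw [h.ha, h.hb, h.hc, one_mul, one_mul, one_mul]
  rw [mul_self_of_commutators h.mul_yx h.mul_zx h.mul_zy (center_commute _) (center_commute _)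
    (center_commute _), h.sq_x, h.sq_y, h.sq_z, ← key]
  norm_cast
  ac_rfl

theorem mul_self_prod (h : CentralSquares x y z a b c d e f) :
    (a * b * c * d * e * f) * (a * b * c * d * e * f) = 1 := by
  calc (a * b * c * d * e * f) * (a * b * c * d * e * f)
      = (a * a) * (b * b) * (c * c) * (d * d) * (e * e) * (f * f) := by
        ac_rfl
    _ = 1 := by simp only [h.ha, h.hb, h.hc, h.hd, h.he, h.hf, mul_one]

/-- Replacing `y` by `x * y`. -/
theorem mul₂ (h : CentralSquares x y z a b c d e f) :
    CentralSquares x (x * y) z a d c b e (a * b * c * d * e * f) := by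
  refine ⟨(h.generates.swap₂₃.mul₃_left (left_mem _ _)).swap₂₃, h.sq_x, h.sq_xy, h.sq_z, ?_,
    h.sq_xz, h.sq_xyz, h.ha, h.hd, h.hc, h.hb, h.he, h.mul_self_prod⟩
  have ha : (a : G) * a = 1 := by exact_mod_cast h.ha
  rw [← mul_assoc x x y, h.sq_x, (center_commute a y).symm.mul_mul_mul_comm, ha, one_mul, h.sq_y]

/-- Replacing `z` by `x * z`. -/
theorem mul₃ (h : CentralSquares x y z a b c d e f) :
    CentralSquares x y (x * z) a b e d c (a * b * c * d * e * f) := by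
  have := h.swap₂₃.mul₂.swap₂₃
  rwa [show a * c * b * e * d * f = a * b * c * d * e * f by ac_rfl] at this

theorem coe_mem (h : CentralSquares x y z a b c d e f) {s : Subgroup.center G}
    (hs : s = a ∨ s = b ∨ s = c ∨ s = d ∨ s = e ∨ s = f) :
    (s : G) ∈ Subgroup.closure (Set.range fun u : G => u * u) := by
  refine Subgroup.subset_closure ?_
  rcases hs with rfl | rfl | rfl | rfl | rfl | rfl
  · exact ⟨x, h.sq_x⟩
  · exact ⟨y, h.sq_y⟩
  · exact ⟨z, h.sq_z⟩
  · exact ⟨x * y, h.sq_xy⟩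
  · exact ⟨x * z, h.sq_xz⟩
  · exact ⟨y * z, h.sq_yz⟩

theorem nonempty_mulEquiv {Φ : Type*} [AddCommGroup Φ] [Module (ZMod 2) Φ] {D : QuadData Φ}
    (h : CentralSquares x y z a b c d e f) (h2 : ∀ a b : G, Subgroup.closure {a, b} ≠ ⊤)
    (ι : Multiplicative Φ →* Subgroup.center G) (hx : a = ι (.ofAdd D.sx))
    (hy : b = ι (.ofAdd D.sy)) (hz : c = ι (.ofAdd D.sz)) (hyx : a * (b * d) = ι (.ofAdd D.cyx))
    (hzx : a * (c * e) = ι (.ofAdd D.czx)) (hzy : b * (c * f) = ι (.ofAdd D.czy))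
    (hinj : ∀ φ, ι (.ofAdd φ) = 1 → φ = 0)
    (hsq : ∀ φ, (ι φ : G) ∈ Subgroup.closure (Set.range fun u : G => u * u)) :
    Nonempty (Quad D ≃* G) := by
  refine Quad.nonempty_mulEquiv h2 h.generates ((Subgroup.center G).subtype.comp ι)
    (fun φ g => center_commute _ g) ?_ ?_ ?_ ?_ ?_ ?_ (fun φ hφ => hinj φ ?_) hsq
  · rw [h.sq_x, hx]; rfl
  · rw [h.sq_y, hy]; rfl
  · rw [h.sq_z, hz]; rfl
  · rw [h.mul_yx, hyx]; rfl
  · rw [h.mul_zx, hzx]; rfl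
  · rw [h.mul_zy, hzy]; rfl
  · exact Subtype.ext hφ

section Models

variable {q r s : Subgroup.center G}

theorem model₁ (h2 : ∀ a b : G, Subgroup.closure {a, b} ≠ ⊤) {D : QuadData (ZMod 2)}
    (h : CentralSquares x y z q b c d e f) (hq : q ≠ 1)
    (hx : D.sx = 1) (hy : b = q ^ D.sy.val) (hz : c = q ^ D.sz.val)
    (hyx : q * (b * d) = q ^ D.cyx.val) (hzx : q * (c * e) = q ^ D.czx.val)
    (hzy : b * (c * f) = q ^ D.czy.val) : Nonempty (Quad D ≃* G) := by
  refine h.nonempty_mulEquiv h2 (iota₁ q h.ha) ?_ hy hz hyx hzx hzy ?_ fun φ => ?_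
  · rw [iota₁_apply, hx]; simp [ZMod.val_one]
  · intro φ hφ
    rw [iota₁_apply] at hφ
    rcases (by decide : ∀ i : ZMod 2, i = 0 ∨ i = 1) φ with rfl | rfl
    · rfl
    · simp [ZMod.val_one, hq] at hφ
  · rw [iota₁_apply, Subgroup.coe_pow]
    exact pow_mem (h.coe_mem (by simp)) _

theorem iota₂_injective {hq : q * q = 1} {hr : r * r = 1} {hqr : Commute q r} (q1 : q ≠ 1)
    (r1 : r ≠ 1) (qr : q ≠ r) (φ : ZMod 2 × ZMod 2) (hφ : iota₂ q r hq hr hqr (.ofAdd φ) = 1) :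
    φ = 0 := by
  have qr' : q * r ≠ 1 := fun h' => qr ((eq_inv_of_mul_eq_one_left h').trans
    (inv_eq_of_mul_eq_one_left hr))
  obtain ⟨i, j⟩ := φ
  rw [iota₂_apply] at hφ
  rcases (by decide : ∀ i : ZMod 2, i = 0 ∨ i = 1) i with rfl | rfl <;>
    rcases (by decide : ∀ i : ZMod 2, i = 0 ∨ i = 1) j with rfl | rfl <;>
    simp [ZMod.val_one, q1, r1, qr'] at hφ ⊢

theorem iota₃_injective {hq : q * q = 1} {hr : r * r = 1} {hs : s * s = 1} {hqr : Commute q r}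
    {hqs : Commute q s} {hrs : Commute r s} (q1 : q ≠ 1) (r1 : r ≠ 1) (s1 : s ≠ 1) (qr : q ≠ r)
    (qs : q ≠ s) (rs : r ≠ s) (qrs : q * r * s ≠ 1) (φ : ZMod 2 × ZMod 2 × ZMod 2)
    (hφ : iota₃ q r s hq hr hs hqr hqs hrs (.ofAdd φ) = 1) : φ = 0 := by
  have mul_ne : ∀ {u v : Subgroup.center G}, v * v = 1 → u ≠ v → u * v ≠ 1 :=
    fun hv huv h' => huv ((eq_inv_of_mul_eq_one_left h').trans (inv_eq_of_mul_eq_one_left hv))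
  have qr' := mul_ne hr qr
  have qs' := mul_ne hs qs
  have rs' := mul_ne hs rs
  rw [mul_assoc] at qrs
  obtain ⟨i, j, k⟩ := φ
  rw [iota₃_apply] at hφ
  rcases (by decide : ∀ i : ZMod 2, i = 0 ∨ i = 1) i with rfl | rfl <;>
    rcases (by decide : ∀ i : ZMod 2, i = 0 ∨ i = 1) j with rfl | rfl <;>
    rcases (by decide : ∀ i : ZMod 2, i = 0 ∨ i = 1) k with rfl | rfl <;>
    simp [ZMod.val_one, q1, r1, s1, qr', qs', rs', qrs] at hφ ⊢

theorem admitsORR_Q8C2 (h2 : ∀ a b : G, Subgroup.closure {a, b} ≠ ⊤)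
    (h : CentralSquares x y z q q 1 q q q) (hq : q ≠ 1) : AdmitsORR G := by
  obtain ⟨f⟩ := h.model₁ (D := dataQ8C2) h2 hq rfl (by simp [dataQ8C2, ZMod.val_one])
    (by simp [dataQ8C2]) (by simp [dataQ8C2, h.ha, ZMod.val_one]) (by simp [dataQ8C2, h.ha])
    (by simp [dataQ8C2, h.ha])
  exact admitsORR_dataQ8C2.of_mulEquiv f

theorem nonempty_mulEquiv_Group16 (h2 : ∀ a b : G, Subgroup.closure {a, b} ≠ ⊤)
    (h : CentralSquares x y z q q q q 1 1) (hq : q ≠ 1) : Nonempty (G ≃* Group16) := by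
  obtain ⟨f⟩ := h.swap₂₃.model₁ (D := data16) h2 hq rfl (by simp [data16, ZMod.val_one])
    (by simp [data16, ZMod.val_one]) (by simp [data16, h.ha])
    (by simp [data16, h.ha, ZMod.val_one]) (by simp [data16, h.ha])
  exact ⟨f.symm.trans ORR.nonempty_mulEquiv_Group16.some⟩

theorem nonempty_mulEquiv_C4 (h2 : ∀ a b : G, Subgroup.closure {a, b} ≠ ⊤)
    (h : CentralSquares x y z q 1 1 q q 1) (hq : q ≠ 1) :
    Nonempty (G ≃* C 4 × (Fin 2 → C 2)) := by
  obtain ⟨f⟩ := h.model₁ (D := dataC4) h2 hq rfl (by simp [dataC4])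
    (by simp [dataC4]) (by simp [dataC4, h.ha]) (by simp [dataC4, h.ha]) (by simp [dataC4])
  exact ⟨f.symm.trans ORR.nonempty_mulEquiv_C4.some⟩

theorem admitsORR_32 (h2 : ∀ a b : G, Subgroup.closure {a, b} ≠ ⊤)
    (h : CentralSquares x y z q 1 1 q r 1) (hq : q ≠ 1) (hr : r ≠ 1) (hqr : q ≠ r) :
    AdmitsORR G := by
  obtain ⟨f⟩ := h.nonempty_mulEquiv (D := data32) h2 (iota₂ q r h.ha h.he (Commute.all q r))
    (by simp [data32, iota₂_apply, ZMod.val_one]) (by simp [data32, iota₂_apply])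
    (by simp [data32, iota₂_apply]) (by simp [data32, iota₂_apply, h.ha])
    (by simp [data32, iota₂_apply, ZMod.val_one]) (by simp [data32, iota₂_apply])
    (iota₂_injective hq hr hqr) (fun φ => by
      rw [iota₂_apply, Subgroup.coe_mul, Subgroup.coe_pow, Subgroup.coe_pow]
      exact mul_mem (pow_mem (h.coe_mem (by simp)) _) (pow_mem (h.coe_mem (by simp)) _))
  exact admitsORR_data32.of_mulEquiv f

theorem nonempty_mulEquiv_Group32 (h2 : ∀ a b : G, Subgroup.closure {a, b} ≠ ⊤)
    (h : CentralSquares x y z q r (q * r) 1 1 1) (hq : q ≠ 1) (hr : r ≠ 1) (hqr : q ≠ r) :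
    Nonempty (G ≃* Group32) := by
  obtain ⟨f⟩ := h.nonempty_mulEquiv (D := data32') h2 (iota₂ q r h.ha h.hb (Commute.all q r))
    (by simp [data32', iota₂_apply, ZMod.val_one]) (by simp [data32', iota₂_apply, ZMod.val_one])
    (by simp [data32', iota₂_apply, ZMod.val_one]) (by simp [data32', iota₂_apply, ZMod.val_one])
    (by rw [mul_one, ← mul_assoc, h.ha]; simp [data32', iota₂_apply, ZMod.val_one])
    (by rw [mul_one, mul_left_comm, h.hb]; simp [data32', iota₂_apply, ZMod.val_one])
    (iota₂_injective hq hr hqr) (fun φ => by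
      rw [iota₂_apply, Subgroup.coe_mul, Subgroup.coe_pow, Subgroup.coe_pow]
      exact mul_mem (pow_mem (h.coe_mem (by simp)) _) (pow_mem (h.coe_mem (by simp)) _))
  exact ⟨f.symm.trans ORR.nonempty_mulEquiv_Group32.some⟩

theorem admitsORR_64 (h2 : ∀ a b : G, Subgroup.closure {a, b} ≠ ⊤)
    (h : CentralSquares x y z q 1 1 r s 1) (hq : q ≠ 1) (hr : r ≠ 1) (hs : s ≠ 1) (hqr : q ≠ r)
    (hqs : q ≠ s) (hrs : r ≠ s) (hqrs : q * r * s ≠ 1) : AdmitsORR G := by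
  obtain ⟨f⟩ := h.nonempty_mulEquiv (D := data64) h2
    (iota₃ q r s h.ha h.hd h.he (Commute.all q r) (Commute.all q s) (Commute.all r s))
    (by simp [data64, iota₃_apply, ZMod.val_one]) (by simp [data64, iota₃_apply])
    (by simp [data64, iota₃_apply]) (by simp [data64, iota₃_apply, ZMod.val_one])
    (by simp [data64, iota₃_apply, ZMod.val_one]) (by simp [data64, iota₃_apply])
    (iota₃_injective hq hr hs hqr hqs hrs hqrs) (fun φ => by
      rw [iota₃_apply, Subgroup.coe_mul, Subgroup.coe_mul, Subgroup.coe_pow, Subgroup.coe_pow,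
        Subgroup.coe_pow]
      exact mul_mem (pow_mem (h.coe_mem (by simp)) _) (mul_mem (pow_mem (h.coe_mem (by simp)) _)
        (pow_mem (h.coe_mem (by simp)) _)))
  exact admitsORR_data64.of_mulEquiv f

theorem isGeneralizedDihedral (h2 : ∀ a b : G, Subgroup.closure {a, b} ≠ ⊤)
    (h : CentralSquares x y z q 1 1 q 1 1) : IsGeneralizedDihedral G := by
  have hyx := h.mul_yx
  have hzy := h.mul_zy
  have hz := h.sq_z
  have hxz := h.sq_xz
  simp only [one_mul, h.ha, OneMemClass.coe_one, mul_one] at hyx hzy hz hxz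
  have hzi : z⁻¹ = z := inv_eq_of_mul_eq_one_left hz
  refine isGeneralizedDihedral_of_pair h2 h.generates hyx.symm (by rw [pow_two, hz]) ?_ ?_
  · rw [mul_assoc] at hxz
    rw [hzi, inv_eq_of_mul_eq_one_right hxz, mul_assoc]
  · have hy := h.sq_y
    rw [mul_assoc, ← hzy, inv_mul_cancel_left, inv_eq_of_mul_eq_one_left hy]

/-- The case of a group `⟨y, z⟩` of exponent `2`. -/
theorem isExceptional_of_involutions (h2 : ∀ a b : G, Subgroup.closure {a, b} ≠ ⊤)
    (hD : ¬ IsGeneralizedDihedral G) (hO : ¬ AdmitsORR G)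
    (h : CentralSquares x y z a 1 1 d e 1) (ha : a ≠ 1) : IsExceptional G := by
  -- The squares of `x`, `xy`, `xz`, `xyz` are `a`, `d`, `e`, `ade`. Here they are `a`, `a`, `e`,
  -- `e`.
  have equal : ∀ {x y z : G} {e}, CentralSquares x y z a 1 1 a e 1 → IsExceptional G := by
    intro x y z e h
    by_cases he : e = a
    · subst he
      exact Or.inl (h.nonempty_mulEquiv_C4 h2 ha)
    by_cases he1 : e = 1
    · subst he1
      exact (hD (h.isGeneralizedDihedral h2)).elim
    exact (hO (h.admitsORR_32 h2 ha he1 (Ne.symm he))).elim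
  -- Here the four squares are `a`, `1`, `e`, `ae`. The generators `xz`, `xzy`, `x` have squares
  -- `e`, `ae`, `a`, and their pairwise products have trivial square, as in `Group32`.
  have trivial : ∀ {x y z : G} {e}, CentralSquares x y z a 1 1 1 e 1 → e ≠ a → e ≠ 1 →
      IsExceptional G := by
    intro x y z e h hea he
    have h' := h.swap₂₃.mul₂.swap₁₂.swap₂₃.mul₂
    simp only [mul_one] at h'
    have hprod : e * a * (a * e) = 1 := by
      rw [mul_assoc, ← mul_assoc a, h.ha, one_mul, h.he]
    have hmul : e * (a * e) = a := by rw [mul_left_comm, h.he, mul_one]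
    rw [hprod] at h'
    have hae : a * e ≠ 1 := fun hh => hea (by
      rw [← inv_eq_of_mul_eq_one_right hh, inv_eq_of_mul_eq_one_right h.ha])
    refine Or.inr (Or.inr (Or.inl (CentralSquares.nonempty_mulEquiv_Group32 h2
      (q := e) (r := a * e) (by rw [hmul]; exact h') he hae ?_)))
    intro hh
    exact ha (by simpa using hh)
  by_cases hda : d = a
  · subst hda
    exact equal h
  by_cases hea : e = a
  · subst hea
    exact equal h.swap₂₃
  -- Replacing `z` by `yz` turns the square `e` of `xz` into the square `ade` of `xyz`.
  have h' := h.swap₁₂.mul₃.swap₁₂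
  simp only [mul_one, one_mul] at h'
  by_cases hde : d = e
  · subst hde
    rw [mul_assoc, h.hd, mul_one] at h'
    exact equal h'.swap₂₃
  by_cases hd : d = 1
  · subst hd
    exact trivial h hea (Ne.symm hde)
  by_cases he : e = 1
  · subst he
    exact trivial h.swap₂₃ hda hde
  by_cases hade : a * d * e = 1
  · rw [hade] at h'
    exact trivial h'.swap₂₃ hda hd
  exact (hO (h.admitsORR_64 h2 ha hd he (Ne.symm hda) (Ne.symm hea) hde hade)).elim

end Models

end CentralSquares

variable [Finite G]

/-- In every alternative `y` commutes with `x`, inverts `x` or commutes with `x²`; inversion fixes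
`x²` because `x⁴ = 1`. -/
theorem commute_sq (h2 : ∀ a b : G, Subgroup.closure {a, b} ≠ ⊤)
    (hD : ¬ IsGeneralizedDihedral G) (hO : ¬ AdmitsORR G) {x y z : G} (h : Generates x y z)
    (hx : x ^ 4 = 1) : Commute (x * x) y := by
  have hinv : x * x = (x * x)⁻¹ := eq_inv_of_mul_eq_one_left (mul_self_mul_self hx)
  have key : x * y = y * x⁻¹ → Commute (x * x) y := by
    intro hc
    have : x * x * y = y * (x * x)⁻¹ := by rw [mul_assoc, hc, ← mul_assoc, hc]; group
    rwa [← hinv] at this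
  by_cases hx2 : x ^ 2 = 1
  · rw [← pow_two, hx2]
    exact Commute.one_left y
  rcases pair_cases h2 hD hO h hx2 with hc | ⟨-, hc⟩ | ⟨hc, -⟩ | ⟨-, -, hc⟩
  · exact hc.mul_left hc
  · exact key hc
  · exact key hc
  · rwa [← pow_two]

theorem exists_centralSquares (h2 : ∀ a b : G, Subgroup.closure {a, b} ≠ ⊤)
    (hD : ¬ IsGeneralizedDihedral G) (hO : ¬ AdmitsORR G)
    (h4 : ∀ x y z : G, Generates x y z → x ^ 4 = 1) {x y z : G} (h : Generates x y z) :
    ∃ a b c d e f, CentralSquares x y z a b c d e f := by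
  have sq : ∀ {x y z : G}, Generates x y z → ∃ a : Subgroup.center G, x * x = a ∧ a * a = 1 := by
    intro x y z h
    have hc := h.central ((Commute.refl x).mul_left (Commute.refl x))
      (commute_sq h2 hD hO h (h4 _ _ _ h)) (commute_sq h2 hD hO h.swap₂₃ (h4 _ _ _ h))
    exact ⟨⟨x * x, Subgroup.mem_center_iff.2 fun g => (hc g).symm.eq⟩, rfl,
      Subtype.ext (mul_self_mul_self (h4 _ _ _ h))⟩
  obtain ⟨a, ha, ha2⟩ := sq h
  obtain ⟨b, hb, hb2⟩ := sq h.swap₁₂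
  obtain ⟨c, hc, hc2⟩ := sq h.swap₂₃.swap₁₂
  obtain ⟨d, hd, hd2⟩ := sq (h.swap₂₃.mul₃_left (left_mem _ _)).swap₂₃.swap₁₂
  obtain ⟨e, he, he2⟩ := sq (h.mul₃_left (left_mem _ _)).swap₂₃.swap₁₂
  obtain ⟨f, hf, hf2⟩ := sq (h.mul₃_left (right_mem _ _)).swap₂₃.swap₁₂
  exact ⟨a, b, c, d, e, f, h, ha, hb, hc, hd, he, hf, ha2, hb2, hc2, hd2, he2, hf2⟩

namespace CentralSquares

variable {x y z : G} {a b c d e f q : Subgroup.center G}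

/-- Of the elements `x`, `y`, `x * y` one is an involution, or their squares coincide. -/
theorem line (h2 : ∀ a b : G, Subgroup.closure {a, b} ≠ ⊤)
    (hD : ¬ IsGeneralizedDihedral G) (hO : ¬ AdmitsORR G)
    (h : CentralSquares x y z a b c d e f) : a = 1 ∨ b = 1 ∨ d = 1 ∨ (a = b ∧ b = d) := by
  by_contra! hne
  obtain ⟨a1, b1, d1, hq⟩ := hne
  obtain ⟨w, hw, hw2⟩ := exists_completion hD h2 h.generates
  have ne : ∀ {g : G} {s : Subgroup.center G}, g * g = s → s ≠ 1 → g ^ 2 ≠ 1 := by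
    intro g s hg hs hg2
    rw [pow_two, hg] at hg2
    exact hs (Subtype.ext hg2)
  have x2 := ne h.sq_x a1
  have y2 := ne h.sq_y b1
  have x4 : x ^ 4 = 1 := by
    rw [show 4 = 2 * 2 from rfl, pow_mul, pow_two x, h.sq_x, pow_two]
    exact_mod_cast h.ha
  by_cases hc : Commute x y
  · refine hO (admitsORR_of_commute h2 hw hw2 hc x2 ?_ y2 (ne h.sq_xy d1) ?_)
    · intro x3
      rw [pow_succ, x3, one_mul] at x4
      exact x2 (by rw [x4, one_pow])
    · rwa [(hc.pow_left 2).mul_pow, ← pow_mul, x4, one_mul]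
  · refine hO (admitsORR_of_pair h2 hw x2 y2 ?_ hw2 hc ?_)
    · have hi : x⁻¹ = x * a := inv_eq_of_mul_eq_one_right (by
        rw [← mul_assoc, h.sq_x]; exact_mod_cast h.ha)
      have ha : (a : G) * a = 1 := by exact_mod_cast h.ha
      -- As `x⁻¹ = xa` with `a` central of trivial square, `(yx⁻¹)² = (yx)² = d`.
      refine ne (s := d) ?_ d1
      rw [hi, ← mul_assoc y, (center_commute a _).mul_mul_mul_comm, ha, mul_one,
        mul_self_comm h.sq_xy]
    · rintro ⟨hxy, hxx⟩
      rw [pow_two, pow_two, h.sq_x, h.sq_y] at hxx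
      have hab : a = b := Subtype.ext hxx
      refine hq hab (Subtype.ext ?_)
      rw [← h.sq_xy, ← h.sq_y]
      nth_rewrite 1 [hxy]
      group

/-- The case of a quaternion subgroup `⟨x, y⟩`. -/
theorem isExceptional_of_quaternion (h2 : ∀ a b : G, Subgroup.closure {a, b} ≠ ⊤)
    (hD : ¬ IsGeneralizedDihedral G) (hO : ¬ AdmitsORR G)
    (h : CentralSquares x y z q q c q e f) (hq : q ≠ 1) : IsExceptional G := by
  have prod : ∀ c e f : Subgroup.center G, q * q * c * q * e * f = q * c * e * f := by
    intro c e f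
    rw [h.ha, one_mul, mul_comm c q]
  -- If `c` is neither, the lines joining `z` to `x`, `y` and `xy` force `xz`, `yz` and `xyz` to
  -- have trivial squares; then `qc = 1` and `c = q`.
  have key : ∀ {x y z : G} {c e f}, CentralSquares x y z q q c q e f → c = 1 ∨ c = q := by
    intro x y z c e f h
    by_contra! hc
    have he : e = 1 := by
      rcases h.swap₂₃.line h2 hD hO with h' | h' | h' | h'
      exacts [(hq h').elim, (hc.1 h').elim, h', (hc.2 h'.1.symm).elim]
    have hf : f = 1 := by
      rcases h.swap₁₂.swap₂₃.line h2 hD hO with h' | h' | h' | h'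
      exacts [(hq h').elim, (hc.1 h').elim, h', (hc.2 h'.1.symm).elim]
    have hg : q * q * c * q * e * f = 1 := by
      rcases h.mul₂.swap₁₂.swap₂₃.line h2 hD hO with h' | h' | h' | h'
      exacts [(hq h').elim, (hc.1 h').elim, h', (hc.2 h'.1.symm).elim]
    rw [prod, he, hf, mul_one, mul_one] at hg
    exact hc.2 (by rw [← inv_eq_of_mul_eq_one_right hg, inv_eq_of_mul_eq_one_right h.ha])
  have fin : ∀ {x y z : G} {c e f}, CentralSquares x y z q q c q e f →
      (c = 1 ∧ e = q ∧ f = q) ∨ (c = q ∧ e = 1 ∧ f = 1) → IsExceptional G := by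
    rintro x y z c e f h (⟨rfl, rfl, rfl⟩ | ⟨rfl, rfl, rfl⟩)
    · exact (hO (h.admitsORR_Q8C2 h2 hq)).elim
    · exact Or.inr (Or.inr (Or.inr (h.nonempty_mulEquiv_Group16 h2 hq)))
  have hqq := h.ha
  have h' := h.mul₃
  have h'' := h.swap₁₂.mul₃
  rw [prod] at h' h''
  have huv := h'.swap₁₂.mul₃
  rw [prod] at huv
  -- The squares of `z`, `xz`, `yz`, `xyz` lie in `{1, q}` and have product `q`, so exactly one
  -- differs from the other three. Taking that element as third generator gives one of the patterns
  -- of `fin`.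
  rcases key h with rfl | rfl <;> rcases key h' with rfl | rfl <;>
    rcases key h'' with rfl | rfl <;>
    first
    | (refine fin h ?_; simp; done)
    | (refine fin h' ?_; simp [hqq]; done)
    | (refine fin h'' ?_; simp [hqq]; done)
    | (refine fin huv ?_; simp [hqq])

/-- Without a quaternion pair every line of the Fano plane has a point of trivial square. This
allows `y` and `z` to be chosen with trivial squares, and then so that `yz` has trivial square too.
-/
theorem isExceptional (h2 : ∀ a b : G, Subgroup.closure {a, b} ≠ ⊤)
    (hD : ¬ IsGeneralizedDihedral G) (hO : ¬ AdmitsORR G)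
    (h : CentralSquares x y z a b c d e f) (ha : a ≠ 1) : IsExceptional G := by
  by_cases hQ : ∃ (x y z : G) (q c e f : Subgroup.center G),
      CentralSquares x y z q q c q e f ∧ q ≠ 1
  · obtain ⟨_, _, _, _, _, _, _, h', hq⟩ := hQ
    exact h'.isExceptional_of_quaternion h2 hD hO hq
  have line' : ∀ {x y z : G} {a b c d e f}, CentralSquares x y z a b c d e f → a ≠ 1 →
      b = 1 ∨ d = 1 := by
    intro x y z a b c d e f h ha
    rcases h.line h2 hD hO with h' | h' | h' | ⟨rfl, rfl⟩
    · exact (ha h').elim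
    · exact Or.inl h'
    · exact Or.inr h'
    · exact (hQ ⟨_, _, _, _, _, _, _, h, ha⟩).elim
  obtain ⟨y, c, d, e, f, h⟩ : ∃ y c d e f, CentralSquares x y z a 1 c d e f := by
    rcases line' h ha with rfl | rfl
    · exact ⟨_, _, _, _, _, h⟩
    · exact ⟨_, _, _, _, _, h.mul₂⟩
  obtain ⟨z, d, e, f, h⟩ : ∃ z d e f, CentralSquares x y z a 1 1 d e f := by
    rcases line' h.swap₂₃ ha with rfl | rfl
    · exact ⟨_, _, _, _, h⟩
    · exact ⟨_, _, _, _, h.mul₃⟩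
  by_cases hf : f = 1
  · subst hf
    exact h.isExceptional_of_involutions h2 hD hO ha
  have hyz := h.swap₁₂.mul₃.swap₁₂
  simp only [mul_one, one_mul] at hyz
  have hxyz : a * d * e * f = 1 := by
    rcases line' hyz.swap₂₃ ha with h' | h'
    · exact (hf h').elim
    · rw [← h']; ac_rfl
  have hxyz' : a * d * f * e = 1 := by rw [← hxyz]; ac_rfl
  -- This is the line through `xy`, `yz` and `xz`, where `yz` has square `f ≠ 1`.
  have hline : d = 1 ∨ e = 1 := by
    by_contra! hne
    have hmix := h.swap₁₂.mul₂.mul₃.swap₁₂.swap₂₃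
    simp only [mul_one, one_mul, hxyz'] at hmix
    rcases line' hmix hne.1 with h' | h'
    · exact hf h'
    · rw [mul_comm d a] at h'
      rw [h', one_mul] at hxyz'
      exact hne.2 hxyz'
  rcases hline with rfl | rfl
  -- With `xy` in place of `y`, the product with `z` is `xyz`, whose square is trivial by `hxyz`.
  · have h' := h.mul₂
    simp only [mul_one] at h' hxyz
    rw [hxyz] at h'
    exact h'.isExceptional_of_involutions h2 hD hO ha
  · have h' := h.swap₂₃.mul₂
    simp only [mul_one] at h' hxyz
    rw [hxyz] at h'
    exact h'.isExceptional_of_involutions h2 hD hO ha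

end CentralSquares
end OrderFour

/-! ### The classification -/

section Classification

variable {G : Type*} [Group G] [Finite G]

theorem isExceptional_of_generates (h2 : ∀ a b : G, Subgroup.closure {a, b} ≠ ⊤)
    (hD : ¬ IsGeneralizedDihedral G) (hO : ¬ AdmitsORR G) {x y z : G} (h : Generates x y z) :
    IsExceptional G := by
  by_cases h4 : ∀ x y z : G, Generates x y z → x ^ 4 = 1
  · obtain ⟨w, hw, hw2⟩ := exists_completion hD h2 h
    -- The generator `w` with `w² ≠ 1` is moved to the first place, so that `a ≠ 1`.
    obtain ⟨a, _, _, _, _, _, h'⟩ := exists_centralSquares h2 hD hO h4 hw.swap₂₃.swap₁₂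
    refine h'.isExceptional h2 hD hO fun ha => hw2 ?_
    rw [pow_two, h'.sq_x, ha, OneMemClass.coe_one]
  · push Not at h4
    obtain ⟨x, y, z, h, hx⟩ := h4
    exact Or.inr (Or.inl ((nonempty_mulEquiv_of_pow_four_ne_one h2 hD hO h hx).map MulEquiv.symm))

theorem exists_generates {G : Type*} [Group G] [Group.FG G] (hG : Group.rank G = 3) :
    ∃ x y z : G, Generates x y z := by
  classical
  obtain ⟨S, hS, hcl⟩ := Group.rank_spec G
  rw [hG, Finset.card_eq_three] at hS
  obtain ⟨x, y, z, -, -, -, rfl⟩ := hS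
  exact ⟨x, y, z, by simpa [Generates] using hcl⟩

theorem closure_pair_ne_top {G : Type*} [Group G] [Group.FG G] (hG : Group.rank G = 3)
    (a b : G) :
    Subgroup.closure {a, b} ≠ ⊤ := by
  classical
  intro h
  have h1 : Group.rank G ≤ ({a, b} : Finset G).card := Group.rank_le (by simpa using h)
  have h3 := h1.trans Finset.card_le_two
  omega

end Classification
end ORR

theorem theorem3p12 :
    (∀ (G : Type*) [Group G] [Finite G], Group.rank G = 3 →
      (ORR.IsGeneralizedDihedral G ∨ ORR.AdmitsORR G ∨ ORR.IsExceptional G) ∧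
      (ORR.IsGeneralizedDihedral G → ¬ ORR.AdmitsORR G)) ∧
    (∀ (G : Type*) [Group G], ORR.IsExceptional G → ¬ ORR.AdmitsORR G) ∧
    Nat.card ORR.Group32 = 32 ∧ Nat.card ORR.Group16 = 16 := by
  refine ⟨fun G _ _ hG => ?_, fun G _ hG => hG.not_admitsORR, ORR.card_Group32, ORR.card_Group16⟩
  have h2 := ORR.closure_pair_ne_top hG
  obtain ⟨x, y, z, h⟩ := ORR.exists_generates hG
  refine ⟨?_, fun hD => ORR.not_admitsORR_of_isGeneralizedDihedral hD h2⟩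
  by_cases hD : ORR.IsGeneralizedDihedral G
  · exact Or.inl hD
  by_cases hO : ORR.AdmitsORR G
  · exact Or.inr (Or.inl hO)
  exact Or.inr (Or.inr (ORR.isExceptional_of_generates h2 hD hO h))
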